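/- Let $k\ge 1$ be an integer and let $X=(X(t))_{t\ge 0}$ be a real Lévy process (with càdlàg paths and $X(0)=0$). Let $U,U_1,\dots,U_k$ be standard uniform random variables, $B$ a standard Brownian bridge on $[0,1]$ and $\beta_1,\dots,\beta_k$ Brownian bridges on $[0,1/k]$ (continuous centred Gaussian processes on $[0,T]$ with covariance $s(T-t)/T$, $s\le t$, where $T=1$ and $T=1/k$, respectively), such that $X,U,U_1,\dots,U_k,B,\beta_1,\dots,\beta_k$ are mutually independent. For a process $Y$ write $\Delta_i^kY=Y(i/k)-Y((i-1)/k)$, $1\le i\le k$. Reordering of increments. Let $h:\mathbb R^2\to\mathbb R$ be any measurable function such that $h(X(1),U)$ is standard normal, and put $W'(t)=B(t)+t\,h(X(1),U)$, $t\in[0,1]$. Let $\pi$ be the a.s. unique random permutation of $\{1,\dots,k\}$ such that a.s. for all $i\ne j$ $$\Delta^k_{\pi(i)}W'<\Delta^k_{\pi(j)}W'\iff \Delta_i^kX<\Delta_j^kX\ \text{ or }\ \bigl(\Delta_i^kX=\Delta_j^kX\text{ and }U_i<U_j\bigr).$$ Define $W(0)=0$ and, for $\frac{i-1}{k}<t\le\frac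 ik$, $i=1,\dots,k$, $$W(t)=W\bigl(\tfrac{i-1}{k}\bigr)+W'\bigl(\tfrac{\pi(i)-1}{k}+t-\tfrac{i-1}{k}\bigr)-W'\bigl(\tfrac{\pi(i)-1}{k}\bigr).$$ Comonotonic coupling of increments. Let $\Phi_k^{-1}(p)=\inf\{x:\Phi_k(x)\ge p\}$ be the left inverse of the distribution function $\Phi_k$ of the normal law with mean $0$ and variance $1/k$, let $h_k(x,u)=\Phi_k^{-1}\bigl(\mathbb P(X(1/k)<x)+u\,\mathbb P(X(1/k)=x)\bigr)$ and $\xi_i=h_k(\Delta_i^kX,U_i)$. Define $\widehat W(0)=0$ and, for $\frac{i-1}{k}<t\le\frac ik$, $i=1,\dots,k$, $$\widehat W(t)=\widehat W\bigl(\tfrac{i-1}{k}\bigr)+\beta_i\bigl(t-\tfrac{i-1}{k}\bigr)+k\bigl(t-\tfrac{i-1}{k}\bigr)\xi_i.$$ Then $$\mathbb E\sup_{t\in[0,1]}\bigl|[W(t)-tW(1)]-[\widehat W(t)-t\widehat W(1)]\bigr|^2=\mathrm O(\log k/k),\qquad k\to\infty,$$ uniformly over all Lévy processes $X$ (and all admissible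 $h$): there are absolute constants $C$ and $k_0$ such that the left-hand side is at most $C\log k/k$ for every $k\ge k_0$ and every choice of the above objects. -/

import Mathlib

open MeasureTheory ProbabilityTheory Filter Topology
open scoped NNReal ENNReal

noncomputable section

/-- A real Lévy process on `[0, ∞)`: it starts at `0`, has independent and stationary increments
and almost surely càdlàg paths. -/
structure IsLevyProcess {Ω : Type*} [MeasurableSpace Ω] (X : ℝ≥0 → Ω → ℝ) (P : Measure Ω) :
    Prop where
  measurable : ∀ t, Measurable (X t)
  start_zero : ∀ᵐ ω ∂P, X 0 ω = 0
  indep_increments : HasIndepIncrements X P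
  stationary_increments : ∀ s t : ℝ≥0, IdentDistrib (fun ω ↦ X (s + t) ω - X s ω) (X t) P P
  cadlag : ∀ᵐ ω ∂P, ∀ t : ℝ≥0,
    ContinuousWithinAt (fun s ↦ X s ω) (Set.Ici t) t ∧
      ∃ l : ℝ, Tendsto (fun s ↦ X s ω) (𝓝[<] t) (𝓝 l)

/-- A Brownian bridge from `0` to `0` on the time interval `[0, T]`: a centred Gaussian process with
covariance `s (T - t) / T` for `s ≤ t` and almost surely continuous paths. Only the values at times
in `[0, T]` matter. -/
structure IsBrownianBridge {Ω : Type*} [MeasurableSpace Ω] (T : ℝ) (b : ℝ → Ω → ℝ)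
    (P : Measure Ω) : Prop where
  measurable : ∀ t ∈ Set.Icc 0 T, Measurable (b t)
  gaussian : IsGaussianProcess (fun t : Set.Icc 0 T ↦ b t) P
  mean_zero : ∀ t ∈ Set.Icc 0 T, ∫ ω, b t ω ∂P = 0
  covariance : ∀ s ∈ Set.Icc 0 T, ∀ t ∈ Set.Icc 0 T, s ≤ t →
    cov[b s, b t; P] = s * (T - t) / T
  continuous : ∀ᵐ ω ∂P, ContinuousOn (fun t ↦ b t ω) (Set.Icc 0 T)

/-- The left inverse `F⁻¹(p) = inf {x | p ≤ F x}` of the distribution function of `ν`. -/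
def quantile (ν : Measure ℝ) (p : ℝ) : ℝ := sInf {x : ℝ | p ≤ cdf ν x}

/-- The function `h(x, u) = F_ν⁻¹(μ(-∞, x) + u μ{x})`: if `ζ` has law `μ` and `U` is an independent
standard uniform, then `h(ζ, U)` has law `ν` and is comonotonically coupled with `ζ`. -/
def comonotoneMap (μ ν : Measure ℝ) (x u : ℝ) : ℝ :=
  quantile ν (μ.real (Set.Iio x) + u * μ.real {x})

/-- The `i`-th increment over the grid of mesh `1/k` of a process on `[0, ∞)`
(`i` runs from `0` to `k - 1`). -/
def levyIncrement {Ω : Type*} (k : ℕ) (X : ℝ≥0 → Ω → ℝ) (i : Fin k) (ω : Ω) : ℝ :=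
  X (((i : ℕ) + 1 : ℝ≥0) / k) ω - X (((i : ℕ) : ℝ≥0) / k) ω

/-- The `i`-th increment over the grid of mesh `1/k` of a process with real time parameter
(`i` runs from `0` to `k - 1`). -/
def pathIncrement {Ω : Type*} (k : ℕ) (Y : ℝ → Ω → ℝ) (i : Fin k) (ω : Ω) : ℝ :=
  Y (((i : ℕ) + 1 : ℝ) / k) ω - Y (((i : ℕ) : ℝ) / k) ω

/-- Concatenation of `k` pieces of path, the `i`-th piece `f i` being run through on the time
interval `(i/k, (i+1)/k]`. See `concatPath_zero` and `concatPath_step` for the recursion. -/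
def concatPath (k : ℕ) (f : Fin k → ℝ → ℝ) (t : ℝ) : ℝ :=
  ∑ i : Fin k, if ((i : ℕ) : ℝ) / k < t then f i (min (t - ((i : ℕ) : ℝ) / k) (1 / k)) else 0

theorem concatPath_zero (k : ℕ) (f : Fin k → ℝ → ℝ) : concatPath k f 0 = 0 := by
  refine Finset.sum_eq_zero fun i _ ↦ if_neg (not_lt.mpr (by positivity))

theorem concatPath_step (k : ℕ) (f : Fin k → ℝ → ℝ) (i : Fin k) (t : ℝ)
    (h₁ : ((i : ℕ) : ℝ) / k < t) (h₂ : t ≤ ((i : ℕ) + 1 : ℝ) / k) :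
    concatPath k f t = concatPath k f (((i : ℕ) : ℝ) / k) + f i (t - ((i : ℕ) : ℝ) / k) := by
  have hk : (0 : ℝ) < k := by exact_mod_cast i.pos
  have key : ∀ j : Fin k,
      (if ((j : ℕ) : ℝ) / k < t then f j (min (t - ((j : ℕ) : ℝ) / k) (1 / k)) else 0)
      = (if ((j : ℕ) : ℝ) / k < ((i : ℕ) : ℝ) / k then
          f j (min (((i : ℕ) : ℝ) / k - ((j : ℕ) : ℝ) / k) (1 / k)) else 0)
        + if j = i then f i (t - ((i : ℕ) : ℝ) / k) else 0 := by
    intro j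
    rw [add_div] at h₂
    rcases lt_trichotomy j i with h | rfl | h
    · have h' : ((j : ℕ) : ℝ) + 1 ≤ (i : ℕ) := by exact_mod_cast h
      have h'' : ((j : ℕ) : ℝ) / k + 1 / k ≤ ((i : ℕ) : ℝ) / k := by
        rw [← add_div]; gcongr
      have hpos : (0 : ℝ) < 1 / k := by positivity
      rw [if_pos (by linarith), if_pos (by linarith), if_neg h.ne,
        min_eq_right (by linarith), min_eq_right (by linarith), add_zero]
    · rw [if_pos h₁, if_neg (lt_irrefl _), if_pos rfl, zero_add, min_eq_left (by linarith)]
    · have h' : ((i : ℕ) : ℝ) + 1 ≤ (j : ℕ) := by exact_mod_cast h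
      have h'' : ((i : ℕ) : ℝ) / k + 1 / k ≤ ((j : ℕ) : ℝ) / k := by
        rw [← add_div]; gcongr
      have hpos : (0 : ℝ) < 1 / k := by positivity
      rw [if_neg (by linarith), if_neg (by linarith), if_neg h.ne', add_zero]
  unfold concatPath
  rw [Finset.sum_congr rfl fun j _ ↦ key j, Finset.sum_add_distrib]
  simp

/-- Labels for the mutually independent sources of randomness. -/
inductive Source (k : ℕ) : Type where
  | levy : Source k
  | endpoint : Source k
  | bridge : Source k
  | tie (i : Fin k) : Source k
  | interval (i : Fin k) : Source k

/-- The σ-algebra generated by each of the sources of randomness. -/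
def sourceSigma {Ω : Type*} {k : ℕ} (X : ℝ≥0 → Ω → ℝ) (U : Ω → ℝ) (B : ℝ → Ω → ℝ)
    (V : Fin k → Ω → ℝ) (β : Fin k → ℝ → Ω → ℝ) : Source k → MeasurableSpace Ω
  | .levy => MeasurableSpace.comap (fun ω (t : ℝ≥0) ↦ X t ω) inferInstance
  | .endpoint => MeasurableSpace.comap U inferInstance
  | .bridge => MeasurableSpace.comap (fun ω (t : Set.Icc (0 : ℝ) 1) ↦ B t ω) inferInstance
  | .tie i => MeasurableSpace.comap (V i) inferInstance
  | .interval i =>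
      MeasurableSpace.comap (fun ω (t : Set.Icc (0 : ℝ) (1 / k)) ↦ β i t ω) inferInstance

/-- The ingredients of the two constructions with `k` increments: a Lévy process `X`, standard
uniforms `U, V 0, …, V (k - 1)`, a Brownian bridge `B` on `[0, 1]` and Brownian bridges
`β 0, …, β (k - 1)` on `[0, 1/k]`, all mutually independent, and a measurable function `h` for which
`h(X(1), U)` is standard normal; `h` encodes an arbitrary coupling of the end-points. -/
structure CouplingInput {Ω : Type*} [MeasurableSpace Ω] (k : ℕ) (P : Measure Ω) where
  X : ℝ≥0 → Ω → ℝ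
  U : Ω → ℝ
  B : ℝ → Ω → ℝ
  V : Fin k → Ω → ℝ
  β : Fin k → ℝ → Ω → ℝ
  h : ℝ × ℝ → ℝ
  levy : IsLevyProcess X P
  measurable_U : Measurable U
  uniform_U : pdf.IsUniform U (Set.Icc 0 1) P
  bridge_B : IsBrownianBridge 1 B P
  measurable_V : ∀ i, Measurable (V i)
  uniform_V : ∀ i, pdf.IsUniform (V i) (Set.Icc 0 1) P
  bridge_β : ∀ i, IsBrownianBridge (1 / k) (β i) P
  indep : iIndep (sourceSigma X U B V β) P
  measurable_h : Measurable h
  law_h : HasLaw (fun ω ↦ h (X 1 ω, U ω)) (gaussianReal 0 1) P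

namespace CouplingInput

variable {Ω : Type*} [MeasurableSpace Ω] {k : ℕ} {P : Measure Ω}

/-- The Brownian motion `W'` on `[0, 1]` with end-point `h(X(1), U)` and bridge `B`. -/
def W' (S : CouplingInput k P) (t : ℝ) (ω : Ω) : ℝ :=
  S.B t ω + t * S.h (S.X 1 ω, S.U ω)

/-- `π` is the (almost surely unique) random permutation for which the reordered increments
`Δ_{π(i)} W'` have the same ordering as the increments `Δ_i X`, with ties among the latter
resolved by the uniforms. -/
structure IsOrderMatching (S : CouplingInput k P) (π : Ω → Equiv.Perm (Fin k)) : Prop where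
  measurable : ∀ σ : Equiv.Perm (Fin k), MeasurableSet {ω | π ω = σ}
  order : ∀ᵐ ω ∂P, ∀ i j : Fin k, i ≠ j →
    (pathIncrement k S.W' (π ω i) ω < pathIncrement k S.W' (π ω j) ω ↔
      levyIncrement k S.X i ω < levyIncrement k S.X j ω ∨
        (levyIncrement k S.X i ω = levyIncrement k S.X j ω ∧ S.V i ω < S.V j ω))

/-- The reordering Brownian motion: the pieces of `W'` over the grid intervals, put in the order
prescribed by `π`. -/
def W (S : CouplingInput k P) (π : Ω → Equiv.Perm (Fin k)) (t : ℝ) (ω : Ω) : ℝ :=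
  concatPath k (fun i s ↦ S.W' (((π ω i : ℕ) : ℝ) / k + s) ω - S.W' (((π ω i : ℕ) : ℝ) / k) ω) t

/-- The normal increment comonotonically coupled with the `i`-th increment of `X`. -/
def ξ (S : CouplingInput k P) (i : Fin k) (ω : Ω) : ℝ :=
  comonotoneMap (P.map (S.X (1 / k))) (gaussianReal 0 (1 / k)) (levyIncrement k S.X i ω) (S.V i ω)

/-- The comonotone-increment Brownian motion `Ŵ`. -/
def What (S : CouplingInput k P) (t : ℝ) (ω : Ω) : ℝ :=
  concatPath k (fun i s ↦ S.β i s ω + k * s * S.ξ i ω) t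

/-- The squared maximal distance over `[0, 1]` between the bridges of `W` and `Ŵ`. -/
def supSqBridgeDist (S : CouplingInput k P) (π : Ω → Equiv.Perm (Fin k)) (ω : Ω) : ℝ≥0∞ :=
  ⨆ t ∈ Set.Icc (0 : ℝ) 1,
    ENNReal.ofReal (|(S.W π t ω - t * S.W π 1 ω) - (S.What t ω - t * S.What 1 ω)| ^ 2)

end CouplingInput

end

noncomputable section

section Sampling

/-- The running maximum of a real sequence. -/
def runMax (a : ℕ → ℝ) : ℕ → ℝ
  | 0 => a 0
  | n + 1 => max (runMax a n) (a (n + 1))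

theorem le_runMax (a : ℕ → ℝ) {m n : ℕ} (h : m ≤ n) : a m ≤ runMax a n := by
  induction n with
  | zero => obtain rfl : m = 0 := by omega
            exact le_rfl
  | succ n ih =>
    rcases Nat.lt_or_ge n m with h' | h'
    · obtain rfl : m = n + 1 := by omega
      exact le_max_right _ _
    · exact (ih h').trans (le_max_left _ _)

theorem runMax_congr {a b : ℕ → ℝ} {n : ℕ} (h : ∀ m ≤ n, a m = b m) : runMax a n = runMax b n := by
  induction n with
  | zero => exact h 0 le_rfl
  | succ n ih => simp only [runMax, ih fun m hm ↦ h m (by omega), h (n + 1) le_rfl]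

/-- Pathwise form of Doob's `L²` maximal inequality. -/
theorem sum_runMax_mul_sub_le (a : ℕ → ℝ) (h₀ : a 0 = 0) (n : ℕ) :
    ∑ i ∈ Finset.range n, runMax a i * (a (i + 1) - a i) ≤
      runMax a n * a n - runMax a n ^ 2 / 2 := by
  induction n with
  | zero => simp [runMax, h₀]
  | succ n ih =>
    rw [Finset.sum_range_succ]
    rcases le_total (a (n + 1)) (runMax a n) with h | h
    · simp only [runMax, max_eq_left h]; nlinarith
    · simp only [runMax, max_eq_right h]; nlinarith [sq_nonneg (a (n + 1) - runMax a n)]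

variable {k : ℕ}

/-- The `m`-th value drawn when sampling `d` without replacement in the order `σ`. -/
def draw (d : Fin k → ℝ) (σ : Equiv.Perm (Fin k)) (m : ℕ) : ℝ :=
  if h : m < k then d (σ ⟨m, h⟩) else 0

/-- The partial sums of a sample without replacement. -/
def drawSum (d : Fin k → ℝ) (σ : Equiv.Perm (Fin k)) (m : ℕ) : ℝ :=
  ∑ j ∈ Finset.range m, draw d σ j

/-- The martingale attached to sampling without replacement from a centred population. -/
def drawMart (d : Fin k → ℝ) (σ : Equiv.Perm (Fin k)) (m : ℕ) : ℝ :=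
  drawSum d σ m / ((k : ℝ) - m)

theorem draw_mul_swap (d : Fin k → ℝ) (σ : Equiv.Perm (Fin k)) {i l : Fin k} (h : i ≤ l) {m : ℕ}
    (hm : m < i) : draw d (σ * Equiv.swap i l) m = draw d σ m := by
  have hmk : m < k := by omega
  simp only [draw, hmk, dite_true, Equiv.Perm.mul_apply]
  rw [Equiv.swap_apply_of_ne_of_ne]
  · intro h'; simp only [Fin.ext_iff] at h'; omega
  · intro h'; simp only [Fin.ext_iff, Fin.le_def] at h' h; omega

theorem drawSum_mul_swap (d : Fin k → ℝ) (σ : Equiv.Perm (Fin k)) {i l : Fin k} (h : i ≤ l)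
    {m : ℕ} (hm : m ≤ i) : drawSum d (σ * Equiv.swap i l) m = drawSum d σ m :=
  Finset.sum_congr rfl fun j hj ↦ draw_mul_swap d σ h (by simp at hj; omega)

theorem drawMart_mul_swap (d : Fin k → ℝ) (σ : Equiv.Perm (Fin k)) {i l : Fin k} (h : i ≤ l)
    {m : ℕ} (hm : m ≤ i) : drawMart d (σ * Equiv.swap i l) m = drawMart d σ m := by
  simp only [drawMart, drawSum_mul_swap d σ h hm]

theorem drawSum_eq_sum_filter (d : Fin k → ℝ) (σ : Equiv.Perm (Fin k)) {m : ℕ} (hm : m ≤ k) :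
    drawSum d σ m = ∑ j : Fin k with j.val < m, d (σ j) := by
  have h1 : drawSum d σ m = ∑ j ∈ Finset.range k, if j < m then draw d σ j else 0 := by
    rw [← Finset.sum_filter]
    refine Finset.sum_congr ?_ fun _ _ ↦ rfl
    ext j; simp; omega
  rw [h1, Finset.sum_filter, ← Fin.sum_univ_eq_sum_range (fun j ↦ if j < m then draw d σ j else 0)]
  refine Finset.sum_congr rfl fun j _ ↦ ?_
  simp [draw]

theorem sum_perm_mul_draw (d : Fin k → ℝ) (hd : ∑ j, d j = 0) (i : Fin k)
    (φ : Equiv.Perm (Fin k) → ℝ)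
    (hφ : ∀ σ, ∀ l, i ≤ l → φ (σ * Equiv.swap i l) = φ σ) :
    ∑ σ, φ σ * (draw d σ i + drawSum d σ i / ((k : ℝ) - i)) = 0 := by
  have hik : (0 : ℝ) < (k : ℝ) - (i : ℕ) := by
    have : ((i : ℕ) : ℝ) < k := by exact_mod_cast i.2
    linarith
  have h1 : ∀ l, i ≤ l → ∑ σ, φ σ * d (σ l) = ∑ σ, φ σ * d (σ i) := by
    intro l hl
    rw [← Equiv.sum_comp (Equiv.mulRight (Equiv.swap i l)) (fun σ ↦ φ σ * d (σ l))]
    refine Finset.sum_congr rfl fun σ _ ↦ ?_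
    simp [hφ σ l hl]
  have h2 : ∀ σ : Equiv.Perm (Fin k), drawSum d σ i = - ∑ l : Fin k with i ≤ l, d (σ l) := by
    intro σ
    rw [drawSum_eq_sum_filter d σ i.2.le, eq_neg_iff_add_eq_zero, ← hd, ← Equiv.sum_comp σ d,
      ← Finset.sum_filter_add_sum_filter_not Finset.univ (fun j : Fin k ↦ (j : ℕ) < i)]
    simp only [not_lt, Fin.le_def]
  have hcard : ((Finset.univ.filter fun l : Fin k ↦ i ≤ l).card : ℝ) = (k : ℝ) - (i : ℕ) := by
    have : (Finset.univ.filter fun l : Fin k ↦ i ≤ l) = Finset.Ici i := by ext; simp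
    rw [this, Fin.card_Ici, Nat.cast_sub i.2.le]
  have h3 : ∑ σ, φ σ * drawSum d σ i = - (((k : ℝ) - (i : ℕ)) * ∑ σ, φ σ * d (σ i)) := by
    simp_rw [h2, mul_neg, Finset.sum_neg_distrib, Finset.mul_sum]
    rw [Finset.sum_comm, Finset.sum_congr rfl fun l hl ↦ h1 l (by simpa using hl),
      Finset.sum_const, nsmul_eq_mul, hcard, Finset.mul_sum]
  have h4 : ∑ σ, φ σ * (draw d σ i + drawSum d σ i / ((k : ℝ) - i)) =
      ∑ σ, φ σ * d (σ i) + (∑ σ, φ σ * drawSum d σ i) / ((k : ℝ) - i) := by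
    rw [Finset.sum_div, ← Finset.sum_add_distrib]
    refine Finset.sum_congr rfl fun σ _ ↦ ?_
    simp only [draw, i.2, dite_true, Fin.eta]; ring
  rw [h4, h3]
  field_simp
  ring

theorem drawMart_succ_sub (d : Fin k → ℝ) (σ : Equiv.Perm (Fin k)) {i : ℕ} (hi : i + 1 < k) :
    drawMart d σ (i + 1) - drawMart d σ i =
      (draw d σ i + drawSum d σ i / ((k : ℝ) - i)) / ((k : ℝ) - i - 1) := by
  have h : ((i + 1 : ℕ) : ℝ) < k := by exact_mod_cast hi
  push_cast at h
  have h1 : (k : ℝ) - i ≠ 0 := by linarith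
  have h2 : (k : ℝ) - i - 1 ≠ 0 := by linarith
  have h3 : (k : ℝ) - (i + 1) ≠ 0 := by linarith
  simp only [drawMart]
  rw [show drawSum d σ (i + 1) = drawSum d σ i + draw d σ i from Finset.sum_range_succ _ _]
  push_cast
  rw [show (k : ℝ) - (i + 1) = k - i - 1 by ring]
  field_simp
  ring

theorem sum_perm_mul_drawMart_sub (d : Fin k → ℝ) (hd : ∑ j, d j = 0) {i : ℕ} (hi : i + 1 < k)
    (φ : Equiv.Perm (Fin k) → ℝ)
    (hφ : ∀ σ, ∀ l, ⟨i, by omega⟩ ≤ l → φ (σ * Equiv.swap ⟨i, by omega⟩ l) = φ σ) :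
    ∑ σ, φ σ * (drawMart d σ (i + 1) - drawMart d σ i) = 0 := by
  have := sum_perm_mul_draw d hd ⟨i, by omega⟩ φ hφ
  simp_rw [drawMart_succ_sub d _ hi, mul_div_assoc', ← Finset.sum_div]
  rw [div_eq_zero_iff]
  exact Or.inl this

theorem sum_perm_apply (f : Fin k → ℝ) (i : Fin k) :
    (k : ℝ) * ∑ σ : Equiv.Perm (Fin k), f (σ i) = k.factorial * ∑ j, f j := by
  have h1 : ∀ l, ∑ σ : Equiv.Perm (Fin k), f (σ l) = ∑ σ : Equiv.Perm (Fin k), f (σ i) := by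
    intro l
    rw [← Equiv.sum_comp (Equiv.mulRight (Equiv.swap i l)) (fun σ ↦ f (σ l))]
    simp
  have h2 : ∑ l : Fin k, ∑ σ : Equiv.Perm (Fin k), f (σ l) = k.factorial * ∑ j, f j := by
    rw [Finset.sum_comm]
    simp_rw [fun σ : Equiv.Perm (Fin k) ↦ Equiv.sum_comp σ f]
    simp [Fintype.card_perm]
  rw [← h2, Finset.sum_congr rfl fun l _ ↦ h1 l]
  simp

theorem sum_perm_drawMart_sq_le (d : Fin k → ℝ) (hd : ∑ j, d j = 0) {n : ℕ} (hn : n < k) :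
    ∑ σ, drawMart d σ n ^ 2 ≤ n * (k.factorial * (∑ j, d j ^ 2) / k) / ((k : ℝ) - n) ^ 2 := by
  have hk : (0 : ℝ) < k := by exact_mod_cast (by omega : 0 < k)
  set Q : ℝ := k.factorial * (∑ j, d j ^ 2) / k with hQ
  have hQ0 : 0 ≤ Q := by have := Finset.sum_nonneg fun j (_ : j ∈ Finset.univ) ↦ sq_nonneg (d j)
                         positivity
  induction n with
  | zero => simp [drawMart, drawSum]
  | succ i ih =>
    have hi : i < k := by omega
    have h : ((i + 1 : ℕ) : ℝ) < k := by exact_mod_cast hn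
    push_cast at h
    have h1 : 0 < (k : ℝ) - i := by linarith
    have h2 : 0 < (k : ℝ) - i - 1 := by linarith
    have hmart := sum_perm_mul_drawMart_sub d hd hn (fun σ ↦ drawMart d σ i)
      (fun σ l hl ↦ drawMart_mul_swap d σ hl le_rfl)
    have hmart' := sum_perm_mul_draw d hd ⟨i, hi⟩ (fun σ ↦ drawSum d σ i / ((k : ℝ) - i))
      (fun σ l hl ↦ by rw [drawSum_mul_swap d σ hl le_rfl])
    have hdraw : ∑ σ, draw d σ i ^ 2 = Q := by
      have := sum_perm_apply (fun j ↦ d j ^ 2) ⟨i, hi⟩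
      rw [hQ, ← this]
      simp only [draw, hi, dite_true]
      field_simp
    have hsq : ∑ σ, (draw d σ i + drawSum d σ i / ((k : ℝ) - i)) ^ 2 ≤ Q := by
      rw [← hdraw]
      have : ∑ σ, (draw d σ i + drawSum d σ i / ((k : ℝ) - i)) ^ 2 =
          ∑ σ, (draw d σ i ^ 2 - (drawSum d σ i / ((k : ℝ) - i)) ^ 2) +
          2 * ∑ σ, drawSum d σ i / ((k : ℝ) - i) *
            (draw d σ i + drawSum d σ i / ((k : ℝ) - i)) := by
        rw [Finset.mul_sum, ← Finset.sum_add_distrib]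
        exact Finset.sum_congr rfl fun σ _ ↦ by ring
      rw [this, show (∑ σ, drawSum d σ i / ((k : ℝ) - i) *
            (draw d σ i + drawSum d σ i / ((k : ℝ) - i))) = 0 from hmart', mul_zero, add_zero]
      exact Finset.sum_le_sum fun σ _ ↦ by
        linarith [sq_nonneg (drawSum d σ i / ((k : ℝ) - i))]
    have hexp : ∑ σ, drawMart d σ (i + 1) ^ 2 = ∑ σ, drawMart d σ i ^ 2 +
        (∑ σ, (draw d σ i + drawSum d σ i / ((k : ℝ) - i)) ^ 2) / ((k : ℝ) - i - 1) ^ 2 +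
        2 * ∑ σ, drawMart d σ i * (drawMart d σ (i + 1) - drawMart d σ i) := by
      rw [Finset.mul_sum, Finset.sum_div, ← Finset.sum_add_distrib, ← Finset.sum_add_distrib]
      refine Finset.sum_congr rfl fun σ _ ↦ ?_
      rw [← div_pow, ← drawMart_succ_sub d σ hn]
      ring
    rw [hexp, hmart, mul_zero, add_zero]
    push_cast
    rw [show (k : ℝ) - (i + 1) = k - i - 1 by ring, add_mul, add_div, one_mul]
    refine add_le_add ((ih hi).trans ?_) (by gcongr)
    have h3 : (k : ℝ) - i - 1 ≤ k - i := by linarith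
    gcongr

theorem sum_perm_runMax_sq_le (d : Fin k → ℝ) (hd : ∑ j, d j = 0) {n : ℕ} (hn : n < k) :
    ∑ σ, runMax (fun m ↦ |drawMart d σ m|) n ^ 2 ≤ 4 * ∑ σ, drawMart d σ n ^ 2 := by
  have hpath := fun σ ↦ sum_runMax_mul_sub_le (fun m ↦ |drawMart d σ m|)
    (by simp [drawMart, drawSum]) n
  have h0 : 0 ≤ ∑ σ : Equiv.Perm (Fin k), ∑ i ∈ Finset.range n,
      runMax (fun m ↦ |drawMart d σ m|) i * (|drawMart d σ (i + 1)| - |drawMart d σ i|) := by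
    rw [Finset.sum_comm]
    refine Finset.sum_nonneg fun i hi ↦ ?_
    have hik : i + 1 < k := by simp at hi; omega
    rw [← sum_perm_mul_drawMart_sub d hd hik (fun σ ↦ runMax (fun m ↦ |drawMart d σ m|) i *
      (SignType.sign (drawMart d σ i) : ℝ)) ?_]
    · refine Finset.sum_le_sum fun σ _ ↦ ?_
      rw [mul_assoc]
      have hr : 0 ≤ runMax (fun m ↦ |drawMart d σ m|) i :=
        (abs_nonneg _).trans (le_runMax (fun m ↦ |drawMart d σ m|) le_rfl)
      refine mul_le_mul_of_nonneg_left ?_ hr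
      rcases lt_trichotomy (drawMart d σ i) 0 with h | h | h
      · rw [sign_neg h, abs_of_neg h]
        have := neg_le_abs (drawMart d σ (i + 1))
        simp; linarith
      · rw [h]; simp
      · rw [sign_pos h, abs_of_pos h]
        have := le_abs_self (drawMart d σ (i + 1))
        simp; linarith
    · intro σ l hl
      rw [drawMart_mul_swap d σ hl le_rfl]
      congr 1
      exact runMax_congr fun m hm ↦ by rw [drawMart_mul_swap d σ hl hm]
  have h1 := h0.trans (Finset.sum_le_sum fun σ _ ↦ hpath σ)
  have h2 : ∑ σ : Equiv.Perm (Fin k), (runMax (fun m ↦ |drawMart d σ m|) n * |drawMart d σ n| -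
      runMax (fun m ↦ |drawMart d σ m|) n ^ 2 / 2) ≤
      ∑ σ : Equiv.Perm (Fin k), (drawMart d σ n ^ 2 -
        runMax (fun m ↦ |drawMart d σ m|) n ^ 2 / 4) := by
    refine Finset.sum_le_sum fun σ _ ↦ ?_
    rw [← sq_abs (drawMart d σ n)]
    nlinarith [sq_nonneg (|drawMart d σ n| - runMax (fun m ↦ |drawMart d σ m|) n / 2)]
  have h3 := h1.trans h2
  rw [Finset.sum_sub_distrib, ← Finset.sum_div] at h3
  linarith

theorem drawSum_sq_le_runMax (d : Fin k → ℝ) (σ : Equiv.Perm (Fin k)) {m n : ℕ} (hmn : m ≤ n)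
    (hn : n < k) :
    drawSum d σ m ^ 2 ≤ (k : ℝ) ^ 2 * runMax (fun m ↦ |drawMart d σ m|) n ^ 2 := by
  have hm : (m : ℝ) < k := by exact_mod_cast (by omega : m < k)
  have h1 : drawSum d σ m = ((k : ℝ) - m) * drawMart d σ m := by
    rw [drawMart, mul_div_cancel₀]; linarith
  rw [h1, ← mul_pow, ← sq_abs, abs_mul, abs_of_pos (by linarith : (0 : ℝ) < k - m)]
  have := le_runMax (fun m ↦ |drawMart d σ m|) hmn
  have hm0 : (0 : ℝ) ≤ m := by positivity
  gcongr
  linarith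

theorem drawSum_rev (d : Fin k → ℝ) (hd : ∑ j, d j = 0) (σ : Equiv.Perm (Fin k)) {m : ℕ}
    (hm : m ≤ k) : drawSum d (σ * Fin.revPerm) (k - m) = - drawSum d σ m := by
  rw [drawSum_eq_sum_filter _ _ (Nat.sub_le k m), drawSum_eq_sum_filter _ _ hm,
    eq_neg_iff_add_eq_zero, ← hd, ← Equiv.sum_comp σ d,
    ← Finset.sum_filter_add_sum_filter_not Finset.univ (fun j : Fin k ↦ (j : ℕ) < m), add_comm]
  congr 1
  refine Finset.sum_equiv Fin.revPerm (fun j ↦ ?_) (fun j _ ↦ ?_)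
  · simp [Fin.val_rev]; omega
  · simp

/-- The largest square of a partial sum of the centred sequence `d j - mean d`. -/
def maxPartialSq (d : Fin k → ℝ) : ℝ≥0∞ :=
  ⨆ m : Fin (k + 1), ENNReal.ofReal
    ((∑ j : Fin k with j.val < m.val, (d j - (∑ l, d l) / k)) ^ 2)

/-- Maximal inequality for sampling without replacement. -/
theorem sum_perm_maxPartialSq_le (hk : 2 ≤ k) (d : Fin k → ℝ) :
    ∑ σ : Equiv.Perm (Fin k), maxPartialSq (d ∘ σ) ≤
      ENNReal.ofReal (72 * k.factorial * ∑ j, d j ^ 2) := by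
  have hk0 : (0 : ℝ) < k := by exact_mod_cast (by omega : 0 < k)
  set c : Fin k → ℝ := fun j ↦ d j - (∑ l, d l) / k with hc
  have hc0 : ∑ j, c j = 0 := by
    simp only [hc, Finset.sum_sub_distrib, Finset.sum_const, Finset.card_univ, Fintype.card_fin,
      nsmul_eq_mul]
    field_simp; ring
  have hcd : ∑ j, c j ^ 2 ≤ ∑ j, d j ^ 2 := by
    have : ∑ j, d j ^ 2 = ∑ j, c j ^ 2 + 2 * ((∑ l, d l) / k) * ∑ j, c j +
        ∑ j : Fin k, ((∑ l, d l) / k) ^ 2 := by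
      rw [Finset.mul_sum, ← Finset.sum_add_distrib, ← Finset.sum_add_distrib]
      exact Finset.sum_congr rfl fun j _ ↦ by simp only [hc]; ring
    rw [this, hc0]
    have := Finset.sum_nonneg fun j (_ : j ∈ (Finset.univ : Finset (Fin k))) ↦
      sq_nonneg ((∑ l, d l) / k)
    linarith
  set n := (k + 1) / 2 with hn
  have hnk : n < k := by omega
  set H : Equiv.Perm (Fin k) → ℝ :=
    fun σ ↦ (k : ℝ) ^ 2 * runMax (fun m ↦ |drawMart c σ m|) n ^ 2 with hH
  have hH0 : ∀ σ, 0 ≤ H σ := fun σ ↦ by positivity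
  have hbound : ∀ σ, ∀ m ≤ k, drawSum c σ m ^ 2 ≤ H σ + H (σ * Fin.revPerm) := by
    intro σ m hm
    rcases le_or_gt m n with h | h
    · linarith [drawSum_sq_le_runMax c σ h hnk, hH0 (σ * Fin.revPerm)]
    · have h1 := drawSum_rev c hc0 σ hm
      have h2 := drawSum_sq_le_runMax c (σ * Fin.revPerm) (by omega : k - m ≤ n) hnk
      rw [h1, neg_sq] at h2
      linarith [hH0 σ]
  have hmax : ∀ σ : Equiv.Perm (Fin k), maxPartialSq (d ∘ σ) ≤
      ENNReal.ofReal (H σ + H (σ * Fin.revPerm)) := by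
    intro σ
    refine iSup_le fun m ↦ ENNReal.ofReal_le_ofReal ?_
    refine le_trans (le_of_eq ?_) (hbound σ m (by omega))
    rw [drawSum_eq_sum_filter c σ (by omega)]
    congr 1
    refine Finset.sum_congr rfl fun j _ ↦ ?_
    simp only [hc, Function.comp, Equiv.sum_comp σ d]
  have hsum : ∑ σ, (H σ + H (σ * Fin.revPerm)) ≤ 72 * k.factorial * ∑ j, d j ^ 2 := by
    rw [Finset.sum_add_distrib, show ∑ σ, H (σ * Fin.revPerm) = ∑ σ, H σ from
      Equiv.sum_comp (Equiv.mulRight Fin.revPerm) H, ← two_mul]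
    have h1 : ∑ σ, H σ ≤ (k : ℝ) ^ 2 * (4 * (n * (k.factorial * (∑ j, c j ^ 2) / k) /
        ((k : ℝ) - n) ^ 2)) := by
      rw [hH, ← Finset.mul_sum]
      gcongr
      exact (sum_perm_runMax_sq_le c hc0 hnk).trans (by
        gcongr; exact sum_perm_drawMart_sq_le c hc0 hnk)
    have h2 : (k : ℝ) / 3 ≤ (k : ℝ) - n := by
      have : 3 * n ≤ 2 * k := by omega
      have : 3 * (n : ℝ) ≤ 2 * k := by exact_mod_cast this
      linarith
    have h3 : (n : ℝ) ≤ k := by exact_mod_cast hnk.le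
    have hcn : 0 ≤ ∑ j, c j ^ 2 := Finset.sum_nonneg fun j _ ↦ sq_nonneg _
    have h4 : (k : ℝ) ^ 2 * (4 * (n * (k.factorial * (∑ j, c j ^ 2) / k) /
        ((k : ℝ) - n) ^ 2)) ≤ (k : ℝ) ^ 2 * (4 * (k * (k.factorial * (∑ j, d j ^ 2) / k) /
        ((k : ℝ) / 3) ^ 2)) := by gcongr
    have h5 : (k : ℝ) ^ 2 * (4 * (k * (k.factorial * (∑ j, d j ^ 2) / k) /
        ((k : ℝ) / 3) ^ 2)) = 36 * k.factorial * ∑ j, d j ^ 2 := by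
      field_simp; ring
    linarith
  calc ∑ σ : Equiv.Perm (Fin k), maxPartialSq (d ∘ σ)
      ≤ ∑ σ, ENNReal.ofReal (H σ + H (σ * Fin.revPerm)) := Finset.sum_le_sum fun σ _ ↦ hmax σ
    _ = ENNReal.ofReal (∑ σ, (H σ + H (σ * Fin.revPerm))) :=
        (ENNReal.ofReal_sum_of_nonneg fun σ _ ↦ add_nonneg (hH0 _) (hH0 _)).symm
    _ ≤ _ := ENNReal.ofReal_le_ofReal hsum

end Sampling

theorem measurableSet_le_and_lt {α : Type*} [MeasurableSpace α] {a b c d : α → ℝ}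
    (ha : Measurable a) (hb : Measurable b) (hc : Measurable c) (hd : Measurable d) :
    MeasurableSet {x | a x ≤ b x ∧ c x < d x} :=
  (measurableSet_le ha hb).inter (measurableSet_lt hc hd)

section OrderStat

variable {k : ℕ}

/-- The order statistics of a tuple, in increasing order. -/
def orderStat (z : Fin k → ℝ) (r : Fin k) : ℝ := z (Tuple.sort z r)

theorem card_filter_comp_perm {α : Type*} (z : Fin k → α) (σ : Equiv.Perm (Fin k)) (p : α → Prop)
    [DecidablePred p] :
    (Finset.univ.filter fun i ↦ p (z (σ i))).card = (Finset.univ.filter fun i ↦ p (z i)).card := by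
  refine Finset.card_equiv σ fun i ↦ ?_
  simp

theorem orderStat_le_iff (z : Fin k → ℝ) (r : Fin k) (s : ℝ) :
    orderStat z r ≤ s ↔ (r : ℕ) < (Finset.univ.filter fun i ↦ z i ≤ s).card := by
  rw [← card_filter_comp_perm z (Tuple.sort z) (· ≤ s)]
  exact (Tuple.lt_card_le_iff_apply_le_of_monotone (Tuple.monotone_sort z)).symm

theorem orderStat_lt_iff (z : Fin k → ℝ) (r : Fin k) (s : ℝ) :
    orderStat z r < s ↔ (r : ℕ) < (Finset.univ.filter fun i ↦ z i < s).card := by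
  rw [← card_filter_comp_perm z (Tuple.sort z) (· < s)]
  exact (Tuple.lt_card_lt_iff_apply_lt_of_monotone (Tuple.monotone_sort z)).symm

theorem orderStat_eq_of_card (z : Fin k → ℝ) (r j : Fin k)
    (hr : (r : ℕ) = (Finset.univ.filter fun i ↦ z i < z j).card) : orderStat z r = z j := by
  refine le_antisymm ?_ ?_
  · rw [orderStat_le_iff, hr]
    refine Finset.card_lt_card ⟨fun i hi ↦ ?_, fun h ↦ ?_⟩
    · simp only [Finset.mem_filter, Finset.mem_univ, true_and] at hi ⊢
      exact hi.le
    · simpa using h (show j ∈ _ by simp)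
  · rw [← not_lt, orderStat_lt_iff, hr]
    exact lt_irrefl _

theorem measurable_orderStat (r : Fin k) : Measurable fun z : Fin k → ℝ ↦ orderStat z r := by
  refine measurable_of_Iic fun s ↦ ?_
  have : (fun z : Fin k → ℝ ↦ orderStat z r) ⁻¹' Set.Iic s =
      {z | ((r : ℕ) : ℝ) < ∑ i, Set.indicator (Set.Iic s) (fun _ ↦ (1 : ℝ)) (z i)} := by
    ext z
    simp only [Set.mem_preimage, Set.mem_Iic, Set.mem_ofPred_eq, orderStat_le_iff,
      Set.indicator_apply]
    rw [Finset.sum_boole]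
    norm_cast
  rw [this]
  refine measurableSet_lt measurable_const (Finset.measurable_sum _ fun i _ ↦ ?_)
  exact (measurable_const.indicator measurableSet_Iic).comp (measurable_pi_apply i)

/-- Among all pairings, the monotone one has the least quadratic cost. -/
theorem Monovary.sum_sub_sq_le_orderStat {x y : Fin k → ℝ} (h : Monovary x y) :
    ∑ i, (x i - y i) ^ 2 ≤ ∑ r, (orderStat x r - orderStat y r) ^ 2 := by
  have hsq : ∀ a b : Fin k → ℝ, ∑ i, (a i - b i) ^ 2 =
      ∑ i, a i ^ 2 + ∑ i, b i ^ 2 - 2 * ∑ i, a i * b i := by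
    intro a b
    rw [Finset.mul_sum, ← Finset.sum_add_distrib, ← Finset.sum_sub_distrib]
    exact Finset.sum_congr rfl fun i _ ↦ by ring
  rw [hsq, hsq]
  have hx : ∑ r, orderStat x r ^ 2 = ∑ i, x i ^ 2 :=
    Equiv.sum_comp (Tuple.sort x) (fun i ↦ x i ^ 2)
  have hy : ∑ r, orderStat y r ^ 2 = ∑ i, y i ^ 2 :=
    Equiv.sum_comp (Tuple.sort y) (fun i ↦ y i ^ 2)
  have hxy : ∑ r, orderStat x r * orderStat y r ≤ ∑ i, x i * y i := by
    have := h.sum_mul_comp_perm_le_sum_mul (σ := Tuple.sort y * (Tuple.sort x)⁻¹)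
    refine le_trans (le_of_eq ?_) this
    rw [← Equiv.sum_comp (Tuple.sort x) fun i ↦ x i * y ((Tuple.sort y * (Tuple.sort x)⁻¹) i)]
    refine Finset.sum_congr rfl fun i _ ↦ ?_
    simp [orderStat]
  rw [hx, hy]
  linarith

/-- Replacing the `i`-th entry of a tuple moves at most one order statistic across `(u, v]`, and
only if no other entry lies in `(u, v]`. -/
theorem sum_orderStat_update_le (z : Fin k → ℝ) (i : Fin k) (y : ℝ) {u v : ℝ} (huv : u ≤ v) :
    (∑ r, if orderStat z r ≤ u ∧ v < orderStat (Function.update z i y) r then (1 : ℝ≥0∞) else 0) ≤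
      if z i ≤ u ∧ v < y ∧ ∀ l ≠ i, ¬ (u < z l ∧ z l ≤ v) then 1 else 0 := by
  set z' := Function.update z i y with hz'
  set A := (Finset.univ.erase i).filter fun l ↦ z l ≤ u with hA
  set B := (Finset.univ.erase i).filter fun l ↦ z l ≤ v with hB
  have hAB : A ⊆ B := fun l hl ↦ by
    simp only [hA, hB, Finset.mem_filter] at hl ⊢
    exact ⟨hl.1, hl.2.trans huv⟩
  have hcz : (Finset.univ.filter fun l ↦ z l ≤ u).card = A.card + if z i ≤ u then 1 else 0 := by
    rw [← Finset.insert_erase (Finset.mem_univ i), Finset.filter_insert]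
    split_ifs with h
    · rw [Finset.card_insert_of_notMem (by simp)]
    · rfl
  have hcz' : (Finset.univ.filter fun l ↦ z' l ≤ v).card = B.card + if y ≤ v then 1 else 0 := by
    have hB' : B = (Finset.univ.erase i).filter fun l ↦ z' l ≤ v := by
      refine Finset.filter_congr fun l hl ↦ ?_
      rw [hz', Function.update_of_ne (Finset.ne_of_mem_erase hl)]
    rw [hB', ← Finset.insert_erase (Finset.mem_univ i), Finset.filter_insert]
    have : z' i = y := Function.update_self ..
    rw [this]
    split_ifs with h
    · rw [Finset.card_insert_of_notMem (by simp)]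
      simp
    · simp
  have key : ∀ r : Fin k, orderStat z r ≤ u ∧ v < orderStat z' r →
      (r : ℕ) = A.card ∧ z i ≤ u ∧ v < y ∧ ∀ l ≠ i, ¬ (u < z l ∧ z l ≤ v) := by
    rintro r ⟨h1, h2⟩
    rw [orderStat_le_iff, hcz] at h1
    rw [← not_le, orderStat_le_iff, hcz', not_lt] at h2
    have hle := Finset.card_le_card hAB
    have hi : z i ≤ u := by by_contra hc; rw [if_neg hc] at h1; omega
    have hy : ¬ y ≤ v := by intro hc; rw [if_pos hc] at h2; split_ifs at h1; omega
    rw [if_pos hi] at h1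
    rw [if_neg hy] at h2
    refine ⟨by omega, hi, not_le.mp hy, fun l hl hlu ↦ ?_⟩
    have hAB' : A = B := Finset.eq_of_subset_of_card_le hAB (by omega)
    have hlB : l ∈ B := by simp [hB, hl, hlu.2]
    rw [← hAB'] at hlB
    simp only [hA, Finset.mem_filter] at hlB
    linarith [hlB.2]
  rw [Finset.sum_boole]
  split_ifs with h
  · rw [← Nat.cast_one, Nat.cast_le, Finset.card_le_one]
    intro a ha b hb
    have ha' := (key a (by simpa using ha)).1
    have hb' := (key b (by simpa using hb)).1
    exact Fin.ext (ha'.trans hb'.symm)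
  · rw [nonpos_iff_eq_zero, Nat.cast_eq_zero, Finset.card_eq_zero, Finset.filter_eq_empty_iff]
    intro r _ hr
    exact h (key r hr).2

theorem ofReal_sub_sq_eq (a b : ℝ) : ENNReal.ofReal ((a - b) ^ 2) =
    (∫⁻ p : ℝ × ℝ, if a ≤ min p.1 p.2 ∧ max p.1 p.2 < b then 1 else 0) +
      ∫⁻ p : ℝ × ℝ, if b ≤ min p.1 p.2 ∧ max p.1 p.2 < a then 1 else 0 := by
  have h : ∀ a b : ℝ, (∫⁻ p : ℝ × ℝ, if a ≤ min p.1 p.2 ∧ max p.1 p.2 < b then (1 : ℝ≥0∞) else 0) =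
      ENNReal.ofReal (b - a) ^ 2 := by
    intro a b
    have : (fun p : ℝ × ℝ ↦ if a ≤ min p.1 p.2 ∧ max p.1 p.2 < b then (1 : ℝ≥0∞) else 0) =
        (Set.Ico a b ×ˢ Set.Ico a b).indicator 1 := by
      ext p
      simp only [Set.indicator_apply, Set.mem_prod, Set.mem_Ico, Pi.one_apply, le_min_iff,
        max_lt_iff]
      refine if_congr ?_ rfl rfl
      tauto
    rw [this, lintegral_indicator_one (measurableSet_Ico.prod measurableSet_Ico),
      Measure.volume_eq_prod, Measure.prod_prod, Real.volume_Ico, sq]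
  rw [h, h]
  rcases le_total a b with hab | hab
  · rw [ENNReal.ofReal_of_nonpos (sub_nonpos.mpr hab), ← ENNReal.ofReal_pow (by linarith)]
    simp; congr 1; ring
  · rw [ENNReal.ofReal_of_nonpos (sub_nonpos.mpr hab), ← ENNReal.ofReal_pow (by linarith)]
    simp

end OrderStat

section EfronStein

variable {ι κ : Type*} [DecidableEq ι] [Fintype κ]

/-- The squared Euclidean distance, as an extended nonnegative real. -/
def sqDist (a b : κ → ℝ) : ℝ≥0∞ := ENNReal.ofReal (∑ r, (a r - b r) ^ 2)

theorem sqDist_comm (a b : κ → ℝ) : sqDist a b = sqDist b a := by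
  simp only [sqDist, sub_sq_comm]

theorem sqDist_le_two_mul (a b c : κ → ℝ) : sqDist a c ≤ 2 * (sqDist a b + sqDist b c) := by
  have h : ∀ a b : κ → ℝ, 0 ≤ ∑ r, (a r - b r) ^ 2 :=
    fun a b ↦ Finset.sum_nonneg fun r _ ↦ sq_nonneg _
  have h2 : (2 : ℝ≥0∞) = ENNReal.ofReal 2 := by simp
  rw [sqDist, sqDist, sqDist, ← ENNReal.ofReal_add (h _ _) (h _ _), h2,
    ← ENNReal.ofReal_mul (by norm_num)]
  refine ENNReal.ofReal_le_ofReal ?_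
  rw [← Finset.sum_add_distrib, Finset.mul_sum]
  exact Finset.sum_le_sum fun r _ ↦ by nlinarith [sq_nonneg (a r - b r - (b r - c r))]

/-- The sides of a quadrilateral dominate its diagonals. -/
theorem sqDist_diagonals_le (a b c d : κ → ℝ) :
    sqDist a d + sqDist b c ≤ (sqDist a b + sqDist c d) + (sqDist a c + sqDist b d) := by
  have h : ∀ a b : κ → ℝ, 0 ≤ ∑ r, (a r - b r) ^ 2 :=
    fun a b ↦ Finset.sum_nonneg fun r _ ↦ sq_nonneg _
  simp only [sqDist]
  rw [← ENNReal.ofReal_add (h _ _) (h _ _), ← ENNReal.ofReal_add (h _ _) (h _ _),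
    ← ENNReal.ofReal_add (h _ _) (h _ _),
    ← ENNReal.ofReal_add (add_nonneg (h _ _) (h _ _)) (add_nonneg (h _ _) (h _ _))]
  refine ENNReal.ofReal_le_ofReal ?_
  simp only [← Finset.sum_add_distrib]
  exact Finset.sum_le_sum fun r _ ↦ by nlinarith [sq_nonneg (a r + d r - b r - c r)]

theorem Measurable.sqDist {α : Type*} [MeasurableSpace α] {f g : α → κ → ℝ} (hf : Measurable f)
    (hg : Measurable g) : Measurable fun x ↦ sqDist (f x) (g x) := by
  unfold _root_.sqDist
  refine (Finset.measurable_sum _ fun r _ ↦ ?_).ennreal_ofReal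
  exact (((measurable_pi_apply r).comp hf).sub ((measurable_pi_apply r).comp hg)).pow_const 2

/-- Select the second entry of each pair with index in `s`, the first entry of the others. -/
def pick (s : Finset ι) (w : ι → ℝ × ℝ) (i : ι) : ℝ := if i ∈ s then (w i).2 else (w i).1

theorem measurable_pick (s : Finset ι) : Measurable (pick s) := by
  refine measurable_pi_lambda _ fun i ↦ ?_
  by_cases h : i ∈ s
  · simp only [pick, h, if_true]; fun_prop
  · simp only [pick, h, if_false]; fun_prop

/-- Exchange the entries of each pair with index in `s`. -/
def swapOn (s : Finset ι) (w : ι → ℝ × ℝ) (i : ι) : ℝ × ℝ := if i ∈ s then (w i).swap else w i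

theorem pick_swapOn (s t : Finset ι) (w : ι → ℝ × ℝ) :
    pick s (swapOn t w) = pick (symmDiff s t) w := by
  ext i
  simp only [pick, swapOn, Finset.mem_symmDiff]
  by_cases h1 : i ∈ s <;> by_cases h2 : i ∈ t <;> simp [h1, h2]

variable [Fintype ι]

theorem measurePreserving_swapOn (γ : Measure ℝ) [IsProbabilityMeasure γ] (s : Finset ι) :
    MeasurePreserving (swapOn s) (Measure.pi fun _ : ι ↦ γ.prod γ)
      (Measure.pi fun _ : ι ↦ γ.prod γ) := by
  refine measurePreserving_pi (f := fun i (p : ℝ × ℝ) ↦ if i ∈ s then p.swap else p) _ _ fun i ↦ ?_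
  by_cases h : i ∈ s
  · simp only [h, if_true]; exact Measure.measurePreserving_swap
  · simp only [h, if_false]; exact MeasurePreserving.id _

/-- The mean squared distance between the values of `f` at two resampled arguments. -/
def resampleDist (γ : Measure ℝ) (f : (ι → ℝ) → κ → ℝ) (s t : Finset ι) : ℝ≥0∞ :=
  ∫⁻ w, sqDist (f (pick s w)) (f (pick t w)) ∂(Measure.pi fun _ : ι ↦ γ.prod γ)

variable (γ : Measure ℝ) {f : (ι → ℝ) → κ → ℝ}

theorem resampleDist_comm (s t : Finset ι) : resampleDist γ f s t = resampleDist γ f t s := by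
  simp only [resampleDist, sqDist_comm]

variable [IsProbabilityMeasure γ]

theorem resampleDist_symmDiff (hf : Measurable f) (s t u : Finset ι) :
    resampleDist γ f (symmDiff s u) (symmDiff t u) = resampleDist γ f s t := by
  unfold resampleDist
  have h := (measurePreserving_swapOn γ u).lintegral_comp
    ((hf.comp (measurable_pick s)).sqDist (hf.comp (measurable_pick t)))
  simp only [Function.comp, pick_swapOn] at h
  exact h

theorem resampleDist_insert_le (hf : Measurable f) {s : Finset ι} {i : ι} (hi : i ∉ s) :
    resampleDist γ f ∅ (insert i s) ≤ resampleDist γ f ∅ s + resampleDist γ f ∅ {i} := by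
  have hm : ∀ s t : Finset ι, Measurable fun w ↦ sqDist (f (pick s w)) (f (pick t w)) :=
    fun s t ↦ (hf.comp (measurable_pick s)).sqDist (hf.comp (measurable_pick t))
  have hsi : symmDiff s {i} = insert i s := by
    ext j; simp only [Finset.mem_symmDiff, Finset.mem_singleton, Finset.mem_insert]
    by_cases h : j = i
    · subst h; simp [hi]
    · simp [h]
  have h1 : resampleDist γ f s {i} = resampleDist γ f ∅ (insert i s) := by
    rw [← resampleDist_symmDiff γ hf s {i} {i}, resampleDist_comm, hsi, symmDiff_self]; rfl
  have h2 : resampleDist γ f {i} (insert i s) = resampleDist γ f ∅ s := by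
    rw [← resampleDist_symmDiff γ hf ∅ s {i}, hsi, ← Finset.bot_eq_empty, bot_symmDiff]
  have h3 : resampleDist γ f s (insert i s) = resampleDist γ f ∅ {i} := by
    rw [← resampleDist_symmDiff γ hf ∅ {i} s, symmDiff_comm {i} s, hsi,
      ← Finset.bot_eq_empty, bot_symmDiff]
  have key : resampleDist γ f ∅ (insert i s) + resampleDist γ f s {i} ≤
      (resampleDist γ f ∅ s + resampleDist γ f {i} (insert i s)) +
        (resampleDist γ f ∅ {i} + resampleDist γ f s (insert i s)) := by
    unfold resampleDist
    rw [← lintegral_add_left (hm _ _), ← lintegral_add_left (hm _ _), ← lintegral_add_left (hm _ _),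
      ← lintegral_add_left (by exact (hm _ _).add (hm _ _))]
    exact lintegral_mono fun w ↦ sqDist_diagonals_le _ _ _ _
  rw [h1, h2, h3, ← two_mul, ← two_mul, ← two_mul, ← mul_add] at key
  exact (ENNReal.mul_le_mul_iff_right (by norm_num) (by norm_num)).mp key

/-- The Efron–Stein inequality for vector-valued functions. -/
theorem resampleDist_univ_le (hf : Measurable f) :
    resampleDist γ f ∅ Finset.univ ≤ ∑ i, resampleDist γ f ∅ {i} := by
  suffices h : ∀ s : Finset ι, resampleDist γ f ∅ s ≤ ∑ i ∈ s, resampleDist γ f ∅ {i} from h _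
  intro s
  induction s using Finset.induction_on with
  | empty => simp [resampleDist, sqDist]
  | insert i s hi ih =>
    rw [Finset.sum_insert hi, add_comm]
    exact (resampleDist_insert_le γ hf hi).trans (by gcongr)

theorem lintegral_lintegral_sqDist_eq (hf : Measurable f) :
    ∫⁻ z, ∫⁻ z', sqDist (f z) (f z') ∂(Measure.pi fun _ : ι ↦ γ) ∂(Measure.pi fun _ : ι ↦ γ) =
      resampleDist γ f ∅ Finset.univ := by
  have hm : Measurable fun p : (ι → ℝ) × (ι → ℝ) ↦ sqDist (f p.1) (f p.2) :=
    (hf.comp measurable_fst).sqDist (hf.comp measurable_snd)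
  rw [← lintegral_prod (f := fun p : (ι → ℝ) × (ι → ℝ) ↦ sqDist (f p.1) (f p.2)) hm.aemeasurable,
    ← (measurePreserving_arrowProdEquivProdArrow ℝ ℝ ι (fun _ ↦ γ) (fun _ ↦ γ)).lintegral_comp hm]
  unfold resampleDist
  refine lintegral_congr fun w ↦ ?_
  have h1 : pick ∅ w = fun i ↦ (w i).1 := by ext i; simp [pick]
  have h2 : pick Finset.univ w = fun i ↦ (w i).2 := by ext i; simp [pick]
  rw [h1, h2]
  rfl

end EfronStein

section SortedSample

variable {k : ℕ} (γ : Measure ℝ) [IsProbabilityMeasure γ]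

theorem measurable_orderStat_pi : Measurable (orderStat : (Fin k → ℝ) → Fin k → ℝ) :=
  measurable_pi_lambda _ measurable_orderStat

/-- The probability that a given point of an i.i.d. sample is at most `u` and its replacement
exceeds `v`, with no other sample point in `(u, v]`. -/
def gapProb (k : ℕ) (u v : ℝ) : ℝ≥0∞ :=
  γ (Set.Iic u) * γ (Set.Ioi v) * γ (Set.Ioc u v)ᶜ ^ (k - 1)

open scoped Classical in
theorem lintegral_orderStat_gap_le {x y : (Fin k → ℝ × ℝ) → Fin k → ℝ} (i : Fin k)
    {a b : ℝ × ℝ → ℝ} (ha : Measurable a) (hb : Measurable b)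
    (hyx : ∀ w, y w = Function.update (x w) i (b (w i))) (hxi : ∀ w, x w i = a (w i))
    (hxl : ∀ w, ∀ l ≠ i, x w l = (w l).1)
    (hab : ∀ u v, (γ.prod γ) {p | a p ≤ u ∧ v < b p} = γ (Set.Iic u) * γ (Set.Ioi v)) :
    ∫⁻ w, ∑ r, (∫⁻ p : ℝ × ℝ, if orderStat (x w) r ≤ min p.1 p.2 ∧
        max p.1 p.2 < orderStat (y w) r then 1 else 0) ∂(Measure.pi fun _ : Fin k ↦ γ.prod γ) ≤
      ∫⁻ p : ℝ × ℝ, gapProb γ k (min p.1 p.2) (max p.1 p.2) := by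
  set A : ℝ × ℝ → Fin k → Set (ℝ × ℝ) := fun p l ↦ if l = i then
    {q | a q ≤ min p.1 p.2 ∧ max p.1 p.2 < b q} else
    {q | ¬ (min p.1 p.2 < q.1 ∧ q.1 ≤ max p.1 p.2)} with hA
  set I : (Fin k → ℝ × ℝ) → ℝ × ℝ → ℝ≥0∞ := fun w p ↦
    {q : (Fin k → ℝ × ℝ) × (ℝ × ℝ) | ∀ l, q.1 l ∈ A q.2 l}.indicator 1 (w, p) with hI
  have hAm : MeasurableSet {q : (Fin k → ℝ × ℝ) × (ℝ × ℝ) | ∀ l, q.1 l ∈ A q.2 l} := by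
    simp only [Set.ofPred_forall]
    refine MeasurableSet.iInter fun l ↦ ?_
    by_cases h : l = i
    · simp only [hA, h, if_true, Set.mem_ofPred_eq]
      apply measurableSet_le_and_lt <;> fun_prop
    · simp only [hA, h, if_false, Set.mem_ofPred_eq]
      simp_rw [and_comm (a := _ < _)]
      refine (measurableSet_le_and_lt ?_ ?_ ?_ ?_).compl <;> fun_prop
  have hIm : Measurable (Function.uncurry I) := measurable_one.indicator hAm
  have h1 : ∀ w, ∑ r, (∫⁻ p : ℝ × ℝ, if orderStat (x w) r ≤ min p.1 p.2 ∧
        max p.1 p.2 < orderStat (y w) r then 1 else 0) ≤ ∫⁻ p, I w p := by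
    intro w
    rw [← lintegral_finsetSum]
    · refine lintegral_mono fun p ↦ ?_
      refine le_trans (le_of_eq ?_) ((sum_orderStat_update_le (x w) i (b (w i))
        (min_le_max (a := p.1) (b := p.2))).trans (le_of_eq ?_))
      · simp only [hyx]
      · simp only [hI]
        rw [Set.indicator_apply]
        refine if_congr ?_ rfl rfl
        constructor
        · rintro ⟨h1, h2, h3⟩ l
          by_cases h : l = i
          · subst h
            simp only [hA, if_true, Set.mem_ofPred_eq]
            exact ⟨by rw [← hxi]; exact h1, h2⟩
          · simp only [hA, h, if_false, Set.mem_ofPred_eq]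
            rw [← hxl w l h]; exact h3 l h
        · intro h
          have hi := h i
          simp only [hA, if_true, Set.mem_ofPred_eq] at hi
          refine ⟨by rw [hxi]; exact hi.1, hi.2, fun l hl ↦ ?_⟩
          have := h l
          simp only [hA, hl, if_false, Set.mem_ofPred_eq] at this
          rw [hxl w l hl]; exact this
    · intro r _
      refine Measurable.ite (measurableSet_le_and_lt ?_ ?_ ?_ ?_) ?_ ?_ <;> fun_prop
  refine (lintegral_mono h1).trans ?_
  rw [lintegral_lintegral_swap hIm.aemeasurable]
  refine le_of_eq (lintegral_congr fun p ↦ ?_)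
  have h2 : (fun w ↦ I w p) = (Set.univ.pi (A p)).indicator 1 := by
    ext w; simp only [hI, Set.indicator_apply]; simp [Set.mem_pi]
  have hAp : ∀ l, MeasurableSet (A p l) := by
    intro l
    by_cases h : l = i
    · simp only [hA, h, if_true]
      apply measurableSet_le_and_lt <;> fun_prop
    · simp only [hA, h, if_false]
      simp_rw [and_comm (a := _ < _)]
      refine (measurableSet_le_and_lt ?_ ?_ ?_ ?_).compl <;> fun_prop
  rw [h2, lintegral_indicator_one (MeasurableSet.univ_pi hAp), Measure.pi_pi,
    ← Finset.mul_prod_erase Finset.univ _ (Finset.mem_univ i), gapProb]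
  congr 1
  · simp only [hA, if_true, hab]
  · rw [Finset.prod_congr rfl (g := fun _ ↦ γ (Set.Ioc (min p.1 p.2) (max p.1 p.2))ᶜ)]
    · simp [Finset.card_erase_of_mem]
    · intro l hl
      have : A p l = (Set.Ioc (min p.1 p.2) (max p.1 p.2))ᶜ ×ˢ Set.univ := by
        ext q; simp only [hA, Finset.ne_of_mem_erase hl, if_false]
        simp [-lt_inf_iff, -inf_lt_iff, -le_sup_iff]
      rw [this, Measure.prod_prod]; simp

theorem resampleDist_orderStat_singleton_le (i : Fin k) :
    resampleDist γ orderStat ∅ {i} ≤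
      2 * ∫⁻ p : ℝ × ℝ, gapProb γ k (min p.1 p.2) (max p.1 p.2) := by
  have hterm : ∀ c d : (Fin k → ℝ × ℝ) → Fin k → ℝ, Measurable c → Measurable d → Measurable
      fun w ↦ ∑ r, ∫⁻ p : ℝ × ℝ, if orderStat (c w) r ≤ min p.1 p.2 ∧
        max p.1 p.2 < orderStat (d w) r then (1 : ℝ≥0∞) else 0 := by
    intro c d hc hd
    refine Finset.measurable_sum _ fun r _ ↦ Measurable.lintegral_prod_right ?_
    have hc' : Measurable fun q : (Fin k → ℝ × ℝ) × (ℝ × ℝ) ↦ orderStat (c q.1) r :=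
      (measurable_orderStat r).comp (hc.comp measurable_fst)
    have hd' : Measurable fun q : (Fin k → ℝ × ℝ) × (ℝ × ℝ) ↦ orderStat (d q.1) r :=
      (measurable_orderStat r).comp (hd.comp measurable_fst)
    exact Measurable.ite (measurableSet_le_and_lt hc' (by fun_prop) (by fun_prop) hd')
      measurable_const measurable_const
  unfold resampleDist
  have hsq : ∀ w : Fin k → ℝ × ℝ, sqDist (orderStat (pick ∅ w)) (orderStat (pick {i} w)) =
      (∑ r, ∫⁻ p : ℝ × ℝ, if orderStat (pick ∅ w) r ≤ min p.1 p.2 ∧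
        max p.1 p.2 < orderStat (pick {i} w) r then 1 else 0) +
      ∑ r, ∫⁻ p : ℝ × ℝ, if orderStat (pick {i} w) r ≤ min p.1 p.2 ∧
        max p.1 p.2 < orderStat (pick ∅ w) r then 1 else 0 := by
    intro w
    rw [sqDist, ENNReal.ofReal_sum_of_nonneg fun r _ ↦ sq_nonneg _, ← Finset.sum_add_distrib]
    exact Finset.sum_congr rfl fun r _ ↦ ofReal_sub_sq_eq _ _
  simp_rw [hsq]
  rw [lintegral_add_left (hterm _ _ (measurable_pick _) (measurable_pick _)), two_mul]
  refine add_le_add ?_ ?_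
  · refine lintegral_orderStat_gap_le γ i measurable_fst measurable_snd (fun w ↦ ?_) (fun w ↦ ?_)
      (fun w l hl ↦ ?_) (fun u v ↦ ?_)
    · ext l
      by_cases h : l = i
      · subst h; simp [pick]
      · simp [pick, h]
    · simp [pick]
    · simp [pick]
    · rw [← Measure.prod_prod]; rfl
  · refine lintegral_orderStat_gap_le γ i measurable_snd measurable_fst (fun w ↦ ?_) (fun w ↦ ?_)
      (fun w l hl ↦ ?_) (fun u v ↦ ?_)
    · ext l
      by_cases h : l = i
      · subst h; simp [pick]
      · simp [pick, h]
    · simp [pick]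
    · simp [pick, hl]
    · rw [mul_comm, ← Measure.prod_prod]
      congr 1
      ext q; simp [and_comm]

/-- Mean squared distance between two independent sorted samples. -/
theorem lintegral_sqDist_orderStat_le :
    ∫⁻ z, ∫⁻ z', sqDist (orderStat z) (orderStat z')
        ∂(Measure.pi fun _ : Fin k ↦ γ) ∂(Measure.pi fun _ : Fin k ↦ γ) ≤
      2 * (k * ∫⁻ p : ℝ × ℝ, gapProb γ k (min p.1 p.2) (max p.1 p.2)) := by
  rw [lintegral_lintegral_sqDist_eq γ measurable_orderStat_pi]
  refine (resampleDist_univ_le γ measurable_orderStat_pi).trans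
    ((Finset.sum_le_sum fun i _ ↦ resampleDist_orderStat_singleton_le γ i).trans (le_of_eq ?_))
  simp; ring

end SortedSample

section Quantile

/-- The uniform distribution on `[0, 1]`. -/
def unif : Measure ℝ := volume.restrict (Set.Icc 0 1)

instance : IsProbabilityMeasure unif := ⟨by simp [unif]⟩

theorem unif_Iio {a : ℝ} (h₁ : a ≤ 1) : unif (Set.Iio a) = ENNReal.ofReal a := by
  have : Set.Iio a ∩ Set.Icc 0 1 = Set.Ico 0 a := by
    ext x; simp only [Set.mem_inter_iff, Set.mem_Iio, Set.mem_Icc, Set.mem_Ico]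
    constructor
    · rintro ⟨h1, h2, _⟩; exact ⟨h2, h1⟩
    · rintro ⟨h1, h2⟩; exact ⟨h2, h1, by linarith⟩
  rw [unif, Measure.restrict_apply measurableSet_Iio, this, Real.volume_Ico, sub_zero]

theorem ae_unif_mem_Ioo : ∀ᵐ u ∂unif, u ∈ Set.Ioo (0 : ℝ) 1 := by
  rw [unif, ← Measure.restrict_congr_set Ioo_ae_eq_Icc]
  exact ae_restrict_mem measurableSet_Ioo

theorem measure_of_ae_mem {α : Type*} [MeasurableSpace α] {ρ : Measure α} {s : Set α}
    (h : ∀ᵐ x ∂ρ, x ∈ s) : ρ s = ρ Set.univ :=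
  measure_congr (eventuallyEq_univ.mpr h)

variable (ν : Measure ℝ)

theorem quantile_le_iff {p : ℝ} (h₀ : 0 < p) (h₁ : p < 1) (x : ℝ) :
    quantile ν p ≤ x ↔ p ≤ cdf ν x := by
  have hbdd : BddBelow {x : ℝ | p ≤ cdf ν x} := by
    obtain ⟨b, hb⟩ := ((tendsto_cdf_atBot ν).eventually (gt_mem_nhds h₀)).exists
    refine ⟨b, fun y hy ↦ ?_⟩
    by_contra hc
    have := monotone_cdf ν (not_le.mp hc).le
    have hy' : p ≤ cdf ν y := hy
    linarith
  have hne : {x : ℝ | p ≤ cdf ν x}.Nonempty := by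
    obtain ⟨b, hb⟩ := ((tendsto_cdf_atTop ν).eventually (lt_mem_nhds h₁)).exists
    exact ⟨b, hb.le⟩
  constructor
  · intro h
    refine le_trans ?_ (monotone_cdf ν h)
    by_contra hc
    rw [not_le] at hc
    have hev : ∀ᶠ y in 𝓝[>] (quantile ν p), cdf ν y < p :=
      (((cdf ν).right_continuous (quantile ν p)).mono Set.Ioi_subset_Ici_self).eventually
        (gt_mem_nhds hc)
    obtain ⟨y, hy, hyq⟩ := (hev.and self_mem_nhdsWithin).exists
    obtain ⟨s, hs, hsy⟩ := exists_lt_of_csInf_lt hne hyq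
    have hs' : p ≤ cdf ν s := hs
    have := monotone_cdf ν hsy.le
    linarith
  · intro h
    exact csInf_le hbdd h

theorem quantile_monotoneOn : MonotoneOn (quantile ν) (Set.Ioo 0 1) := by
  intro p hp q hq hpq
  rw [quantile_le_iff ν hp.1 hp.2]
  exact hpq.trans ((quantile_le_iff ν hq.1 hq.2 _).mp le_rfl)

theorem measurable_quantile : Measurable (quantile ν) := by
  refine measurable_of_restrict_of_restrict_compl (measurableSet_Ioo (a := (0 : ℝ)) (b := 1)) ?_ ?_
  · exact Monotone.measurable fun p q hpq ↦ quantile_monotoneOn ν p.2 q.2 hpq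
  · have : ∀ p ∈ (Set.Ioo (0 : ℝ) 1)ᶜ, quantile ν p =
        if p = 1 then quantile ν 1 else 0 := by
      intro p hp
      split_ifs with h
      · rw [h]
      · rcases le_or_gt p 0 with h0 | h0
        · have : {x : ℝ | p ≤ cdf ν x} = Set.univ :=
            Set.eq_univ_of_forall fun x ↦ h0.trans (cdf_nonneg ν x)
          rw [quantile, this, Real.sInf_univ]
        · have h1 : 1 < p := lt_of_le_of_ne
            (by by_contra hc; exact hp ⟨h0, not_le.mp hc⟩) (Ne.symm h)
          have : {x : ℝ | p ≤ cdf ν x} = ∅ :=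
            Set.eq_empty_of_forall_notMem fun x hx ↦ by
              have hx' : p ≤ cdf ν x := hx
              linarith [cdf_le_one ν x]
          rw [quantile, this, Real.sInf_empty]
    have h2 : (Set.Ioo (0 : ℝ) 1)ᶜ.domRestrict (quantile ν) =
        (fun p : ℝ ↦ if p = 1 then quantile ν 1 else 0) ∘ Subtype.val := by
      ext p; exact this p p.2
    rw [h2]
    exact (Measurable.ite (measurableSet_singleton 1) measurable_const measurable_const).comp
      measurable_subtype_coe

theorem map_quantile_unif [IsProbabilityMeasure ν] : unif.map (quantile ν) = ν := by
  have := Measure.isProbabilityMeasure_map (μ := unif) (measurable_quantile ν).aemeasurable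
  refine Measure.ext_of_Iic _ _ fun x ↦ ?_
  rw [Measure.map_apply (measurable_quantile ν) measurableSet_Iic, ← ofReal_cdf]
  have h : quantile ν ⁻¹' Set.Iic x =ᵐ[unif] Set.Iic (cdf ν x) := by
    filter_upwards [ae_unif_mem_Ioo] with p hp
    exact propext (quantile_le_iff ν hp.1 hp.2 x)
  have h' : Set.Iic (cdf ν x) =ᵐ[unif] Set.Iio (cdf ν x) :=
    ae_restrict_of_ae Iio_ae_eq_Iic.symm
  rw [measure_congr h, measure_congr h', unif_Iio (cdf_le_one ν x)]

end Quantile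

section DistributionalTransform

variable (μ : Measure ℝ)

/-- The distributional transform `μ(-∞, x) + u μ{x}`. -/
def distTransform (q : ℝ × ℝ) : ℝ := μ.real (Set.Iio q.1) + q.2 * μ.real {q.1}

theorem le_distTransform {x u : ℝ} (hu : 0 ≤ u) : μ.real (Set.Iio x) ≤ distTransform μ (x, u) := by
  have : 0 ≤ μ.real {x} := measureReal_nonneg
  simp only [distTransform]
  nlinarith

variable [IsProbabilityMeasure μ]

theorem real_Iio_add_singleton (x : ℝ) : μ.real (Set.Iio x) + μ.real {x} = μ.real (Set.Iic x) := by
  rw [← measureReal_union (by simp) (measurableSet_singleton x)]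
  congr 1
  ext y; simp [le_iff_lt_or_eq, or_comm]

theorem measurable_distTransform : Measurable (distTransform μ) := by
  have h1 : Measurable fun x ↦ μ.real (Set.Iio x) :=
    Monotone.measurable fun x y h ↦ measureReal_mono (Set.Iio_subset_Iio h)
  have h2 : Measurable fun x ↦ μ.real (Set.Iic x) :=
    Monotone.measurable fun x y h ↦ measureReal_mono (Set.Iic_subset_Iic.mpr h)
  have h3 : Measurable fun x ↦ μ.real {x} := by
    have : (fun x ↦ μ.real {x}) = fun x ↦ μ.real (Set.Iic x) - μ.real (Set.Iio x) := by
      ext x; linarith [real_Iio_add_singleton μ x]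
    rw [this]; exact h2.sub h1
  exact (h1.comp measurable_fst).add (measurable_snd.mul (h3.comp measurable_fst))

theorem distTransform_le {x u : ℝ} (hu : u ≤ 1) : distTransform μ (x, u) ≤ μ.real (Set.Iic x) := by
  rw [← real_Iio_add_singleton, distTransform]
  have : 0 ≤ μ.real {x} := measureReal_nonneg
  simp only
  nlinarith

theorem distTransform_mono {x x' u u' : ℝ} (hu : u ≤ 1) (hu' : 0 ≤ u')
    (h : x < x' ∨ (x = x' ∧ u < u')) : distTransform μ (x, u) ≤ distTransform μ (x', u') := by
  rcases h with h | ⟨rfl, h⟩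
  · exact (distTransform_le μ hu).trans ((measureReal_mono (Set.Iic_subset_Iio.mpr h)).trans
      (le_distTransform μ hu'))
  · have : 0 ≤ μ.real {x} := measureReal_nonneg
    simp only [distTransform]
    nlinarith

theorem real_Iio_quantile_le {a : ℝ} (h₀ : 0 < a) (h₁ : a < 1) :
    μ.real (Set.Iio (quantile μ a)) ≤ a := by
  have h : Function.leftLim (cdf μ) (quantile μ a) ≤ a := by
    refine le_of_tendsto ((monotone_cdf μ).tendsto_leftLim _) ?_
    filter_upwards [self_mem_nhdsWithin] with y hy
    by_contra hc
    have := (quantile_le_iff μ h₀ h₁ y).mpr (not_le.mp hc).le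
    exact absurd hy (not_lt.mpr this)
  have h2 := (cdf μ).measure_Iio (tendsto_cdf_atBot μ) (quantile μ a)
  rw [measure_cdf, sub_zero] at h2
  rw [measureReal_def, h2]
  exact ENNReal.toReal_le_of_le_ofReal h₀.le (ENNReal.ofReal_le_ofReal h)

theorem prod_unif_distTransform_lt {a : ℝ} (h₀ : 0 < a) (h₁ : a < 1) :
    (μ.prod unif) (distTransform μ ⁻¹' Set.Iio a) = ENNReal.ofReal a := by
  set y := quantile μ a with hy
  set m := μ.real (Set.Iio y) with hm
  have hma : m ≤ a := real_Iio_quantile_le μ h₀ h₁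
  have ham : a ≤ m + μ.real {y} := by
    rw [hm, real_Iio_add_singleton, ← cdf_eq_real]
    exact (quantile_le_iff μ h₀ h₁ y).mp le_rfl
  set w := unif {u | m + u * μ.real {y} < a} with hw
  have hw' : μ {y} * w = ENNReal.ofReal (a - m) := by
    rcases (measureReal_nonneg (μ := μ) (s := {y})).eq_or_lt with h | h
    · have h' : μ {y} = 0 := by simpa [measureReal_def, ENNReal.toReal_eq_zero_iff] using h.symm
      rw [h', zero_mul, ENNReal.ofReal_of_nonpos (by linarith)]
    · have hset : {u | m + u * μ.real {y} < a} = Set.Iio ((a - m) / μ.real {y}) := by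
        ext u; simp only [Set.mem_ofPred_eq, Set.mem_Iio, lt_div_iff₀ h]
        constructor <;> intro _ <;> linarith
      rw [hw, hset, unif_Iio (by rw [div_le_one h]; linarith),
        ← ofReal_measureReal, ← ENNReal.ofReal_mul h.le]
      congr 1; field_simp
  have hsec : ∀ x, unif (Prod.mk x ⁻¹' (distTransform μ ⁻¹' Set.Iio a)) =
      (Set.Iio y).indicator 1 x + ({y} : Set ℝ).indicator (fun _ ↦ w) x := by
    intro x
    rcases lt_trichotomy x y with h | h | h
    · have h1 : ∀ᵐ u ∂unif, u ∈ Prod.mk x ⁻¹' (distTransform μ ⁻¹' Set.Iio a) := by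
        filter_upwards [ae_unif_mem_Ioo] with u hu
        refine lt_of_le_of_lt (distTransform_le μ hu.2.le) ?_
        rw [← cdf_eq_real, ← not_le, ← quantile_le_iff μ h₀ h₁]
        exact not_le.mpr h
      rw [measure_of_ae_mem h1, measure_univ]
      simp [h, h.ne]
    · subst h
      simp only [Set.mem_Iio, lt_irrefl, not_false_eq_true, Set.indicator_of_notMem,
        Set.mem_singleton_iff, Set.indicator_of_mem, zero_add]
      rfl
    · have h1 : ∀ᵐ u ∂unif, u ∉ Prod.mk x ⁻¹' (distTransform μ ⁻¹' Set.Iio a) := by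
        filter_upwards [ae_unif_mem_Ioo] with u hu
        simp only [Set.mem_preimage, Set.mem_Iio, not_lt]
        refine le_trans ?_ (le_distTransform μ hu.1.le)
        refine ham.trans ?_
        rw [hm, real_Iio_add_singleton]
        exact measureReal_mono (Set.Iic_subset_Iio.mpr h)
      rw [measure_eq_zero_iff_ae_notMem.mpr h1]
      simp [h.le, h.ne']
  rw [Measure.prod_apply (measurable_distTransform μ measurableSet_Iio)]
  simp_rw [hsec]
  rw [lintegral_add_left (measurable_one.indicator measurableSet_Iio),
    lintegral_indicator_one measurableSet_Iio,
    lintegral_indicator_const (measurableSet_singleton y), mul_comm w, hw',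
    ← ofReal_measureReal, ← ENNReal.ofReal_add measureReal_nonneg (by linarith)]
  congr 1
  linarith

/-- The distributional transform has a uniform law. -/
theorem map_distTransform : (μ.prod unif).map (distTransform μ) = unif := by
  have hmeas := measurable_distTransform μ
  have := Measure.isProbabilityMeasure_map (μ := μ.prod unif) hmeas.aemeasurable
  have hsub : ∀ a, (μ.prod unif) (distTransform μ ⁻¹' Set.Iio a) = unif (Set.Iio a) := by
    intro a
    rcases le_or_gt a 0 with h0 | h0
    · have h1 : unif (Set.Iio a) = 0 := by
        rw [measure_eq_zero_iff_ae_notMem]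
        filter_upwards [ae_unif_mem_Ioo] with u hu
        simp only [Set.mem_Iio, not_lt]; linarith [hu.1]
      rw [h1, measure_eq_zero_iff_ae_notMem]
      have := Measure.quasiMeasurePreserving_snd (μ := μ) (ν := unif) |>.ae ae_unif_mem_Ioo
      filter_upwards [this] with q hq
      simp only [Set.mem_preimage, Set.mem_Iio, not_lt]
      exact h0.trans (measureReal_nonneg.trans (le_distTransform μ hq.1.le))
    rcases lt_or_ge a 1 with h1 | h1
    · rw [prod_unif_distTransform_lt μ h0 h1, unif_Iio h1.le]
    · have h2 : unif (Set.Iio a) = 1 := by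
        rw [measure_of_ae_mem, measure_univ]
        filter_upwards [ae_unif_mem_Ioo] with u hu
        exact hu.2.trans_le h1
      rw [h2]
      refine le_antisymm prob_le_one ?_
      refine le_of_forall_lt fun c hc ↦ ?_
      lift c to ℝ≥0 using (hc.trans ENNReal.one_lt_top).ne
      have hc' : (c : ℝ) < 1 := by exact_mod_cast hc
      obtain ⟨b, hb1, hb2⟩ := exists_between hc'
      have hb0 : 0 < b := lt_of_le_of_lt c.2 hb1
      have h3 := prod_unif_distTransform_lt μ hb0 hb2
      refine lt_of_lt_of_le ?_ (measure_mono (Set.preimage_mono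
        (Set.Iio_subset_Iio (hb2.le.trans h1))))
      rw [h3, ENNReal.lt_ofReal_iff_toReal_lt ENNReal.coe_ne_top]
      exact hb1
  refine Measure.ext_of_Ici _ _ fun a ↦ ?_
  rw [← Set.compl_Iio, prob_compl_eq_one_sub measurableSet_Iio,
    prob_compl_eq_one_sub measurableSet_Iio, Measure.map_apply hmeas measurableSet_Iio, hsub]

theorem ae_distTransform_mem_Ioo :
    ∀ᵐ q ∂(μ.prod unif), distTransform μ q ∈ Set.Ioo (0 : ℝ) 1 := by
  have h := ae_unif_mem_Ioo
  rw [← map_distTransform μ] at h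
  exact ae_of_ae_map (measurable_distTransform μ).aemeasurable h

theorem measurable_comonotoneMap (ν : Measure ℝ) :
    Measurable fun q : ℝ × ℝ ↦ comonotoneMap μ ν q.1 q.2 :=
  (measurable_quantile ν).comp (measurable_distTransform μ)

theorem map_comonotoneMap (ν : Measure ℝ) [IsProbabilityMeasure ν] :
    (μ.prod unif).map (fun q : ℝ × ℝ ↦ comonotoneMap μ ν q.1 q.2) = ν := by
  rw [show (fun q : ℝ × ℝ ↦ comonotoneMap μ ν q.1 q.2) = quantile ν ∘ distTransform μ from rfl,
    ← Measure.map_map (measurable_quantile ν) (measurable_distTransform μ), map_distTransform,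
    map_quantile_unif]

theorem map_cdf [NullSingletonClass μ] : μ.map (cdf μ) = unif := by
  have h : distTransform μ = cdf μ ∘ Prod.fst := by
    ext q
    have h1 : μ.real {q.1} = 0 := by simp [measureReal_def]
    have h2 := real_Iio_add_singleton μ q.1
    rw [h1] at h2
    simp only [distTransform, h1, Function.comp, cdf_eq_real]
    linarith
  rw [← map_distTransform μ, h, ← Measure.map_map (monotone_cdf μ).measurable measurable_fst,
    Measure.map_fst_prod]
  simp

end DistributionalTransform

section UniformGap

theorem measurePreserving_one_sub_unif : MeasurePreserving (fun x : ℝ ↦ 1 - x) unif unif := by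
  have h := (Measure.measurePreserving_sub_left (volume : Measure ℝ) 1).restrict_preimage
    (measurableSet_Icc (a := (0 : ℝ)) (b := 1))
  have h2 : (fun x : ℝ ↦ 1 - x) ⁻¹' Set.Icc 0 1 = Set.Icc 0 1 := by
    ext x; simp only [Set.mem_preimage, Set.mem_Icc]
    constructor <;> rintro ⟨h1, h2⟩ <;> constructor <;> linarith
  rw [h2] at h
  exact h

theorem lintegral_unif_eq {f : ℝ → ℝ} (hf : Continuous f) (h : ∀ x ∈ Set.Icc (0 : ℝ) 1, 0 ≤ f x) :
    ∫⁻ x, ENNReal.ofReal (f x) ∂unif = ENNReal.ofReal (∫ x in (0 : ℝ)..1, f x) := by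
  rw [unif, intervalIntegral.integral_of_le zero_le_one, ← integral_Icc_eq_integral_Ioc,
    ofReal_integral_eq_lintegral_ofReal]
  · exact hf.integrableOn_Icc
  · exact (ae_restrict_iff' measurableSet_Icc).mpr (Eventually.of_forall h)

theorem lintegral_unif_gap_le (n : ℕ) {b : ℝ} (hb : b ∈ Set.Ioo (0 : ℝ) 1) :
    ∫⁻ a, (if a ≤ b then ENNReal.ofReal ((1 - (b - a)) ^ n / b) else 0) ∂unif ≤
      ENNReal.ofReal ((∑ j ∈ Finset.range (n + 1), (1 - b) ^ j) / (n + 1)) := by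
  have h1 : ∫⁻ a, (if a ≤ b then ENNReal.ofReal ((1 - (b - a)) ^ n / b) else 0) ∂unif =
      ∫⁻ a in Set.Icc 0 b, ENNReal.ofReal ((1 - (b - a)) ^ n / b) := by
    have : (fun a ↦ if a ≤ b then ENNReal.ofReal ((1 - (b - a)) ^ n / b) else 0) =
        (Set.Iic b).indicator fun a ↦ ENNReal.ofReal ((1 - (b - a)) ^ n / b) := by
      ext a; simp [Set.indicator_apply]
    rw [this, lintegral_indicator measurableSet_Iic, unif,
      Measure.restrict_restrict measurableSet_Iic]
    congr 2
    ext x; simp only [Set.mem_inter_iff, Set.mem_Iic, Set.mem_Icc]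
    constructor
    · rintro ⟨h1, h2, h3⟩; exact ⟨h2, h1⟩
    · rintro ⟨h1, h2⟩; exact ⟨h2, h1, h2.trans hb.2.le⟩
  rw [h1, ← ofReal_integral_eq_lintegral_ofReal]
  · refine ENNReal.ofReal_le_ofReal (le_of_eq ?_)
    rw [integral_Icc_eq_integral_Ioc, ← intervalIntegral.integral_of_le hb.1.le,
      intervalIntegral.integral_div]
    have h2 : ∫ a in (0 : ℝ)..b, (1 - (b - a)) ^ n = (1 - (1 - b) ^ (n + 1)) / (n + 1) := by
      have : ∀ a : ℝ, (1 - (b - a)) ^ n = (fun x ↦ x ^ n) (a + (1 - b)) := by intro a; ring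
      simp_rw [this]
      rw [intervalIntegral.integral_comp_add_right (fun x ↦ x ^ n), integral_pow]
      ring
    rw [h2, div_right_comm]
    congr 1
    have h3 := mul_neg_geom_sum (1 - b) (n + 1)
    rw [← h3]
    have := hb.1.ne'
    field_simp
    ring
  · exact Continuous.integrableOn_Icc (by fun_prop)
  · refine (ae_restrict_iff' measurableSet_Icc).mpr (Eventually.of_forall fun a ha ↦ ?_)
    have : 0 ≤ 1 - (b - a) := by linarith [ha.1, hb.2]
    have := hb.1
    simp only [Pi.zero_apply]; positivity

theorem lintegral_lintegral_unif_gap_le (n : ℕ) :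
    ∫⁻ b, ∫⁻ a, (if a ≤ b then ENNReal.ofReal ((1 - (b - a)) ^ n / b) else 0) ∂unif ∂unif ≤
      ENNReal.ofReal ((1 + Real.log (n + 1)) / (n + 1)) := by
  calc ∫⁻ b, ∫⁻ a, (if a ≤ b then ENNReal.ofReal ((1 - (b - a)) ^ n / b) else 0) ∂unif ∂unif
      ≤ ∫⁻ b, ENNReal.ofReal ((∑ j ∈ Finset.range (n + 1), (1 - b) ^ j) / (n + 1)) ∂unif := by
        refine lintegral_mono_ae ?_
        filter_upwards [ae_unif_mem_Ioo] with b hb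
        exact lintegral_unif_gap_le n hb
    _ = ENNReal.ofReal (∫ b in (0 : ℝ)..1,
          (∑ j ∈ Finset.range (n + 1), (1 - b) ^ j) / (n + 1)) := by
        refine lintegral_unif_eq (by fun_prop) fun b hb ↦ ?_
        have : 0 ≤ 1 - b := by linarith [hb.2]
        positivity
    _ ≤ _ := by
        refine ENNReal.ofReal_le_ofReal ?_
        rw [intervalIntegral.integral_div, intervalIntegral.integral_finsetSum]
        · gcongr
          have h := harmonic_le_one_add_log (n + 1)
          rw [harmonic] at h
          push_cast at h
          refine le_trans (le_of_eq ?_) h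
          refine Finset.sum_congr rfl fun j _ ↦ ?_
          rw [intervalIntegral.integral_comp_sub_left (fun x ↦ x ^ j), integral_pow]
          simp
        · exact fun j _ ↦ Continuous.intervalIntegrable (by fun_prop) _ _

/-- The gap probability expressed through the values of the distribution function. -/
def gapWeight (n : ℕ) (a b : ℝ) : ℝ :=
  min a b * (1 - max a b) * (1 - (max a b - min a b)) ^ n

theorem gapWeight_div_le (n : ℕ) {a b : ℝ} (ha : a ∈ Set.Ioo (0 : ℝ) 1)
    (hb : b ∈ Set.Ioo (0 : ℝ) 1) :
    gapWeight n a b / (a * (1 - a) * (b * (1 - b))) ≤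
      (1 - (max a b - min a b)) ^ n / max a b + (1 - (max a b - min a b)) ^ n / (1 - min a b) := by
  obtain ⟨ha0, ha1⟩ := ha
  obtain ⟨hb0, hb1⟩ := hb
  have key : ∀ x y : ℝ, 0 < x → y < 1 → x ≤ y →
      x * (1 - y) * (1 - (y - x)) ^ n / (x * (1 - x) * (y * (1 - y))) ≤
        (1 - (y - x)) ^ n / y + (1 - (y - x)) ^ n / (1 - x) := by
    intro x y hx hy hxy
    have h1 : 0 < 1 - y := by linarith
    have h2 : 0 < 1 - x := by linarith
    have h3 : 0 < y := by linarith
    have h4 : 0 ≤ (1 - (y - x)) ^ n := pow_nonneg (by linarith) n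
    have e : x * (1 - y) * (1 - (y - x)) ^ n / (x * (1 - x) * (y * (1 - y))) =
        (1 - (y - x)) ^ n / (y * (1 - x)) := by field_simp
    rw [e, div_add_div _ _ h3.ne' h2.ne']
    gcongr
    nlinarith
  rcases le_total a b with h | h
  · simp only [gapWeight, min_eq_left h, max_eq_right h]
    exact key a b ha0 hb1 h
  · simp only [gapWeight, min_eq_right h, max_eq_left h]
    rw [mul_comm (a * (1 - a))]
    exact key b a hb0 ha1 h

theorem lintegral_lintegral_unif_one_sub {f : ℝ → ℝ → ℝ≥0∞} (hf : Measurable (Function.uncurry f)) :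
    ∫⁻ a, ∫⁻ b, f (1 - a) (1 - b) ∂unif ∂unif = ∫⁻ a, ∫⁻ b, f a b ∂unif ∂unif := by
  rw [← measurePreserving_one_sub_unif.lintegral_comp (f := fun a ↦ ∫⁻ b, f a b ∂unif)
    hf.lintegral_prod_right]
  refine lintegral_congr fun a ↦ ?_
  exact measurePreserving_one_sub_unif.lintegral_comp (f := f (1 - a)) hf.of_uncurry_left

theorem lintegral_lintegral_add {α β : Type*} [MeasurableSpace α] [MeasurableSpace β]
    {μ : Measure α} {ν : Measure β} [SFinite ν] {f g : α → β → ℝ≥0∞}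
    (hf : Measurable (Function.uncurry f)) :
    ∫⁻ a, ∫⁻ b, (f a b + g a b) ∂ν ∂μ = (∫⁻ a, ∫⁻ b, f a b ∂ν ∂μ) + ∫⁻ a, ∫⁻ b, g a b ∂ν ∂μ := by
  rw [← lintegral_add_left hf.lintegral_prod_right]
  exact lintegral_congr fun a ↦ lintegral_add_left hf.of_uncurry_left _

theorem lintegral_unif_max_le (n : ℕ) :
    ∫⁻ a, ∫⁻ b, ENNReal.ofReal ((1 - (max a b - min a b)) ^ n / max a b) ∂unif ∂unif ≤
      2 * ENNReal.ofReal ((1 + Real.log (n + 1)) / (n + 1)) := by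
  set f : ℝ → ℝ → ℝ≥0∞ :=
    fun b a ↦ if a ≤ b then ENNReal.ofReal ((1 - (b - a)) ^ n / b) else 0 with hf
  have hfm : Measurable (Function.uncurry f) := by
    refine Measurable.ite (measurableSet_le measurable_snd measurable_fst) ?_ measurable_const
    fun_prop
  calc ∫⁻ a, ∫⁻ b, ENNReal.ofReal ((1 - (max a b - min a b)) ^ n / max a b) ∂unif ∂unif
      ≤ ∫⁻ a, ∫⁻ b, (f b a + f a b) ∂unif ∂unif := by
        refine lintegral_mono fun a ↦ lintegral_mono fun b ↦ ?_
        rcases le_total a b with h | h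
        · simp only [min_eq_left h, max_eq_right h, hf, h, if_true]
          exact le_self_add
        · simp only [min_eq_right h, max_eq_left h, hf, h, if_true]
          exact le_add_self
    _ = (∫⁻ a, ∫⁻ b, f b a ∂unif ∂unif) + ∫⁻ a, ∫⁻ b, f a b ∂unif ∂unif :=
        lintegral_lintegral_add (f := fun a b ↦ f b a) (hfm.comp measurable_swap)
    _ = (∫⁻ a, ∫⁻ b, f a b ∂unif ∂unif) + ∫⁻ a, ∫⁻ b, f a b ∂unif ∂unif := by
        congr 1
        exact lintegral_lintegral_swap (f := fun a b ↦ f b a)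
          (hfm.comp measurable_swap).aemeasurable
    _ ≤ _ := by
        rw [← two_mul]
        gcongr
        exact lintegral_lintegral_unif_gap_le n

theorem lintegral_unif_min_le (n : ℕ) :
    ∫⁻ a, ∫⁻ b, ENNReal.ofReal ((1 - (max a b - min a b)) ^ n / (1 - min a b)) ∂unif ∂unif ≤
      2 * ENNReal.ofReal ((1 + Real.log (n + 1)) / (n + 1)) := by
  refine le_trans (le_of_eq ?_) (lintegral_unif_max_le n)
  rw [← lintegral_lintegral_unif_one_sub (f := fun a b ↦ ENNReal.ofReal
    ((1 - (max a b - min a b)) ^ n / max a b)) (by fun_prop)]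
  refine lintegral_congr fun a ↦ lintegral_congr fun b ↦ ?_
  rw [max_sub_sub_left, min_sub_sub_left]
  congr 3
  ring

theorem lintegral_unif_gapWeight_le (n : ℕ) :
    ∫⁻ a, ∫⁻ b, ENNReal.ofReal (gapWeight n a b / (a * (1 - a) * (b * (1 - b)))) ∂unif ∂unif ≤
      4 * ENNReal.ofReal ((1 + Real.log (n + 1)) / (n + 1)) := by
  calc ∫⁻ a, ∫⁻ b, ENNReal.ofReal (gapWeight n a b / (a * (1 - a) * (b * (1 - b)))) ∂unif ∂unif
      ≤ ∫⁻ a, ∫⁻ b, (ENNReal.ofReal ((1 - (max a b - min a b)) ^ n / max a b) +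
          ENNReal.ofReal ((1 - (max a b - min a b)) ^ n / (1 - min a b))) ∂unif ∂unif := by
        refine lintegral_mono_ae ?_
        filter_upwards [ae_unif_mem_Ioo] with a ha
        refine lintegral_mono_ae ?_
        filter_upwards [ae_unif_mem_Ioo] with b hb
        exact (ENNReal.ofReal_le_ofReal (gapWeight_div_le n ha hb)).trans ENNReal.ofReal_add_le
    _ = (∫⁻ a, ∫⁻ b, ENNReal.ofReal ((1 - (max a b - min a b)) ^ n / max a b) ∂unif ∂unif) +
          ∫⁻ a, ∫⁻ b, ENNReal.ofReal ((1 - (max a b - min a b)) ^ n / (1 - min a b))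
            ∂unif ∂unif := lintegral_lintegral_add (by fun_prop)
    _ ≤ _ := by
        refine (add_le_add (lintegral_unif_max_le n) (lintegral_unif_min_le n)).trans
          (le_of_eq ?_)
        ring

end UniformGap

section GaussianGap

variable (v : ℝ≥0)

theorem gaussianPDFReal_le_mul {v : ℝ≥0} (hv : v ≠ 0) {x y : ℝ} (h : 0 ≤ x * (y - x)) :
    gaussianPDFReal 0 v y ≤ √(2 * Real.pi * v) * gaussianPDFReal 0 v x * gaussianPDFReal x v y := by
  have hv' : (0 : ℝ) < v := lt_of_le_of_ne v.2 (by exact_mod_cast hv.symm)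
  have hs : 0 < √(2 * Real.pi * v) := by positivity
  simp only [gaussianPDFReal, sub_zero]
  have : √(2 * Real.pi * v) * ((√(2 * Real.pi * v))⁻¹ * Real.exp (-x ^ 2 / (2 * v))) *
      ((√(2 * Real.pi * v))⁻¹ * Real.exp (-(y - x) ^ 2 / (2 * v))) =
      (√(2 * Real.pi * v))⁻¹ * Real.exp (-x ^ 2 / (2 * v) + -(y - x) ^ 2 / (2 * v)) := by
    rw [Real.exp_add]; field_simp
  rw [this]
  gcongr
  rw [← add_div]
  gcongr
  nlinarith

variable {v}

theorem gaussianReal_tail_le (hv : v ≠ 0) {x : ℝ} {s : Set ℝ} (hs : MeasurableSet s)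
    (h : ∀ y ∈ s, 0 ≤ x * (y - x)) :
    gaussianReal 0 v s ≤ ENNReal.ofReal √(2 * Real.pi * v) * gaussianPDF 0 v x := by
  rw [gaussianReal_apply 0 hv]
  calc ∫⁻ y in s, gaussianPDF 0 v y
      ≤ ∫⁻ y in s, ENNReal.ofReal √(2 * Real.pi * v) * gaussianPDF 0 v x * gaussianPDF x v y := by
        refine setLIntegral_mono' hs fun y hy ↦ ?_
        simp only [gaussianPDF]
        rw [← ENNReal.ofReal_mul (by positivity), ← ENNReal.ofReal_mul
          (mul_nonneg (by positivity) (gaussianPDFReal_nonneg _ _ _))]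
        exact ENNReal.ofReal_le_ofReal (gaussianPDFReal_le_mul hv (h y hy))
    _ ≤ ∫⁻ y, ENNReal.ofReal √(2 * Real.pi * v) * gaussianPDF 0 v x * gaussianPDF x v y :=
        setLIntegral_le_lintegral _ _
    _ = _ := by
        rw [lintegral_const_mul _ (measurable_gaussianPDF x v), lintegral_gaussianPDF_eq_one x hv,
          mul_one]

/-- The density of a centred normal law dominates `F (1 - F)`. -/
theorem cdf_mul_one_sub_cdf_le (hv : v ≠ 0) (x : ℝ) :
    ENNReal.ofReal (cdf (gaussianReal 0 v) x * (1 - cdf (gaussianReal 0 v) x)) ≤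
      ENNReal.ofReal √(2 * Real.pi * v) * gaussianPDF 0 v x := by
  have h0 := cdf_nonneg (gaussianReal 0 v) x
  have h1 := cdf_le_one (gaussianReal 0 v) x
  rcases le_total 0 x with hx | hx
  · refine le_trans ?_ (gaussianReal_tail_le hv (measurableSet_Ioi (a := x)) fun y hy ↦ ?_)
    · rw [← Set.compl_Iic, prob_compl_eq_one_sub measurableSet_Iic, ← ofReal_cdf,
        ← ENNReal.ofReal_one, ← ENNReal.ofReal_sub _ h0]
      exact ENNReal.ofReal_le_ofReal (by nlinarith)
    · have hy' : x < y := hy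
      exact mul_nonneg hx (by linarith)
  · refine le_trans ?_ (gaussianReal_tail_le hv (measurableSet_Iic (a := x)) fun y hy ↦ ?_)
    · rw [← ofReal_cdf]
      exact ENNReal.ofReal_le_ofReal (by nlinarith)
    · have hy' : y ≤ x := hy
      exact mul_nonneg_of_nonpos_of_nonpos hx (by linarith)

theorem lintegral_le_lintegral_gaussian (hv : v ≠ 0) {g : ℝ → ℝ≥0∞} (hg : Measurable g) :
    ∫⁻ x, g x ≤ ENNReal.ofReal √(2 * Real.pi * v) *
      ∫⁻ x, (ENNReal.ofReal (cdf (gaussianReal 0 v) x * (1 - cdf (gaussianReal 0 v) x)))⁻¹ * g x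
        ∂(gaussianReal 0 v) := by
  set w : ℝ → ℝ≥0∞ := fun x ↦
    ENNReal.ofReal (cdf (gaussianReal 0 v) x * (1 - cdf (gaussianReal 0 v) x)) with hw
  have hwm : Measurable w := by
    have := (monotone_cdf (gaussianReal 0 v)).measurable
    fun_prop
  have hd : ∫⁻ x, (w x)⁻¹ * g x ∂(gaussianReal 0 v) =
      ∫⁻ x, gaussianPDF 0 v x * ((w x)⁻¹ * g x) := by
    rw [gaussianReal_of_var_ne_zero 0 hv]
    exact lintegral_withDensity_eq_lintegral_mul _ (measurable_gaussianPDF 0 v) (hwm.inv.mul hg)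
  rw [hd, ← lintegral_const_mul]
  · refine lintegral_mono fun x ↦ ?_
    have h := cdf_mul_one_sub_cdf_le hv x
    have hw1 : 1 ≤ ENNReal.ofReal √(2 * Real.pi * v) * gaussianPDF 0 v x * (w x)⁻¹ := by
      have hv' : (0 : ℝ) < v := lt_of_le_of_ne v.2 (by exact_mod_cast hv.symm)
      have hpos : ENNReal.ofReal √(2 * Real.pi * v) * gaussianPDF 0 v x ≠ 0 :=
        mul_ne_zero (by rw [ne_eq, ENNReal.ofReal_eq_zero, not_le]; positivity)
          (gaussianPDF_pos 0 hv x).ne'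
      rw [← div_eq_mul_inv, ENNReal.le_div_iff_mul_le (Or.inr hpos) (Or.inl ENNReal.ofReal_ne_top),
        one_mul]
      exact h
    calc g x = 1 * g x := (one_mul _).symm
      _ ≤ ENNReal.ofReal √(2 * Real.pi * v) * gaussianPDF 0 v x * (w x)⁻¹ * g x := by gcongr
      _ = _ := by ring
  · exact (measurable_gaussianPDF 0 v).mul (hwm.inv.mul hg)

theorem gapProb_eq (γ : Measure ℝ) [IsProbabilityMeasure γ] (k : ℕ) (s t : ℝ) :
    gapProb γ k (min s t) (max s t) =
      ENNReal.ofReal (gapWeight (k - 1) (cdf γ s) (cdf γ t)) := by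
  have h0 := cdf_nonneg γ
  have h1 := cdf_le_one γ
  have hle : min (cdf γ s) (cdf γ t) ≤ max (cdf γ s) (cdf γ t) := min_le_max
  have hmax : max (cdf γ s) (cdf γ t) ≤ 1 := max_le (h1 s) (h1 t)
  have hmin : 0 ≤ min (cdf γ s) (cdf γ t) := le_min (h0 s) (h0 t)
  rw [gapProb, gapWeight, ENNReal.ofReal_mul (mul_nonneg hmin (by linarith)),
    ENNReal.ofReal_mul hmin, ENNReal.ofReal_pow (by linarith), ← (monotone_cdf γ).map_min,
    ← (monotone_cdf γ).map_max, ofReal_cdf, ENNReal.ofReal_sub _ (h0 _),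
    ENNReal.ofReal_sub _ (sub_nonneg.mpr ((monotone_cdf γ) min_le_max)), ENNReal.ofReal_one,
    ofReal_cdf, ← prob_compl_eq_one_sub measurableSet_Iic, Set.compl_Iic,
    prob_compl_eq_one_sub measurableSet_Ioc]
  congr 3
  have := (cdf γ).measure_Ioc (min s t) (max s t)
  rwa [measure_cdf] at this

theorem lintegral_lintegral_map {α β : Type*} [MeasurableSpace α] [MeasurableSpace β]
    {μ : Measure α} [IsProbabilityMeasure μ] {g : α → β} {f : β → β → ℝ≥0∞}
    (hf : Measurable (Function.uncurry f)) (hg : Measurable g) :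
    ∫⁻ a, ∫⁻ b, f a b ∂(μ.map g) ∂(μ.map g) = ∫⁻ s, ∫⁻ t, f (g s) (g t) ∂μ ∂μ := by
  rw [lintegral_map hf.lintegral_prod_right hg]
  exact lintegral_congr fun s ↦ lintegral_map hf.of_uncurry_left hg

theorem lintegral_gapProb_gaussian_le (hv : v ≠ 0) {k : ℕ} (hk : 1 ≤ k) :
    k * ∫⁻ p : ℝ × ℝ, gapProb (gaussianReal 0 v) k (min p.1 p.2) (max p.1 p.2) ≤
      ENNReal.ofReal (8 * Real.pi * v * (1 + Real.log k)) := by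
  set γ := gaussianReal 0 v with hγ
  have hna : NullSingletonClass γ := nullSingletonClass_gaussianReal hv
  set K := ENNReal.ofReal √(2 * Real.pi * v) with hK
  set F := cdf γ with hF
  have hFm : Measurable F := (monotone_cdf γ).measurable
  set w : ℝ → ℝ≥0∞ := fun a ↦ (ENNReal.ofReal (a * (1 - a)))⁻¹ with hw
  have hwm : Measurable w := by fun_prop
  set H : ℝ → ℝ → ℝ≥0∞ := fun a b ↦ ENNReal.ofReal (gapWeight (k - 1) a b) with hH
  have hHm : Measurable (Function.uncurry H) := by
    simp only [Function.uncurry_def, hH, gapWeight]; fun_prop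
  have hHF : Measurable fun q : ℝ × ℝ ↦ H (F q.1) (F q.2) :=
    hHm.comp ((hFm.comp measurable_fst).prodMk (hFm.comp measurable_snd))
  have hGm : Measurable fun q : ℝ × ℝ ↦ w q.1 * (w q.2 * H q.1 q.2) :=
    (hwm.comp measurable_fst).mul ((hwm.comp measurable_snd).mul hHm)
  have hJ : ∫⁻ a, ∫⁻ b, w a * (w b * H a b) ∂unif ∂unif ≤
      4 * ENNReal.ofReal ((1 + Real.log k) / k) := by
    have := lintegral_unif_gapWeight_le (k - 1)
    have hk' : ((k - 1 : ℕ) : ℝ) + 1 = k := by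
      rw [Nat.cast_sub hk]; simp
    rw [hk'] at this
    refine le_trans (lintegral_mono_ae ?_) this
    filter_upwards [ae_unif_mem_Ioo] with a ha
    refine lintegral_mono_ae ?_
    filter_upwards [ae_unif_mem_Ioo] with b hb
    have ha' : 0 < a * (1 - a) := mul_pos ha.1 (by linarith [ha.2])
    have hb' : 0 < b * (1 - b) := mul_pos hb.1 (by linarith [hb.2])
    rw [div_eq_mul_inv, mul_comm (gapWeight _ _ _), mul_inv, ENNReal.ofReal_mul
      (by positivity), ENNReal.ofReal_mul (by positivity), ENNReal.ofReal_inv_of_pos ha',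
      ENNReal.ofReal_inv_of_pos hb', mul_assoc]
  calc (k : ℝ≥0∞) * ∫⁻ p : ℝ × ℝ, gapProb γ k (min p.1 p.2) (max p.1 p.2)
      = k * ∫⁻ s, ∫⁻ t, H (F s) (F t) := by
        simp_rw [gapProb_eq]
        rw [Measure.volume_eq_prod, lintegral_prod _ hHF.aemeasurable]
    _ ≤ k * ∫⁻ s, K * ∫⁻ t, w (F t) * H (F s) (F t) ∂γ := by
        gcongr with s
        exact lintegral_le_lintegral_gaussian hv (hHF.comp measurable_prodMk_left)
    _ ≤ k * (K * ∫⁻ s, w (F s) * (K * ∫⁻ t, w (F t) * H (F s) (F t) ∂γ) ∂γ) := by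
        gcongr
        refine lintegral_le_lintegral_gaussian hv (Measurable.const_mul ?_ K)
        exact Measurable.lintegral_prod_right
          ((hwm.comp (hFm.comp measurable_snd)).mul hHF)
    _ = k * (K * (K * ∫⁻ s, ∫⁻ t, w (F s) * (w (F t) * H (F s) (F t)) ∂γ ∂γ)) := by
        congr 2
        rw [← lintegral_const_mul]
        · refine lintegral_congr fun s ↦ ?_
          rw [lintegral_const_mul]
          · ring
          · exact (hwm.comp hFm).mul (hHF.comp measurable_prodMk_left)
        · exact Measurable.lintegral_prod_right ((hwm.comp (hFm.comp measurable_fst)).mul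
            ((hwm.comp (hFm.comp measurable_snd)).mul hHF))
    _ = k * (K * (K * ∫⁻ a, ∫⁻ b, w a * (w b * H a b) ∂unif ∂unif)) := by
        rw [← map_cdf γ, lintegral_lintegral_map (f := fun a b ↦ w a * (w b * H a b)) hGm hFm]
    _ ≤ k * (K * (K * (4 * ENNReal.ofReal ((1 + Real.log k) / k)))) := by gcongr
    _ = _ := by
        have hk0 : (0 : ℝ) < k := by exact_mod_cast hk
        have h4 : (4 : ℝ≥0∞) = ENNReal.ofReal 4 := by simp
        have hlog : 0 ≤ Real.log k := Real.log_nonneg (by exact_mod_cast hk)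
        rw [hK, h4, ← ENNReal.ofReal_mul (by positivity), ← ENNReal.ofReal_mul (by positivity),
          ← ENNReal.ofReal_mul (by positivity), ← ENNReal.ofReal_natCast,
          ← ENNReal.ofReal_mul (by positivity)]
        congr 1
        have hs : √(2 * Real.pi * v) * √(2 * Real.pi * v) = 2 * Real.pi * v :=
          Real.mul_self_sqrt (by positivity)
        calc (k : ℝ) * (√(2 * Real.pi * v) * (√(2 * Real.pi * v) * (4 * ((1 + Real.log k) / k))))
            = (√(2 * Real.pi * v) * √(2 * Real.pi * v)) * 4 * (1 + Real.log k) * (k / k) := by ring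
          _ = _ := by rw [hs, div_self hk0.ne']; ring

/-- Two independent sorted Gaussian samples are close. -/
theorem lintegral_sqDist_orderStat_gaussian_le (hv : v ≠ 0) {k : ℕ} (hk : 1 ≤ k) :
    ∫⁻ z, ∫⁻ z', sqDist (orderStat z) (orderStat z')
        ∂(Measure.pi fun _ : Fin k ↦ gaussianReal 0 v) ∂(Measure.pi fun _ ↦ gaussianReal 0 v) ≤
      ENNReal.ofReal (16 * Real.pi * v * (1 + Real.log k)) := by
  refine (lintegral_sqDist_orderStat_le (gaussianReal 0 v)).trans
    ((mul_le_mul_right (lintegral_gapProb_gaussian_le hv hk) 2).trans (le_of_eq ?_))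
  rw [show (2 : ℝ≥0∞) = ENNReal.ofReal 2 by simp, ← ENNReal.ofReal_mul (by norm_num)]
  congr 1; ring

/-- Two Gaussian samples, however dependent, have close order statistics. -/
theorem lintegral_sqDist_orderStat_coupled_le {Ω : Type*} [MeasurableSpace Ω] {P : Measure Ω}
    (hv : v ≠ 0) {k : ℕ} (hk : 1 ≤ k) {x y : Ω → Fin k → ℝ}
    (hx : HasLaw x (Measure.pi fun _ ↦ gaussianReal 0 v) P)
    (hy : HasLaw y (Measure.pi fun _ ↦ gaussianReal 0 v) P) :
    ∫⁻ ω, sqDist (orderStat (x ω)) (orderStat (y ω)) ∂P ≤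
      ENNReal.ofReal (64 * Real.pi * v * (1 + Real.log k)) := by
  set ρ := Measure.pi fun _ : Fin k ↦ gaussianReal 0 v with hρ
  have hm : Measurable fun q : (Fin k → ℝ) × (Fin k → ℝ) ↦ sqDist (orderStat q.1) (orderStat q.2) :=
    (measurable_orderStat_pi.comp measurable_fst).sqDist
      (measurable_orderStat_pi.comp measurable_snd)
  have hms : ∀ z', Measurable fun z : Fin k → ℝ ↦ sqDist (orderStat z') (orderStat z) :=
    fun z' ↦ measurable_const.sqDist measurable_orderStat_pi
  have hmi : Measurable fun z' : Fin k → ℝ ↦ ∫⁻ z, sqDist (orderStat z') (orderStat z) ∂ρ :=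
    hm.lintegral_prod_right'
  have hlaw : ∀ u : Ω → Fin k → ℝ, HasLaw u ρ P →
      ∫⁻ ω, ∫⁻ z, sqDist (orderStat (u ω)) (orderStat z) ∂ρ ∂P ≤
        ENNReal.ofReal (16 * Real.pi * v * (1 + Real.log k)) := by
    intro u hu
    have h := lintegral_map' (μ := P) (g := u)
      (f := fun z' ↦ ∫⁻ z, sqDist (orderStat z') (orderStat z) ∂ρ)
      hmi.aemeasurable hu.aemeasurable
    rw [← h, hu.map_eq]
    exact lintegral_sqDist_orderStat_gaussian_le hv hk
  calc ∫⁻ ω, sqDist (orderStat (x ω)) (orderStat (y ω)) ∂P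
      = ∫⁻ ω, ∫⁻ _, sqDist (orderStat (x ω)) (orderStat (y ω)) ∂ρ ∂P := by simp
    _ ≤ ∫⁻ ω, 2 * ((∫⁻ z, sqDist (orderStat (x ω)) (orderStat z) ∂ρ) +
          ∫⁻ z, sqDist (orderStat (y ω)) (orderStat z) ∂ρ) ∂P := by
        refine lintegral_mono fun ω ↦ ?_
        rw [← lintegral_add_left (hms _), ← lintegral_const_mul 2 (by exact (hms _).add (hms _))]
        refine lintegral_mono fun z ↦ ?_
        rw [sqDist_comm (orderStat (y ω)) (orderStat z)]
        exact sqDist_le_two_mul _ _ _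
    _ = 2 * ((∫⁻ ω, ∫⁻ z, sqDist (orderStat (x ω)) (orderStat z) ∂ρ ∂P) +
          ∫⁻ ω, ∫⁻ z, sqDist (orderStat (y ω)) (orderStat z) ∂ρ ∂P) := by
        have hmx : AEMeasurable (fun ω ↦ ∫⁻ z, sqDist (orderStat (x ω)) (orderStat z) ∂ρ) P :=
          hmi.comp_aemeasurable hx.aemeasurable
        rw [lintegral_const_mul' 2 _ (by norm_num), lintegral_add_left' hmx]
    _ ≤ 2 * (ENNReal.ofReal (16 * Real.pi * v * (1 + Real.log k)) +
          ENNReal.ofReal (16 * Real.pi * v * (1 + Real.log k))) := by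
        gcongr
        · exact hlaw x hx
        · exact hlaw y hy
    _ = _ := by
        rw [← two_mul, show (2 : ℝ≥0∞) = ENNReal.ofReal 2 by simp,
          ← ENNReal.ofReal_mul (by norm_num), ← ENNReal.ofReal_mul (by norm_num)]
        congr 1; ring

end GaussianGap

section Chaining

theorem lintegral_exp_sq_gaussianReal_le {v : ℝ≥0} {c : ℝ} (hv : v ≤ c) :
    ∫⁻ x, ENNReal.ofReal (Real.exp (x ^ 2 / (4 * c))) ∂(gaussianReal 0 v) ≤ ENNReal.ofReal 2 := by
  by_cases h0 : v = 0
  · rw [h0, gaussianReal_zero_var, lintegral_dirac]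
    exact ENNReal.ofReal_le_ofReal (by norm_num)
  have hv' : (0 : ℝ) < v := lt_of_le_of_ne v.2 (by exact_mod_cast (Ne.symm h0))
  have h2v : 2 * v ≠ 0 := mul_ne_zero two_ne_zero h0
  have hm : Measurable fun x : ℝ ↦ ENNReal.ofReal (Real.exp (x ^ 2 / (4 * c))) := by fun_prop
  rw [gaussianReal_of_var_ne_zero 0 h0,
    lintegral_withDensity_eq_lintegral_mul _ (measurable_gaussianPDF 0 v) hm]
  calc ∫⁻ x, (gaussianPDF 0 v * fun x : ℝ ↦ ENNReal.ofReal (Real.exp (x ^ 2 / (4 * c)))) x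
      ≤ ∫⁻ x, ENNReal.ofReal 2 * gaussianPDF 0 (2 * v) x := by
        refine lintegral_mono fun x ↦ ?_
        simp only [Pi.mul_apply, gaussianPDF]
        rw [← ENNReal.ofReal_mul (gaussianPDFReal_nonneg _ _ _), ← ENNReal.ofReal_mul (by norm_num)]
        refine ENNReal.ofReal_le_ofReal ?_
        simp only [gaussianPDFReal, sub_zero]
        push_cast
        rw [mul_assoc, ← Real.exp_add, ← mul_assoc]
        have h1 : -x ^ 2 / (2 * v) + x ^ 2 / (4 * c) ≤ -x ^ 2 / (2 * (2 * v)) := by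
          have : x ^ 2 / (4 * c) ≤ x ^ 2 / (4 * v) := by gcongr
          have e : -x ^ 2 / (2 * (v : ℝ)) + x ^ 2 / (4 * v) = -x ^ 2 / (2 * (2 * v)) := by
            field_simp; ring
          linarith
        have h2 : (√(2 * Real.pi * v))⁻¹ ≤ 2 * (√(2 * Real.pi * (2 * v)))⁻¹ := by
          have e : √(2 * Real.pi * (2 * v)) = √2 * √(2 * Real.pi * v) := by
            rw [← Real.sqrt_mul (by norm_num)]; congr 1; ring
          have hs2 : √2 ≤ 2 := by rw [Real.sqrt_le_left] <;> norm_num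
          have hs20 : 0 < √2 := by positivity
          rw [e, mul_inv, ← mul_assoc]
          refine le_mul_of_one_le_left (by positivity) ?_
          rw [← div_eq_mul_inv, one_le_div hs20]; exact hs2
        gcongr
    _ = _ := by
        rw [lintegral_const_mul _ (measurable_gaussianPDF 0 _),
          lintegral_gaussianPDF_eq_one 0 h2v, mul_one]

variable {Ω : Type*} [MeasurableSpace Ω] {P : Measure Ω} [IsProbabilityMeasure P]

/-- A dominating variable for the squares of finitely many centred Gaussian variables. -/
theorem exists_dominating_gaussian_sq {ι : Type*} [Fintype ι] [Nonempty ι] {g : ι → Ω → ℝ} {c : ℝ}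
    (hc : 0 < c) (hg : ∀ i, ∃ v : ℝ≥0, (v : ℝ) ≤ c ∧ HasLaw (g i) (gaussianReal 0 v) P) :
    ∃ M : Ω → ℝ, AEMeasurable M P ∧ (∀ ω, 0 ≤ M ω) ∧ (∀ ω i, g i ω ^ 2 ≤ M ω) ∧
      ∫⁻ ω, ENNReal.ofReal (M ω) ∂P ≤
        ENNReal.ofReal (4 * c * (Real.log (Fintype.card ι) + 2)) := by
  set N : ℝ := (Fintype.card ι : ℝ) with hN
  have hN1 : 1 ≤ N := by rw [hN]; exact_mod_cast Fintype.card_pos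
  have hN0 : 0 < N := by linarith
  have hlog : 0 ≤ Real.log N := Real.log_nonneg hN1
  have hgm : ∀ i, AEMeasurable (g i) P := fun i ↦ (hg i).choose_spec.2.aemeasurable
  have hem : ∀ i, AEMeasurable (fun ω ↦ Real.exp (g i ω ^ 2 / (4 * c))) P := fun i ↦
    Real.measurable_exp.comp_aemeasurable (((hgm i).pow_const 2).div_const _)
  refine ⟨fun ω ↦ 4 * c * (Real.log N + (∑ i, Real.exp (g i ω ^ 2 / (4 * c))) / N), ?_, ?_, ?_, ?_⟩
  · exact (((Finset.aemeasurable_fun_sum _ fun i _ ↦ hem i).div_const N).const_add _).const_mul _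
  · intro ω; positivity
  · intro ω i
    have h1 : g i ω ^ 2 / (4 * c) ≤ Real.log N + Real.exp (g i ω ^ 2 / (4 * c)) / N := by
      have h := Real.add_one_le_exp (g i ω ^ 2 / (4 * c) - Real.log N)
      rw [Real.exp_sub, Real.exp_log hN0] at h
      linarith
    have h2 : Real.exp (g i ω ^ 2 / (4 * c)) ≤ ∑ i, Real.exp (g i ω ^ 2 / (4 * c)) :=
      Finset.single_le_sum (f := fun i ↦ Real.exp (g i ω ^ 2 / (4 * c)))
        (fun j _ ↦ (Real.exp_pos _).le) (Finset.mem_univ i)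
    rw [div_le_iff₀' (by positivity)] at h1
    refine h1.trans ?_
    beta_reduce
    gcongr
  · have h1 : ∀ i, ∫⁻ ω, ENNReal.ofReal (Real.exp (g i ω ^ 2 / (4 * c))) ∂P ≤ ENNReal.ofReal 2 := by
      intro i
      obtain ⟨v, hv, hlaw⟩ := hg i
      have hm : Measurable fun x : ℝ ↦ ENNReal.ofReal (Real.exp (x ^ 2 / (4 * c))) := by fun_prop
      have := lintegral_map' (μ := P) (g := g i) hm.aemeasurable hlaw.aemeasurable
      rw [← this, hlaw.map_eq]
      exact lintegral_exp_sq_gaussianReal_le hv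
    have h2 : ∀ ω, ENNReal.ofReal (4 * c * (Real.log N +
        (∑ i, Real.exp (g i ω ^ 2 / (4 * c))) / N)) = ENNReal.ofReal (4 * c) *
        (ENNReal.ofReal (Real.log N) + ENNReal.ofReal N⁻¹ *
          ∑ i, ENNReal.ofReal (Real.exp (g i ω ^ 2 / (4 * c)))) := by
      intro ω
      have h3 : 0 ≤ ∑ i, Real.exp (g i ω ^ 2 / (4 * c)) := by positivity
      rw [ENNReal.ofReal_mul (p := 4 * c) (by positivity), ENNReal.ofReal_add hlog (by positivity),
        div_eq_inv_mul, ENNReal.ofReal_mul (p := N⁻¹) (by positivity),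
        ENNReal.ofReal_sum_of_nonneg fun i _ ↦ (Real.exp_pos _).le]
    simp_rw [h2]
    rw [lintegral_const_mul' _ _ ENNReal.ofReal_ne_top, lintegral_add_left measurable_const,
      lintegral_const_mul' _ _ ENNReal.ofReal_ne_top, lintegral_finsetSum' _
        fun i _ ↦ (hem i).ennreal_ofReal, ENNReal.ofReal_mul (p := 4 * c) (by positivity)]
    gcongr
    rw [ENNReal.ofReal_add hlog (by norm_num)]
    gcongr
    · simp
    · calc ENNReal.ofReal N⁻¹ * ∑ i, ∫⁻ ω, ENNReal.ofReal (Real.exp (g i ω ^ 2 / (4 * c))) ∂P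
          ≤ ENNReal.ofReal N⁻¹ * ∑ _i : ι, ENNReal.ofReal 2 := by gcongr with i; exact h1 i
        _ = _ := by
          rw [Finset.sum_const, Finset.card_univ, nsmul_eq_mul, ← ENNReal.ofReal_natCast,
            ← ENNReal.ofReal_mul (by positivity), ← ENNReal.ofReal_mul (by positivity)]
          congr 1
          rw [← hN]; field_simp

/-- Deterministic chaining along dyadic partitions. -/
theorem sq_le_tsum_of_dyadic_increments {y : ℝ → ℝ} {T : ℝ} (hT : 0 < T) (h₀ : y 0 = 0)
    (hy : ContinuousOn y (Set.Icc 0 T)) {m : ℕ → ℝ} (hm : ∀ n, 0 ≤ m n)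
    (hinc : ∀ n j : ℕ, j < 2 ^ n → (y ((j + 1 : ℕ) * (T / 2 ^ n)) - y (j * (T / 2 ^ n))) ^ 2 ≤ m n)
    {t : ℝ} (ht : t ∈ Set.Icc 0 T) :
    ENNReal.ofReal (y t ^ 2) ≤ 4 * ∑' n, ENNReal.ofReal ((4 / 3) ^ n * m n) := by
  have hinc' : ∀ n j : ℕ, j < 2 ^ n →
      |y ((j + 1 : ℕ) * (T / 2 ^ n)) - y (j * (T / 2 ^ n))| ≤ √(m n) :=
    fun n j hj ↦ Real.abs_le_sqrt (hinc n j hj)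
  have hdy : ∀ n j : ℕ, j ≤ 2 ^ n → |y (j * (T / 2 ^ n))| ≤ ∑ l ∈ Finset.range (n + 1), √(m l) := by
    intro n
    induction n with
    | zero =>
      intro j hj
      simp only [pow_zero] at hj
      rcases Nat.le_one_iff_eq_zero_or_eq_one.mp hj with rfl | rfl
      · simp [h₀]
      · have := hinc' 0 0 (by simp)
        simpa [h₀] using this
    | succ n ih =>
      intro j hj
      rw [Finset.sum_range_succ]
      have hhalf : ∀ i : ℕ, ((2 * i : ℕ) : ℝ) * (T / 2 ^ (n + 1)) = i * (T / 2 ^ n) := by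
        intro i; push_cast; rw [pow_succ]; field_simp
      rcases Nat.even_or_odd' j with ⟨i, rfl | rfl⟩
      · rw [hhalf]
        have := ih i (by rw [pow_succ] at hj; omega)
        linarith [Real.sqrt_nonneg (m (n + 1))]
      · have h1 := hinc' (n + 1) (2 * i) (by omega)
        have h2 := ih i (by rw [pow_succ] at hj; omega)
        rw [hhalf i] at h1
        have h3 := abs_sub_abs_le_abs_sub (y ((2 * i + 1 : ℕ) * (T / 2 ^ (n + 1))))
          (y (i * (T / 2 ^ n)))
        linarith
  set K : ℝ≥0∞ := 4 * ∑' n, ENNReal.ofReal ((4 / 3) ^ n * m n) with hK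
  have hdy2 : ∀ n j : ℕ, j ≤ 2 ^ n → ENNReal.ofReal (y (j * (T / 2 ^ n)) ^ 2) ≤ K := by
    intro n j hj
    have h1 : (∑ l ∈ Finset.range (n + 1), √(m l)) ^ 2 ≤
        (∑ l ∈ Finset.range (n + 1), ((3 / 4 : ℝ)) ^ l) *
          ∑ l ∈ Finset.range (n + 1), (4 / 3 : ℝ) ^ l * m l := by
      refine Finset.sum_sq_le_sum_mul_sum_of_sq_le_mul _ (fun l _ ↦ by positivity)
        (fun l _ ↦ mul_nonneg (by positivity) (hm l)) fun l _ ↦ ?_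
      rw [Real.sq_sqrt (hm l), ← mul_assoc, ← mul_pow]
      norm_num
    have h2 : ∑ l ∈ Finset.range (n + 1), ((3 / 4 : ℝ)) ^ l ≤ 4 := by
      have h : Summable fun l : ℕ ↦ (3 / 4 : ℝ) ^ l :=
        summable_geometric_of_lt_one (by norm_num) (by norm_num)
      refine (h.sum_le_tsum _ fun l _ ↦ by positivity).trans (le_of_eq ?_)
      rw [tsum_geometric_of_lt_one (by norm_num) (by norm_num)]
      norm_num
    have h3 : 0 ≤ ∑ l ∈ Finset.range (n + 1), (4 / 3 : ℝ) ^ l * m l :=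
      Finset.sum_nonneg fun l _ ↦ mul_nonneg (by positivity) (hm l)
    have h4 : y (j * (T / 2 ^ n)) ^ 2 ≤ 4 * ∑ l ∈ Finset.range (n + 1), (4 / 3 : ℝ) ^ l * m l := by
      rw [← sq_abs]
      have h5 := hdy n j hj
      have h6 : |y (j * (T / 2 ^ n))| ^ 2 ≤ (∑ l ∈ Finset.range (n + 1), √(m l)) ^ 2 := by gcongr
      exact h6.trans (h1.trans (by gcongr))
    refine (ENNReal.ofReal_le_ofReal h4).trans ?_
    rw [ENNReal.ofReal_mul (by norm_num), ENNReal.ofReal_sum_of_nonneg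
      fun l _ ↦ mul_nonneg (by positivity) (hm l), hK]
    gcongr
    · simp
    · exact ENNReal.sum_le_tsum _
  have hle : ∀ n : ℕ, ⌊t / T * 2 ^ n⌋₊ ≤ 2 ^ n := by
    intro n
    refine Nat.floor_le_of_le ?_
    push_cast
    refine mul_le_of_le_one_left (by positivity) ?_
    rw [div_le_one hT]; exact ht.2
  have hlim : Tendsto (fun n : ℕ ↦ (⌊t / T * 2 ^ n⌋₊ : ℝ) * (T / 2 ^ n)) atTop (𝓝 t) := by
    have h1 := (tendsto_nat_floor_mul_div_atTop (R := ℝ) (a := t / T) (div_nonneg ht.1 hT.le)).comp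
      (tendsto_pow_atTop_atTop_of_one_lt (r := (2 : ℝ)) (by norm_num))
    have h2 := h1.mul_const T
    rw [div_mul_cancel₀ _ hT.ne'] at h2
    refine h2.congr fun n ↦ ?_
    simp only [Function.comp]; ring
  have hmem : ∀ n : ℕ, (⌊t / T * 2 ^ n⌋₊ : ℝ) * (T / 2 ^ n) ∈ Set.Icc 0 T := by
    intro n
    refine ⟨by positivity, ?_⟩
    have : (⌊t / T * 2 ^ n⌋₊ : ℝ) ≤ 2 ^ n := by exact_mod_cast hle n
    calc (⌊t / T * 2 ^ n⌋₊ : ℝ) * (T / 2 ^ n) ≤ 2 ^ n * (T / 2 ^ n) := by gcongr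
      _ = T := by field_simp
  have hyl : Tendsto (fun n : ℕ ↦ y ((⌊t / T * 2 ^ n⌋₊ : ℝ) * (T / 2 ^ n))) atTop (𝓝 (y t)) :=
    (hy t ht).tendsto.comp (tendsto_nhdsWithin_iff.mpr ⟨hlim, Eventually.of_forall hmem⟩)
  have hc : Continuous fun x : ℝ ↦ ENNReal.ofReal (x ^ 2) :=
    ENNReal.continuous_ofReal.comp (continuous_pow 2)
  exact le_of_tendsto ((hc.tendsto _).comp hyl) (Eventually.of_forall fun n ↦ hdy2 n _ (hle n))

/-- Chaining for finitely many Gaussian processes whose increments are dominated by those of a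
Brownian motion. -/
theorem exists_dominating_gaussian_process_sq {ι : Type*} [Fintype ι] [Nonempty ι]
    {Y : ι → ℝ → Ω → ℝ} {T : ℝ} (hT : 0 < T)
    (hcont : ∀ i, ∀ᵐ ω ∂P, ContinuousOn (fun t ↦ Y i t ω) (Set.Icc 0 T))
    (hzero : ∀ i, ∀ᵐ ω ∂P, Y i 0 ω = 0)
    (hlaw : ∀ i, ∀ s ∈ Set.Icc 0 T, ∀ t ∈ Set.Icc 0 T, s ≤ t →
      ∃ v : ℝ≥0, (v : ℝ) ≤ t - s ∧ HasLaw (fun ω ↦ Y i t ω - Y i s ω) (gaussianReal 0 v) P) :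
    ∃ M : Ω → ℝ≥0∞, AEMeasurable M P ∧
      (∀ᵐ ω ∂P, ∀ i, ∀ t ∈ Set.Icc 0 T, ENNReal.ofReal (Y i t ω ^ 2) ≤ M ω) ∧
      ∫⁻ ω, M ω ∂P ≤ ENNReal.ofReal (48 * T * (Real.log (Fintype.card ι) + 4)) := by
  have hN1 : (1 : ℝ) ≤ Fintype.card ι := by exact_mod_cast Fintype.card_pos
  have hlogN := Real.log_nonneg hN1
  have hlevel : ∀ n : ℕ, ∃ M : Ω → ℝ, AEMeasurable M P ∧ (∀ ω, 0 ≤ M ω) ∧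
      (∀ ω, ∀ q : ι × Fin (2 ^ n), (Y q.1 ((q.2.val + 1 : ℕ) * (T / 2 ^ n)) ω -
        Y q.1 (q.2.val * (T / 2 ^ n)) ω) ^ 2 ≤ M ω) ∧
      ∫⁻ ω, ENNReal.ofReal (M ω) ∂P ≤ ENNReal.ofReal (4 * (T / 2 ^ n) *
        (Real.log (Fintype.card (ι × Fin (2 ^ n))) + 2)) := by
    intro n
    have : Nonempty (Fin (2 ^ n)) := ⟨⟨0, by positivity⟩⟩
    refine exists_dominating_gaussian_sq (g := fun (q : ι × Fin (2 ^ n)) ω ↦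
      Y q.1 ((q.2.val + 1 : ℕ) * (T / 2 ^ n)) ω - Y q.1 (q.2.val * (T / 2 ^ n)) ω)
      (by positivity) fun q ↦ ?_
    have hq : ((q.2.val + 1 : ℕ) : ℝ) ≤ 2 ^ n := by exact_mod_cast q.2.2
    have h1 : ((q.2.val + 1 : ℕ) : ℝ) * (T / 2 ^ n) ≤ T := by
      calc ((q.2.val + 1 : ℕ) : ℝ) * (T / 2 ^ n) ≤ 2 ^ n * (T / 2 ^ n) := by gcongr
        _ = T := by field_simp
    have h2 : (q.2.val : ℝ) * (T / 2 ^ n) ≤ ((q.2.val + 1 : ℕ) : ℝ) * (T / 2 ^ n) := by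
      gcongr; simp
    obtain ⟨v, hv, hl⟩ := hlaw q.1 _ ⟨by positivity, h2.trans h1⟩ _ ⟨by positivity, h1⟩ h2
    refine ⟨v, hv.trans (le_of_eq ?_), hl⟩
    push_cast; ring
  choose M hMm hM0 hMb hMi using hlevel
  refine ⟨fun ω ↦ 4 * ∑' n, ENNReal.ofReal ((4 / 3) ^ n * M n ω), ?_, ?_, ?_⟩
  · exact (AEMeasurable.tsum fun n ↦ ((hMm n).const_mul _).ennreal_ofReal).const_mul _
  · filter_upwards [ae_all_iff.mpr hcont, ae_all_iff.mpr hzero] with ω hc hz i t ht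
    exact sq_le_tsum_of_dyadic_increments hT (hz i) (hc i) (fun n ↦ hM0 n ω)
      (fun n j hj ↦ hMb n ω (i, ⟨j, hj⟩)) ht
  · rw [lintegral_const_mul' _ _ (by norm_num),
      lintegral_tsum fun n ↦ ((hMm n).const_mul _).ennreal_ofReal]
    have hterm : ∀ n, ∫⁻ ω, ENNReal.ofReal ((4 / 3) ^ n * M n ω) ∂P ≤
        ENNReal.ofReal (4 * T * ((2 / 3) ^ n * (Real.log (Fintype.card ι) + 2) +
          n * (2 / 3) ^ n)) := by
      intro n
      simp_rw [fun ω ↦ ENNReal.ofReal_mul (q := M n ω) (by positivity : (0 : ℝ) ≤ (4 / 3) ^ n)]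
      rw [lintegral_const_mul' _ _ ENNReal.ofReal_ne_top]
      refine (mul_le_mul_right (hMi n) _).trans ?_
      rw [← ENNReal.ofReal_mul (by positivity)]
      refine ENNReal.ofReal_le_ofReal ?_
      rw [Fintype.card_prod, Fintype.card_fin, Nat.cast_mul, Real.log_mul (by positivity)
        (by positivity)]
      push_cast
      rw [Real.log_pow]
      have hl2 : Real.log 2 ≤ 1 := by linarith [Real.log_two_lt_d9]
      have e : (2 / 3 : ℝ) ^ n = (4 / 3) ^ n / 2 ^ n := by rw [← div_pow]; norm_num
      rw [e]
      have h3 : (n : ℝ) * Real.log 2 ≤ n := mul_le_of_le_one_right (by positivity) hl2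
      calc (4 / 3 : ℝ) ^ n * (4 * (T / 2 ^ n) *
            (Real.log (Fintype.card ι) + n * Real.log 2 + 2))
          ≤ (4 / 3 : ℝ) ^ n * (4 * (T / 2 ^ n) * (Real.log (Fintype.card ι) + n + 2)) := by
            gcongr
        _ = _ := by ring
    have hsum : HasSum (fun n : ℕ ↦ 4 * T * ((2 / 3 : ℝ) ^ n * (Real.log (Fintype.card ι) + 2) +
        n * (2 / 3) ^ n)) (4 * T * (3 * (Real.log (Fintype.card ι) + 2) + 6)) := by
      have h1 := hasSum_geometric_of_lt_one (r := (2 / 3 : ℝ)) (by norm_num) (by norm_num)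
      have h2 := hasSum_coe_mul_geometric_of_norm_lt_one (r := (2 / 3 : ℝ))
        (by rw [Real.norm_eq_abs, abs_of_pos] <;> norm_num)
      have h3 := ((h1.mul_right (Real.log (Fintype.card ι) + 2)).add h2).mul_left (4 * T)
      have e : 4 * T * ((1 - 2 / 3)⁻¹ * (Real.log (Fintype.card ι) + 2) +
          2 / 3 / (1 - 2 / 3 : ℝ) ^ 2) = 4 * T * (3 * (Real.log (Fintype.card ι) + 2) + 6) := by
        norm_num
      rw [← e]
      exact h3
    calc 4 * ∑' n, ∫⁻ ω, ENNReal.ofReal ((4 / 3) ^ n * M n ω) ∂P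
        ≤ 4 * ∑' n : ℕ, ENNReal.ofReal (4 * T * ((2 / 3) ^ n *
            (Real.log (Fintype.card ι) + 2) + n * (2 / 3) ^ n)) := by
          gcongr with n; exact hterm n
      _ = _ := by
          rw [← ENNReal.ofReal_tsum_of_nonneg (fun n ↦ by positivity) hsum.summable, hsum.tsum_eq,
            show (4 : ℝ≥0∞) = ENNReal.ofReal 4 by simp, ← ENNReal.ofReal_mul (by norm_num)]
          congr 1; ring

end Chaining

section GaussianIncrements

variable {Ω : Type*} [MeasurableSpace Ω] {P : Measure Ω} {T : ℝ} {Y : ℝ → Ω → ℝ}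

theorem integral_increment_eq_zero (hY : IsGaussianProcess (fun t : Set.Icc 0 T ↦ Y t) P)
    (h₀ : ∀ t ∈ Set.Icc 0 T, ∫ ω, Y t ω ∂P = 0) {s t : ℝ} (hs : s ∈ Set.Icc 0 T)
    (ht : t ∈ Set.Icc 0 T) : ∫ ω, (Y t ω - Y s ω) ∂P = 0 := by
  rw [integral_sub (hY.hasGaussianLaw_eval ⟨t, ht⟩).integrable
    (hY.hasGaussianLaw_eval ⟨s, hs⟩).integrable, h₀ t ht, h₀ s hs, sub_zero]

theorem IsBrownianBridge.ae_eq_zero {b : ℝ → Ω → ℝ} (hb : IsBrownianBridge T b P) {t : ℝ}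
    (ht : t ∈ Set.Icc 0 T) (h : t = 0 ∨ t = T) : ∀ᵐ ω ∂P, b t ω = 0 := by
  have hg : HasGaussianLaw (b t) P := hb.gaussian.hasGaussianLaw_eval ⟨t, ht⟩
  have hvar : Var[b t; P] = 0 := by
    rw [← covariance_self hg.aemeasurable, hb.covariance t ht t ht le_rfl]
    rcases h with rfl | rfl <;> simp
  have hmap := hg.map_eq_gaussianReal
  rw [hvar, hb.mean_zero t ht, Real.toNNReal_zero, gaussianReal_zero_var] at hmap
  have : ∀ᵐ x ∂(P.map (b t)), x = 0 := by rw [hmap, ae_dirac_eq]; rfl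
  exact ae_of_ae_map hg.aemeasurable this

variable [IsProbabilityMeasure P]

theorem variance_increment (hY : IsGaussianProcess (fun t : Set.Icc 0 T ↦ Y t) P)
    {s t : ℝ} (hs : s ∈ Set.Icc 0 T) (ht : t ∈ Set.Icc 0 T) :
    Var[fun ω ↦ Y t ω - Y s ω; P] =
      cov[Y t, Y t; P] - 2 * cov[Y s, Y t; P] + cov[Y s, Y s; P] := by
  have h1 := hY.hasGaussianLaw_eval ⟨t, ht⟩
  have h2 := hY.hasGaussianLaw_eval ⟨s, hs⟩
  rw [variance_fun_sub h1.memLp_two h2.memLp_two, covariance_self h1.aemeasurable,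
    covariance_self h2.aemeasurable, covariance_comm (Y s)]

theorem hasLaw_increment (hY : IsGaussianProcess (fun t : Set.Icc 0 T ↦ Y t) P)
    (h₀ : ∀ t ∈ Set.Icc 0 T, ∫ ω, Y t ω ∂P = 0) {s t : ℝ} (hs : s ∈ Set.Icc 0 T)
    (ht : t ∈ Set.Icc 0 T) :
    HasLaw (fun ω ↦ Y t ω - Y s ω)
      (gaussianReal 0 (cov[Y t, Y t; P] - 2 * cov[Y s, Y t; P] + cov[Y s, Y s; P]).toNNReal) P := by
  have h : HasGaussianLaw (fun ω ↦ Y t ω - Y s ω) P :=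
    hY.hasGaussianLaw_fun_sub (s := ⟨t, ht⟩) (t := ⟨s, hs⟩)
  refine ⟨h.aemeasurable, ?_⟩
  rw [h.map_eq_gaussianReal, integral_increment_eq_zero hY h₀ hs ht, variance_increment hY hs ht]

theorem IsBrownianBridge.increment_law {b : ℝ → Ω → ℝ} (hT : 0 < T) (hb : IsBrownianBridge T b P)
    {s t : ℝ} (hs : s ∈ Set.Icc 0 T) (ht : t ∈ Set.Icc 0 T) (hst : s ≤ t) :
    ∃ v : ℝ≥0, (v : ℝ) ≤ t - s ∧ HasLaw (fun ω ↦ b t ω - b s ω) (gaussianReal 0 v) P := by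
  refine ⟨_, ?_, hasLaw_increment hb.gaussian hb.mean_zero hs ht⟩
  rw [hb.covariance t ht t ht le_rfl, hb.covariance s hs t ht hst, hb.covariance s hs s hs le_rfl,
    Real.coe_toNNReal', max_le_iff]
  refine ⟨?_, by linarith⟩
  have : t * (T - t) / T - 2 * (s * (T - t) / T) + s * (T - s) / T = t - s - (t - s) ^ 2 / T := by
    field_simp; ring
  rw [this]
  have : 0 ≤ (t - s) ^ 2 / T := by positivity
  linarith

end GaussianIncrements

section BrownianFromBridge

variable {Ω : Type*} [MeasurableSpace Ω] {P : Measure Ω}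
  {B : ℝ → Ω → ℝ} {Z : Ω → ℝ}

theorem isGaussianProcess_bridge_add (hB : IsBrownianBridge 1 B P)
    (hZ : HasLaw Z (gaussianReal 0 1) P)
    (hBZ : IndepFun (fun ω (t : Set.Icc (0 : ℝ) 1) ↦ B t ω) Z P) :
    IsGaussianProcess (fun (t : Set.Icc (0 : ℝ) 1) ω ↦ B t ω + t * Z ω) P := by
  refine ⟨fun I ↦ ?_⟩
  have hI := hB.gaussian.hasGaussianLaw I
  have hind : IndepFun (fun ω ↦ I.restrict fun t : Set.Icc (0 : ℝ) 1 ↦ B t ω) Z P :=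
    hBZ.comp (φ := I.restrict) (ψ := id) (Finset.measurable_restrict I) measurable_id
  have hj := hind.hasGaussianLaw hI hZ.hasGaussianLaw
  exact hj.map_fun (ContinuousLinearMap.fst ℝ (I → ℝ) ℝ +
    (ContinuousLinearMap.snd ℝ (I → ℝ) ℝ).smulRight (fun t : I ↦ ((t : Set.Icc (0 : ℝ) 1) : ℝ)))
    |>.congr (Eventually.of_forall fun ω ↦ by
      ext t
      simp [mul_comm])

theorem integral_bridge_add (hB : IsBrownianBridge 1 B P) (hZ : HasLaw Z (gaussianReal 0 1) P)
    {t : ℝ} (ht : t ∈ Set.Icc (0 : ℝ) 1) : ∫ ω, (B t ω + t * Z ω) ∂P = 0 := by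
  have hg : HasGaussianLaw (B t) P := hB.gaussian.hasGaussianLaw_eval ⟨t, ht⟩
  have hZi : Integrable Z P := hZ.hasGaussianLaw.integrable
  rw [integral_add hg.integrable (hZi.const_mul t), hB.mean_zero t ht, integral_const_mul,
    hZ.integral_eq]
  simp

variable [IsProbabilityMeasure P]

theorem covariance_bridge_add (hB : IsBrownianBridge 1 B P) (hZ : HasLaw Z (gaussianReal 0 1) P)
    (hBZ : IndepFun (fun ω (t : Set.Icc (0 : ℝ) 1) ↦ B t ω) Z P) {s t : ℝ}
    (hs : s ∈ Set.Icc (0 : ℝ) 1) (ht : t ∈ Set.Icc (0 : ℝ) 1) (hst : s ≤ t) :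
    cov[fun ω ↦ B s ω + s * Z ω, fun ω ↦ B t ω + t * Z ω; P] = s := by
  have hL : ∀ r ∈ Set.Icc (0 : ℝ) 1, MemLp (B r) 2 P := fun r hr ↦
    HasGaussianLaw.memLp_two (hB.gaussian.hasGaussianLaw_eval ⟨r, hr⟩)
  have hZ2 : MemLp Z 2 P := hZ.hasGaussianLaw.memLp_two
  have hZc : ∀ r : ℝ, MemLp (fun ω ↦ r * Z ω) 2 P := fun r ↦ hZ2.const_mul r
  have hc : ∀ r ∈ Set.Icc (0 : ℝ) 1, cov[B r, Z; P] = 0 := by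
    intro r hr
    have : IndepFun (B r) Z P := hBZ.comp
      (φ := fun x : Set.Icc (0 : ℝ) 1 → ℝ ↦ x ⟨r, hr⟩) (ψ := id)
      (measurable_pi_apply (⟨r, hr⟩ : Set.Icc (0 : ℝ) 1)) measurable_id
    exact this.covariance_eq_zero (hL r hr) hZ2
  have hvZ : cov[Z, Z; P] = 1 := by
    rw [covariance_self hZ.aemeasurable, hZ.variance_eq]
    simp
  have hsum : ∀ r : ℝ, (fun ω ↦ B r ω + r * Z ω) = B r + fun ω ↦ r * Z ω := fun r ↦ rfl
  rw [hsum, hsum, covariance_add_left (hL s hs) (hZc s) ((hL t ht).add (hZc t)),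
    covariance_add_right (hL s hs) (hL t ht) (hZc t),
    covariance_add_right (hZc s) (hL t ht) (hZc t), covariance_const_mul_left,
    covariance_const_mul_left, covariance_const_mul_right, covariance_const_mul_right, hvZ,
    hc s hs, covariance_comm Z, hc t ht, hB.covariance s hs t ht hst]
  ring

variable {k : ℕ}

theorem div_mem_Icc_zero_one {a b : ℝ} (h₀ : 0 ≤ a) (h₁ : a ≤ b) : a / b ∈ Set.Icc (0 : ℝ) 1 :=
  ⟨div_nonneg h₀ (h₀.trans h₁), div_le_one_of_le₀ h₁ (h₀.trans h₁)⟩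

theorem hasLaw_pathIncrement_bridge_add (hk : 1 ≤ k) (hB : IsBrownianBridge 1 B P)
    (hZ : HasLaw Z (gaussianReal 0 1) P)
    (hBZ : IndepFun (fun ω (t : Set.Icc (0 : ℝ) 1) ↦ B t ω) Z P) :
    HasLaw (fun ω (i : Fin k) ↦ pathIncrement k (fun t ω ↦ B t ω + t * Z ω) i ω)
      (Measure.pi fun _ ↦ gaussianReal 0 (1 / k)) P := by
  have hk0 : (0 : ℝ) < k := by exact_mod_cast hk
  set Y : ℝ → Ω → ℝ := fun t ω ↦ B t ω + t * Z ω with hYdef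
  have hY : IsGaussianProcess (fun t : Set.Icc (0 : ℝ) 1 ↦ Y t) P :=
    isGaussianProcess_bridge_add hB hZ hBZ
  have hcov : ∀ s ∈ Set.Icc (0 : ℝ) 1, ∀ t ∈ Set.Icc (0 : ℝ) 1, s ≤ t → cov[Y s, Y t; P] = s :=
    fun s hs t ht hst ↦ covariance_bridge_add hB hZ hBZ hs ht hst
  have hlt : ∀ i : Fin k, ((i : ℕ) : ℝ) + 1 ≤ k := fun i ↦ by exact_mod_cast i.2
  have hl : ∀ i : Fin k, ((i : ℕ) : ℝ) / k ∈ Set.Icc (0 : ℝ) 1 := fun i ↦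
    div_mem_Icc_zero_one (by positivity) (by linarith [hlt i])
  have hr : ∀ i : Fin k, ((i : ℕ) + 1 : ℝ) / k ∈ Set.Icc (0 : ℝ) 1 := fun i ↦
    div_mem_Icc_zero_one (by positivity) (hlt i)
  have hlr : ∀ i : Fin k, ((i : ℕ) : ℝ) / k ≤ ((i : ℕ) + 1 : ℝ) / k := fun i ↦ by
    gcongr; linarith
  have hL : ∀ r ∈ Set.Icc (0 : ℝ) 1, MemLp (Y r) 2 P := fun r hr ↦
    HasGaussianLaw.memLp_two (hY.hasGaussianLaw_eval ⟨r, hr⟩)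
  have hjoint : HasGaussianLaw (fun ω (i : Fin k) ↦ pathIncrement k Y i ω) P := by
    have := hY.hasGaussianLaw_increments (n := k) (t := fun j ↦ ⟨((j : ℕ) : ℝ) / k,
      div_mem_Icc_zero_one (by positivity) (by exact_mod_cast Nat.lt_succ_iff.mp j.2)⟩)
    simpa [pathIncrement] using this
  have hlaw : ∀ i : Fin k, HasLaw (pathIncrement k Y i) (gaussianReal 0 (1 / k)) P := by
    intro i
    have h := hasLaw_increment hY (fun t ht ↦ integral_bridge_add hB hZ ht) (hl i) (hr i)
    rw [hcov _ (hr i) _ (hr i) le_rfl, hcov _ (hl i) _ (hr i) (hlr i),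
      hcov _ (hl i) _ (hl i) le_rfl] at h
    have e : (((i : ℕ) + 1 : ℝ) / k - 2 * (((i : ℕ) : ℝ) / k) + ((i : ℕ) : ℝ) / k).toNNReal =
        (1 / k : ℝ≥0) := by
      rw [← NNReal.coe_inj, Real.coe_toNNReal', max_eq_left]
      · push_cast; ring
      · have : ((i : ℕ) + 1 : ℝ) / k - 2 * (((i : ℕ) : ℝ) / k) + ((i : ℕ) : ℝ) / k = 1 / k := by
          ring
        rw [this]; positivity
    rw [e] at h
    exact h
  have hcov0 : ∀ i j : Fin k, i < j → cov[pathIncrement k Y i, pathIncrement k Y j; P] = 0 := by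
    intro i j hij
    have hij' : ((i : ℕ) + 1 : ℝ) / k ≤ ((j : ℕ) : ℝ) / k := by
      gcongr; exact_mod_cast hij
    have e : ∀ i : Fin k, pathIncrement k Y i = Y (((i : ℕ) + 1 : ℝ) / k) - Y (((i : ℕ) : ℝ) / k) :=
      fun i ↦ rfl
    rw [e, e, covariance_sub_left (hL _ (hr i)) (hL _ (hl i)) ((hL _ (hr j)).sub (hL _ (hl j))),
      covariance_sub_right (hL _ (hr i)) (hL _ (hr j)) (hL _ (hl j)),
      covariance_sub_right (hL _ (hl i)) (hL _ (hr j)) (hL _ (hl j)),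
      hcov _ (hr i) _ (hr j) (hij'.trans (hlr j)), hcov _ (hr i) _ (hl j) hij',
      hcov _ (hl i) _ (hr j) ((hlr i).trans (hij'.trans (hlr j))),
      hcov _ (hl i) _ (hl j) ((hlr i).trans hij')]
    ring
  have hind : iIndepFun (fun i : Fin k ↦ pathIncrement k Y i) P := by
    refine hjoint.iIndepFun_of_covariance_eq_zero fun i j hij ↦ ?_
    rcases lt_or_gt_of_ne hij with h | h
    · exact hcov0 i j h
    · rw [covariance_comm]; exact hcov0 j i h
  refine ⟨hjoint.aemeasurable, ?_⟩
  rw [(iIndepFun_iff_map_fun_eq_pi_map fun i ↦ (hlaw i).aemeasurable).mp hind]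
  congr 1
  ext1 i
  exact (hlaw i).map_eq

end BrownianFromBridge

section Exchangeable

variable {k : ℕ}

theorem measurable_maxPartialSq : Measurable (maxPartialSq : (Fin k → ℝ) → ℝ≥0∞) := by
  unfold maxPartialSq
  exact Measurable.iSup fun m ↦ by fun_prop

/-- Maximal inequality for an exchangeable sequence. -/
theorem lintegral_maxPartialSq_le {α : Type*} [MeasurableSpace α] {ρ : Measure α} (hk : 2 ≤ k)
    {Ψ : α → Fin k → ℝ} (hΨ : Measurable Ψ) {T : Equiv.Perm (Fin k) → α → α}
    (hT : ∀ σ, MeasurePreserving (T σ) ρ ρ) (hΨT : ∀ σ q, Ψ (T σ q) = Ψ q ∘ σ) :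
    ∫⁻ q, maxPartialSq (Ψ q) ∂ρ ≤ 72 * ∫⁻ q, ENNReal.ofReal (∑ j, Ψ q j ^ 2) ∂ρ := by
  have hm : Measurable fun q ↦ maxPartialSq (Ψ q) := measurable_maxPartialSq.comp hΨ
  have hfac : (k.factorial : ℝ≥0∞) ≠ 0 := by exact_mod_cast k.factorial_ne_zero
  have hcomp : ∀ σ : Equiv.Perm (Fin k), ∫⁻ q, maxPartialSq (Ψ q ∘ σ) ∂ρ =
      ∫⁻ q, maxPartialSq (Ψ q) ∂ρ := by
    intro σ
    rw [← (hT σ).lintegral_comp hm]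
    simp_rw [hΨT]
  have hmσ : ∀ σ : Equiv.Perm (Fin k), Measurable fun q ↦ maxPartialSq (Ψ q ∘ σ) := by
    intro σ
    simp_rw [← hΨT]
    exact hm.comp (hT σ).measurable
  have hsum : (k.factorial : ℝ≥0∞) * ∫⁻ q, maxPartialSq (Ψ q) ∂ρ =
      ∫⁻ q, ∑ σ : Equiv.Perm (Fin k), maxPartialSq (Ψ q ∘ σ) ∂ρ := by
    rw [lintegral_finsetSum _ fun σ _ ↦ hmσ σ, Finset.sum_congr rfl fun σ _ ↦ hcomp σ]
    simp [Fintype.card_perm]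
  rw [← ENNReal.mul_le_mul_iff_right hfac (ENNReal.natCast_ne_top _), hsum]
  refine (lintegral_mono fun q ↦ sum_perm_maxPartialSq_le hk (Ψ q)).trans (le_of_eq ?_)
  have e : ∀ q, ENNReal.ofReal (72 * k.factorial * ∑ j, Ψ q j ^ 2) =
      (k.factorial * 72) * ENNReal.ofReal (∑ j, Ψ q j ^ 2) := by
    intro q
    rw [ENNReal.ofReal_mul (by positivity), ENNReal.ofReal_mul (by norm_num),
      ENNReal.ofReal_natCast, mul_comm (ENNReal.ofReal 72)]
    simp
  simp_rw [e]
  rw [lintegral_const_mul' _ _ (by finiteness), mul_assoc]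

theorem measurePreserving_comp_perm {β : Type*} [MeasurableSpace β] (μ : Measure β)
    [IsProbabilityMeasure μ] (σ : Equiv.Perm (Fin k)) :
    MeasurePreserving (fun x : Fin k → β ↦ x ∘ σ) (Measure.pi fun _ ↦ μ)
      (Measure.pi fun _ ↦ μ) := by
  have h := measurePreserving_piCongrLeft (α := fun _ : Fin k ↦ β) (fun _ ↦ μ) σ.symm
  have e : (MeasurableEquiv.piCongrLeft (fun _ : Fin k ↦ β) σ.symm : (Fin k → β) → Fin k → β) =
      fun x ↦ x ∘ σ := by
    ext x i
    have := Equiv.piCongrLeft_apply (P := fun _ : Fin k ↦ β) σ.symm x i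
    rw [MeasurableEquiv.coe_piCongrLeft, this]
    simp
  rw [← e]
  exact h

end Exchangeable

section LexRank

variable {k : ℕ}

/-- Lexicographic comparison of the pairs `(x i, v i)`. -/
def LexLT (x v : Fin k → ℝ) (i j : Fin k) : Prop := x i < x j ∨ (x i = x j ∧ v i < v j)

open scoped Classical in
/-- The rank of the `j`-th pair in the lexicographic order. -/
def lexRank (x v : Fin k → ℝ) (j : Fin k) : Fin k :=
  ⟨(Finset.univ.filter fun i ↦ LexLT x v i j).card, by
    refine lt_of_lt_of_eq (Finset.card_lt_card (Finset.filter_ssubset.mpr ⟨j, by simp, ?_⟩))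
      (Finset.card_fin k)
    simp [LexLT]⟩

theorem lexRank_comp_perm (x v : Fin k → ℝ) (σ : Equiv.Perm (Fin k)) (j : Fin k) :
    lexRank (x ∘ σ) (v ∘ σ) j = lexRank x v (σ j) := by
  classical
  refine Fin.ext ?_
  simp only [lexRank]
  exact Finset.card_equiv σ fun i ↦ by
    rw [Finset.mem_filter, Finset.mem_filter]; simp [LexLT]

theorem measurable_lexRank (j : Fin k) :
    Measurable fun q : (Fin k → ℝ) × (Fin k → ℝ) ↦ lexRank q.1 q.2 j := by
  classical
  have hset : ∀ i, MeasurableSet {q : (Fin k → ℝ) × (Fin k → ℝ) | LexLT q.1 q.2 i j} := by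
    intro i
    unfold LexLT
    measurability
  have hn : Measurable fun q : (Fin k → ℝ) × (Fin k → ℝ) ↦ (lexRank q.1 q.2 j : ℕ) := by
    have : (fun q : (Fin k → ℝ) × (Fin k → ℝ) ↦ (lexRank q.1 q.2 j : ℕ)) =
        fun q ↦ ∑ i, if LexLT q.1 q.2 i j then 1 else 0 := by
      ext q; simp [lexRank]
    rw [this]
    exact Finset.measurable_sum _ fun i _ ↦
      Measurable.ite (hset i) measurable_const measurable_const
  refine measurable_to_countable' fun r ↦ ?_
  have : (fun q : (Fin k → ℝ) × (Fin k → ℝ) ↦ lexRank q.1 q.2 j) ⁻¹' {r} =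
      (fun q ↦ (lexRank q.1 q.2 j : ℕ)) ⁻¹' {(r : ℕ)} := by
    ext q; simp [Fin.ext_iff]
  rw [this]
  exact hn (measurableSet_singleton _)

/-- The differences between the order statistics of `b + c(∑ x, u) / k`, put in the lexicographic
order of the pairs `(x i, v i)`, and the values `f (x i, v i)`. -/
def matchedDiff (f : ℝ × ℝ → ℝ) (h : ℝ × ℝ → ℝ)
    (q : ((Fin k → ℝ) × (Fin k → ℝ)) × (ℝ × (Fin k → ℝ))) (j : Fin k) : ℝ :=
  orderStat (fun i ↦ q.2.2 i + h (∑ l, q.1.1 l, q.2.1) / k) (lexRank q.1.1 q.1.2 j) -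
    f (q.1.1 j, q.1.2 j)

theorem measurable_matchedDiff {f h : ℝ × ℝ → ℝ} (hf : Measurable f) (hh : Measurable h) :
    Measurable (matchedDiff (k := k) f h) := by
  refine measurable_pi_lambda _ fun j ↦ ?_
  unfold matchedDiff
  refine Measurable.sub ?_ (hf.comp (by fun_prop))
  have h1 : Measurable fun q : (Fin k → ℝ) × Fin k ↦ orderStat q.1 q.2 :=
    measurable_from_prod_countable_left measurable_orderStat
  have hsum : Measurable fun q : ((Fin k → ℝ) × (Fin k → ℝ)) × (ℝ × (Fin k → ℝ)) ↦
      h (∑ l, q.1.1 l, q.2.1) := hh.comp (by fun_prop)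
  have hz : Measurable fun q : ((Fin k → ℝ) × (Fin k → ℝ)) × (ℝ × (Fin k → ℝ)) ↦
      fun i ↦ q.2.2 i + h (∑ l, q.1.1 l, q.2.1) / k :=
    measurable_pi_lambda _ fun i ↦ Measurable.add (by fun_prop) (hsum.div_const _)
  exact h1.comp (hz.prodMk ((measurable_lexRank j).comp measurable_fst))

theorem matchedDiff_comp_perm (f h : ℝ × ℝ → ℝ) (σ : Equiv.Perm (Fin k))
    (q : ((Fin k → ℝ) × (Fin k → ℝ)) × (ℝ × (Fin k → ℝ))) :
    matchedDiff f h ((q.1.1 ∘ σ, q.1.2 ∘ σ), q.2) = matchedDiff f h q ∘ σ := by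
  ext j
  simp only [matchedDiff, lexRank_comp_perm, Function.comp, Equiv.sum_comp σ q.1.1]

end LexRank

namespace CouplingInput

variable {Ω : Type*} [MeasurableSpace Ω] {k : ℕ} {P : Measure Ω} (S : CouplingInput k P)

/-- The σ-algebra generated by the sources of randomness with labels in `A`. -/
abbrev sigma (A : Set (Source k)) : MeasurableSpace Ω :=
  ⨆ i ∈ A, sourceSigma S.X S.U S.B S.V S.β i

theorem sourceSigma_le (i : Source k) :
    sourceSigma S.X S.U S.B S.V S.β i ≤ (inferInstance : MeasurableSpace Ω) := by
  cases i with
  | levy => exact (measurable_pi_lambda _ S.levy.measurable).comap_le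
  | endpoint => exact S.measurable_U.comap_le
  | bridge => exact (measurable_pi_lambda _ fun t : Set.Icc (0 : ℝ) 1 ↦
      S.bridge_B.measurable t t.2).comap_le
  | tie i => exact (S.measurable_V i).comap_le
  | interval i => exact (measurable_pi_lambda _ fun t : Set.Icc (0 : ℝ) (1 / k) ↦
      (S.bridge_β i).measurable t t.2).comap_le

theorem indepFun_of_measurable {β γ : Type*} [MeasurableSpace β] [MeasurableSpace γ]
    {A A' : Set (Source k)} (hA : Disjoint A A') {f : Ω → β} {g : Ω → γ}
    (hf : Measurable[S.sigma A] f) (hg : Measurable[S.sigma A'] g) : IndepFun f g P := by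
  rw [IndepFun_iff_Indep]
  have h := indep_iSup_of_disjoint S.sourceSigma_le S.indep hA
  exact indep_of_indep_of_le_left (indep_of_indep_of_le_right h
    (measurable_iff_comap_le.mp hg)) (measurable_iff_comap_le.mp hf)

theorem measurable_sigma_of_mem {β : Type*} [MeasurableSpace β] {A : Set (Source k)}
    {i : Source k} (hi : i ∈ A) {f : Ω → β}
    (hf : Measurable[sourceSigma S.X S.U S.B S.V S.β i] f) : Measurable[S.sigma A] f :=
  hf.mono (le_iSup₂ (f := fun i (_ : i ∈ A) ↦ sourceSigma S.X S.U S.B S.V S.β i) i hi) le_rfl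

theorem measurable_X_sigma {A : Set (Source k)} (h : Source.levy ∈ A) (t : ℝ≥0) :
    Measurable[S.sigma A] (S.X t) :=
  S.measurable_sigma_of_mem h ((measurable_pi_apply t).comp
    (comap_measurable (fun ω (t : ℝ≥0) ↦ S.X t ω)))

theorem measurable_U_sigma {A : Set (Source k)} (h : Source.endpoint ∈ A) :
    Measurable[S.sigma A] S.U :=
  S.measurable_sigma_of_mem h (comap_measurable S.U)

theorem measurable_V_sigma {A : Set (Source k)} (i : Fin k) (h : Source.tie i ∈ A) :
    Measurable[S.sigma A] (S.V i) :=
  S.measurable_sigma_of_mem h (comap_measurable (S.V i))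

theorem measurable_B_sigma {A : Set (Source k)} (h : Source.bridge ∈ A) :
    Measurable[S.sigma A] fun ω (t : Set.Icc (0 : ℝ) 1) ↦ S.B t ω :=
  S.measurable_sigma_of_mem h (comap_measurable _)

theorem measurable_levyIncrement_sigma {A : Set (Source k)} (h : Source.levy ∈ A) :
    Measurable[S.sigma A] fun ω (i : Fin k) ↦ levyIncrement k S.X i ω :=
  @measurable_pi_lambda _ _ _ (S.sigma A) _ _ fun _ ↦
    (S.measurable_X_sigma h _).sub (S.measurable_X_sigma h _)

theorem grid_mem (i : Fin k) : ((i : ℕ) : ℝ) / k ∈ Set.Icc (0 : ℝ) 1 :=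
  div_mem_Icc_zero_one (by positivity) (by exact_mod_cast i.2.le)

theorem grid_succ_mem (i : Fin k) : ((i : ℕ) + 1 : ℝ) / k ∈ Set.Icc (0 : ℝ) 1 :=
  div_mem_Icc_zero_one (by positivity) (by exact_mod_cast i.2)

theorem measurable_bridgeIncrement_sigma {A : Set (Source k)} (h : Source.bridge ∈ A) :
    Measurable[S.sigma A] fun ω (i : Fin k) ↦ pathIncrement k S.B i ω :=
  @measurable_pi_lambda _ _ _ (S.sigma A) _ _ fun i ↦
    ((measurable_pi_apply (⟨_, grid_succ_mem i⟩ : Set.Icc (0 : ℝ) 1)).comp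
      (S.measurable_B_sigma h)).sub
    ((measurable_pi_apply (⟨_, grid_mem i⟩ : Set.Icc (0 : ℝ) 1)).comp (S.measurable_B_sigma h))

/-- The end-point of `W'`. -/
def endValue (ω : Ω) : ℝ := S.h (S.X 1 ω, S.U ω)

theorem indepFun_bridge_endValue :
    IndepFun (fun ω (t : Set.Icc (0 : ℝ) 1) ↦ S.B t ω) S.endValue P := by
  refine S.indepFun_of_measurable (A := {Source.bridge}) (A' := {Source.levy, Source.endpoint})
    (by simp) (S.measurable_B_sigma rfl) ?_
  exact S.measurable_h.comp ((S.measurable_X_sigma (by simp) 1).prodMk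
    (S.measurable_U_sigma (by simp)))

theorem measurable_endValue : Measurable S.endValue :=
  S.measurable_h.comp ((S.levy.measurable 1).prodMk S.measurable_U)

theorem measurable_levyIncrement : Measurable fun ω (i : Fin k) ↦ levyIncrement k S.X i ω :=
  measurable_pi_lambda _ fun _ ↦ (S.levy.measurable _).sub (S.levy.measurable _)

theorem measurable_V_pi : Measurable fun ω (i : Fin k) ↦ S.V i ω :=
  measurable_pi_lambda _ S.measurable_V

theorem measurable_bridgeIncrement : Measurable fun ω (i : Fin k) ↦ pathIncrement k S.B i ω :=
  measurable_pi_lambda _ fun i ↦ (S.bridge_B.measurable _ (grid_succ_mem i)).sub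
    (S.bridge_B.measurable _ (grid_mem i))

/-- The law of an increment of `X` over the grid. -/
def incrementLaw : Measure ℝ := P.map (S.X (1 / k))

theorem map_eq_unif_of_isUniform {V : Ω → ℝ} (hV : pdf.IsUniform V (Set.Icc 0 1) P) :
    P.map V = unif := by
  rw [hV, ProbabilityTheory.cond, unif]
  simp

/-- All the randomness that determines the increments of the two Brownian motions. -/
def gridData (ω : Ω) : ((Fin k → ℝ) × (Fin k → ℝ)) × (ℝ × (Fin k → ℝ)) :=
  ((fun i ↦ levyIncrement k S.X i ω, fun i ↦ S.V i ω), (S.U ω, fun i ↦ pathIncrement k S.B i ω))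

theorem measurable_gridData : Measurable S.gridData :=
  (S.measurable_levyIncrement.prodMk S.measurable_V_pi).prodMk
    (S.measurable_U.prodMk S.measurable_bridgeIncrement)

/-- The map which turns an increment of `X` and a uniform into a normal increment. -/
def toNormal (q : ℝ × ℝ) : ℝ := comonotoneMap S.incrementLaw (gaussianReal 0 (1 / k)) q.1 q.2

theorem ξ_eq (i : Fin k) (ω : Ω) : S.ξ i ω = S.toNormal (levyIncrement k S.X i ω, S.V i ω) := rfl

theorem measurable_pairs : Measurable fun ω (i : Fin k) ↦ (levyIncrement k S.X i ω, S.V i ω) :=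
  measurable_pi_lambda _ fun i ↦ ((measurable_pi_apply i).comp S.measurable_levyIncrement).prodMk
    (S.measurable_V i)

theorem ae_X_one_eq_sum (hk : 1 ≤ k) :
    ∀ᵐ ω ∂P, S.X 1 ω = ∑ i : Fin k, levyIncrement k S.X i ω := by
  filter_upwards [S.levy.start_zero] with ω hω
  have h1 : ∑ i : Fin k, levyIncrement k S.X i ω =
      ∑ i ∈ Finset.range k, (S.X (((i + 1 : ℕ) : ℝ≥0) / k) ω - S.X ((i : ℝ≥0) / k) ω) := by
    rw [← Fin.sum_univ_eq_sum_range
      (fun i ↦ S.X (((i + 1 : ℕ) : ℝ≥0) / k) ω - S.X ((i : ℝ≥0) / k) ω)]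
    simp [levyIncrement]
  have hk0 : (k : ℝ≥0) ≠ 0 := by exact_mod_cast (by omega : k ≠ 0)
  rw [h1, Finset.sum_range_sub (fun i : ℕ ↦ S.X ((i : ℝ≥0) / k) ω), div_self hk0]
  simp [hω]

variable {π : Ω → Equiv.Perm (Fin k)}

/-- The difference of the `j`-th increments of `W` and `Ŵ`. -/
def incDiff (π : Ω → Equiv.Perm (Fin k)) (ω : Ω) (j : Fin k) : ℝ :=
  pathIncrement k S.W' (π ω j) ω - S.ξ j ω

theorem ae_incDiff_eq (hk : 1 ≤ k) (hπ : S.IsOrderMatching π) :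
    ∀ᵐ ω ∂P, S.incDiff π ω = matchedDiff S.toNormal S.h (S.gridData ω) := by
  classical
  have hk0 : (k : ℝ) ≠ 0 := by exact_mod_cast (by omega : k ≠ 0)
  filter_upwards [hπ.order, S.ae_X_one_eq_sum hk] with ω hω hX
  ext j
  have hg : (fun i ↦ (S.gridData ω).2.2 i +
      S.h (∑ l, (S.gridData ω).1.1 l, (S.gridData ω).2.1) / k) =
      fun i ↦ pathIncrement k S.W' i ω := by
    ext i
    simp only [gridData, ← hX, pathIncrement, W']
    field_simp
    ring
  simp only [matchedDiff, hg, incDiff, ξ_eq]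
  congr 1
  symm
  refine orderStat_eq_of_card _ _ (π ω j) ?_
  rw [← card_filter_comp_perm (fun i ↦ pathIncrement k S.W' i ω) (π ω)
    (· < pathIncrement k S.W' (π ω j) ω)]
  simp only [lexRank]
  congr 1
  refine Finset.filter_congr fun i _ ↦ ?_
  by_cases hij : i = j
  · subst hij; simp [LexLT]
  · exact (hω i j hij).symm

variable [IsProbabilityMeasure P]

instance : IsProbabilityMeasure S.incrementLaw :=
  Measure.isProbabilityMeasure_map (S.levy.measurable _).aemeasurable

theorem map_levyIncrement :
    P.map (fun ω (i : Fin k) ↦ levyIncrement k S.X i ω) = Measure.pi fun _ ↦ S.incrementLaw := by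
  have hind := S.levy.indep_increments k (fun j ↦ ((j : ℕ) : ℝ≥0) / k) (fun a b hab ↦ by
    have : ((a : ℕ) : ℝ≥0) ≤ ((b : ℕ) : ℝ≥0) := by exact_mod_cast hab
    simp only
    gcongr)
  have hind' : iIndepFun (fun i : Fin k ↦ levyIncrement k S.X i) P := by
    have e : (fun i : Fin k ↦ levyIncrement k S.X i) =
        fun (i : Fin k) ω ↦ S.X (((i : ℕ) + 1 : ℝ≥0) / k) ω - S.X (((i : ℕ) : ℝ≥0) / k) ω := rfl
    rw [e]
    simpa using hind
  have hm : ∀ i : Fin k, Measurable (levyIncrement k S.X i) := fun i ↦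
    (S.levy.measurable _).sub (S.levy.measurable _)
  rw [(iIndepFun_iff_map_fun_eq_pi_map fun i ↦ (hm i).aemeasurable).mp hind']
  congr 1
  ext1 i
  have := (S.levy.stationary_increments (((i : ℕ) : ℝ≥0) / k) (1 / k)).map_eq
  rw [incrementLaw, ← this, ← add_div]
  rfl

theorem map_V : P.map (fun ω (i : Fin k) ↦ S.V i ω) = Measure.pi fun _ ↦ unif := by
  have hind : iIndepFun S.V P := S.indep.precomp (g := Source.tie) fun i j h ↦ by
    simpa using h
  rw [(iIndepFun_iff_map_fun_eq_pi_map fun i ↦ (S.measurable_V i).aemeasurable).mp hind]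
  congr 1
  ext1 i
  exact map_eq_unif_of_isUniform (S.uniform_V i)

theorem map_levyIncrement_V :
    P.map (fun ω ↦ ((fun i ↦ levyIncrement k S.X i ω), fun i ↦ S.V i ω)) =
      (Measure.pi fun _ : Fin k ↦ S.incrementLaw).prod (Measure.pi fun _ ↦ unif) := by
  have hind : IndepFun (fun ω (i : Fin k) ↦ levyIncrement k S.X i ω) (fun ω i ↦ S.V i ω) P := by
    refine S.indepFun_of_measurable (A := {Source.levy}) (A' := Set.range Source.tie)
      (by simp) (S.measurable_levyIncrement_sigma rfl) ?_
    exact @measurable_pi_lambda _ _ _ (S.sigma _) _ _ fun i ↦ S.measurable_V_sigma i (by simp)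
  rw [(indepFun_iff_map_prod_eq_prod_map_map S.measurable_levyIncrement.aemeasurable
    S.measurable_V_pi.aemeasurable).mp hind, map_levyIncrement, map_V]

theorem map_gridData : P.map S.gridData =
    ((Measure.pi fun _ : Fin k ↦ S.incrementLaw).prod (Measure.pi fun _ ↦ unif)).prod
      (P.map fun ω ↦ (S.U ω, fun i : Fin k ↦ pathIncrement k S.B i ω)) := by
  have hind : IndepFun (fun ω ↦ ((fun i ↦ levyIncrement k S.X i ω), fun i ↦ S.V i ω))
      (fun ω ↦ (S.U ω, fun i : Fin k ↦ pathIncrement k S.B i ω)) P := by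
    refine S.indepFun_of_measurable (A := insert Source.levy (Set.range Source.tie))
      (A' := {Source.endpoint, Source.bridge}) (by simp [Set.disjoint_left]) ?_ ?_
    · exact (S.measurable_levyIncrement_sigma (by simp)).prodMk
        (@measurable_pi_lambda _ _ _ (S.sigma _) _ _ fun i ↦ S.measurable_V_sigma i (by simp))
    · exact (S.measurable_U_sigma (by simp)).prodMk (S.measurable_bridgeIncrement_sigma (by simp))
  unfold gridData
  rw [(indepFun_iff_map_prod_eq_prod_map_map
    (S.measurable_levyIncrement.prodMk S.measurable_V_pi).aemeasurable
    (S.measurable_U.prodMk S.measurable_bridgeIncrement).aemeasurable).mp hind,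
    map_levyIncrement_V]

theorem measurePreserving_gridData_perm (σ : Equiv.Perm (Fin k)) :
    MeasurePreserving (fun q : ((Fin k → ℝ) × (Fin k → ℝ)) × (ℝ × (Fin k → ℝ)) ↦
      ((q.1.1 ∘ σ, q.1.2 ∘ σ), q.2)) (P.map S.gridData) (P.map S.gridData) := by
  have : IsProbabilityMeasure
      (P.map fun ω ↦ (S.U ω, fun i : Fin k ↦ pathIncrement k S.B i ω)) :=
    Measure.isProbabilityMeasure_map
      (S.measurable_U.prodMk S.measurable_bridgeIncrement).aemeasurable
  rw [map_gridData]
  exact ((measurePreserving_comp_perm S.incrementLaw σ).prod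
    (measurePreserving_comp_perm unif σ)).prod (MeasurePreserving.id _)

theorem measurable_toNormal : Measurable S.toNormal := measurable_comonotoneMap _ _

theorem map_pairs : P.map (fun ω (i : Fin k) ↦ (levyIncrement k S.X i ω, S.V i ω)) =
    Measure.pi fun _ ↦ S.incrementLaw.prod unif := by
  have h := (measurePreserving_arrowProdEquivProdArrow ℝ ℝ (Fin k) (fun _ ↦ S.incrementLaw)
    (fun _ ↦ unif)).symm
  rw [← h.map_eq, ← map_levyIncrement_V, Measure.map_map h.measurable
    (S.measurable_levyIncrement.prodMk S.measurable_V_pi)]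
  rfl

theorem measurable_ξ : Measurable fun ω i ↦ S.ξ i ω :=
  measurable_pi_lambda _ fun i ↦ by
    have hi : Measurable fun ω ↦ (levyIncrement k S.X i ω, S.V i ω) :=
      (measurable_pi_apply i).comp S.measurable_pairs
    simp only [ξ_eq]
    exact S.measurable_toNormal.comp hi

theorem hasLaw_ξ :
    HasLaw (fun ω i ↦ S.ξ i ω) (Measure.pi fun _ : Fin k ↦ gaussianReal 0 (1 / k)) P := by
  refine ⟨S.measurable_ξ.aemeasurable, ?_⟩
  have hmap : (S.incrementLaw.prod unif).map S.toNormal = gaussianReal 0 (1 / k) :=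
    map_comonotoneMap S.incrementLaw (gaussianReal 0 (1 / k))
  have e : (fun ω i ↦ S.ξ i ω) = (fun (q : Fin k → ℝ × ℝ) i ↦ S.toNormal (q i)) ∘
      fun ω i ↦ (levyIncrement k S.X i ω, S.V i ω) := rfl
  have : ∀ _ : Fin k, SigmaFinite ((S.incrementLaw.prod unif).map S.toNormal) := by
    rw [hmap]; infer_instance
  have hm : Measurable fun (q : Fin k → ℝ × ℝ) i ↦ S.toNormal (q i) :=
    measurable_pi_lambda _ fun i ↦ S.measurable_toNormal.comp (measurable_pi_apply i)
  rw [e, ← Measure.map_map hm S.measurable_pairs, map_pairs,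
    Measure.pi_map_pi (fun _ ↦ S.measurable_toNormal.aemeasurable), hmap]

theorem ae_ξ_mono : ∀ᵐ ω ∂P, ∀ i j : Fin k,
    LexLT (fun i ↦ levyIncrement k S.X i ω) (fun i ↦ S.V i ω) i j → S.ξ i ω ≤ S.ξ j ω := by
  have hpair : ∀ i, P.map (fun ω ↦ (levyIncrement k S.X i ω, S.V i ω)) =
      S.incrementLaw.prod unif := by
    intro i
    have h := measurePreserving_eval (fun _ : Fin k ↦ S.incrementLaw.prod unif) i
    rw [← h.map_eq, ← map_pairs, Measure.map_map h.measurable S.measurable_pairs]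
    rfl
  have h1 : ∀ i, ∀ᵐ ω ∂P, distTransform S.incrementLaw (levyIncrement k S.X i ω, S.V i ω) ∈
      Set.Ioo (0 : ℝ) 1 ∧ S.V i ω ∈ Set.Ioo (0 : ℝ) 1 := by
    intro i
    have ha := ae_distTransform_mem_Ioo S.incrementLaw
    have hb := Measure.quasiMeasurePreserving_snd (μ := S.incrementLaw) (ν := unif)
      |>.ae ae_unif_mem_Ioo
    have hab := ha.and hb
    rw [← hpair i] at hab
    exact ae_of_ae_map ((measurable_pi_apply i).comp S.measurable_pairs).aemeasurable hab
  filter_upwards [ae_all_iff.mpr h1] with ω hω i j hij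
  refine quantile_monotoneOn (gaussianReal 0 (1 / k)) (hω i).1 (hω j).1 ?_
  exact distTransform_mono S.incrementLaw (hω i).2.2.le (hω j).2.1.le hij

theorem hasLaw_W'_increment (hk : 1 ≤ k) :
    HasLaw (fun ω (i : Fin k) ↦ pathIncrement k S.W' i ω)
      (Measure.pi fun _ ↦ gaussianReal 0 (1 / k)) P :=
  hasLaw_pathIncrement_bridge_add hk S.bridge_B S.law_h S.indepFun_bridge_endValue

theorem W'_increment_law {s t : ℝ} (hs : s ∈ Set.Icc (0 : ℝ) 1) (ht : t ∈ Set.Icc (0 : ℝ) 1)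
    (hst : s ≤ t) : ∃ v : ℝ≥0, (v : ℝ) ≤ t - s ∧
      HasLaw (fun ω ↦ S.W' t ω - S.W' s ω) (gaussianReal 0 v) P := by
  have hg : IsGaussianProcess (fun t : Set.Icc (0 : ℝ) 1 ↦ S.W' t) P :=
    isGaussianProcess_bridge_add S.bridge_B S.law_h S.indepFun_bridge_endValue
  have hcov : ∀ s ∈ Set.Icc (0 : ℝ) 1, ∀ t ∈ Set.Icc (0 : ℝ) 1, s ≤ t →
      cov[S.W' s, S.W' t; P] = s := fun s hs t ht hst ↦
    covariance_bridge_add S.bridge_B S.law_h S.indepFun_bridge_endValue hs ht hst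
  refine ⟨_, ?_, hasLaw_increment hg
    (fun t ht ↦ integral_bridge_add S.bridge_B S.law_h ht) hs ht⟩
  rw [hcov t ht t ht le_rfl, hcov s hs t ht hst, hcov s hs s hs le_rfl, Real.coe_toNNReal',
    max_le_iff]
  exact ⟨by linarith, by linarith⟩

theorem ae_monovary (hπ : S.IsOrderMatching π) :
    ∀ᵐ ω ∂P, Monovary (fun j ↦ S.ξ j ω) fun j ↦ pathIncrement k S.W' (π ω j) ω := by
  filter_upwards [hπ.order, S.ae_ξ_mono] with ω hω hξ i j hij
  have hne : i ≠ j := by rintro rfl; exact lt_irrefl _ hij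
  exact hξ i j ((hω i j hne).mp hij)

theorem orderStat_comp_perm (z : Fin k → ℝ) (σ : Equiv.Perm (Fin k)) :
    orderStat (z ∘ σ) = orderStat z :=
  Tuple.comp_perm_comp_sort_eq_comp_sort

theorem lintegral_incDiff_sq_le (hk : 1 ≤ k) (hπ : S.IsOrderMatching π) :
    ∫⁻ ω, ENNReal.ofReal (∑ j, S.incDiff π ω j ^ 2) ∂P ≤
      ENNReal.ofReal (64 * Real.pi * (1 / k) * (1 + Real.log k)) := by
  have hk0 : (1 / k : ℝ≥0) ≠ 0 := by
    have : (k : ℝ≥0) ≠ 0 := by exact_mod_cast (by omega : k ≠ 0)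
    positivity
  have h := lintegral_sqDist_orderStat_coupled_le hk0 hk S.hasLaw_ξ (S.hasLaw_W'_increment hk)
  push_cast at h
  refine le_trans (lintegral_mono_ae ?_) h
  filter_upwards [S.ae_monovary hπ] with ω hω
  refine ENNReal.ofReal_le_ofReal ?_
  have h1 := hω.sum_sub_sq_le_orderStat
  have h2 : orderStat (fun j ↦ pathIncrement k S.W' (π ω j) ω) =
      orderStat fun i ↦ pathIncrement k S.W' i ω :=
    orderStat_comp_perm (fun i ↦ pathIncrement k S.W' i ω) (π ω)
  rw [h2] at h1
  refine le_trans (le_of_eq (Finset.sum_congr rfl fun j _ ↦ ?_)) h1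
  rw [incDiff, sub_sq_comm]

theorem lintegral_maxPartialSq_incDiff_le (hk : 2 ≤ k) (hπ : S.IsOrderMatching π) :
    ∫⁻ ω, maxPartialSq (S.incDiff π ω) ∂P ≤
      72 * ENNReal.ofReal (64 * Real.pi * (1 / k) * (1 + Real.log k)) := by
  have hk1 : 1 ≤ k := by omega
  have hae := S.ae_incDiff_eq hk1 hπ
  have hΨ := measurable_matchedDiff (k := k) S.measurable_toNormal S.measurable_h
  have hsq : Measurable fun d : Fin k → ℝ ↦ ENNReal.ofReal (∑ j, d j ^ 2) := by fun_prop
  calc ∫⁻ ω, maxPartialSq (S.incDiff π ω) ∂P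
      = ∫⁻ ω, maxPartialSq (matchedDiff S.toNormal S.h (S.gridData ω)) ∂P := by
        refine lintegral_congr_ae ?_
        filter_upwards [hae] with ω hω
        rw [hω]
    _ = ∫⁻ q, maxPartialSq (matchedDiff S.toNormal S.h q) ∂(P.map S.gridData) :=
        (lintegral_map (measurable_maxPartialSq.comp hΨ) S.measurable_gridData).symm
    _ ≤ 72 * ∫⁻ q, ENNReal.ofReal (∑ j, matchedDiff S.toNormal S.h q j ^ 2)
          ∂(P.map S.gridData) :=
        lintegral_maxPartialSq_le hk hΨ S.measurePreserving_gridData_perm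
          (matchedDiff_comp_perm S.toNormal S.h)
    _ = 72 * ∫⁻ ω, ENNReal.ofReal (∑ j, matchedDiff S.toNormal S.h (S.gridData ω) j ^ 2) ∂P := by
        congr 1
        exact lintegral_map (hsq.comp hΨ) S.measurable_gridData
    _ = 72 * ∫⁻ ω, ENNReal.ofReal (∑ j, S.incDiff π ω j ^ 2) ∂P := by
        congr 1
        refine lintegral_congr_ae ?_
        filter_upwards [hae] with ω hω
        rw [hω]
    _ ≤ _ := by gcongr; exact S.lintegral_incDiff_sq_le hk1 hπ

end CouplingInput

/-! ### Concatenated paths -/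

theorem concatPath_grid {k : ℕ} (hk : 1 ≤ k) (f : Fin k → ℝ → ℝ) (m : ℕ) :
    concatPath k f ((m : ℝ) / k) = ∑ j : Fin k with j.val < m, f j (1 / k) := by
  have hk0 : (0 : ℝ) < k := by exact_mod_cast hk
  rw [concatPath, Finset.sum_filter]
  refine Finset.sum_congr rfl fun j _ ↦ ?_
  have hiff : ((j : ℕ) : ℝ) / k < (m : ℝ) / k ↔ j.val < m := by
    rw [div_lt_div_iff_of_pos_right hk0]; exact_mod_cast Iff.rfl
  by_cases h : j.val < m
  · have h' : ((j : ℕ) : ℝ) + 1 ≤ m := by exact_mod_cast h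
    rw [if_pos (hiff.mpr h), if_pos h, min_eq_right]
    rw [← sub_div]
    gcongr
    linarith
  · rw [if_neg (mt hiff.mp h), if_neg h]

theorem exists_grid_interval {k : ℕ} (hk : 1 ≤ k) {t : ℝ} (h₀ : 0 < t) (h₁ : t ≤ 1) :
    ∃ i : Fin k, ((i : ℕ) : ℝ) / k < t ∧ t ≤ ((i : ℕ) + 1 : ℝ) / k := by
  have hk0 : (0 : ℝ) < k := by exact_mod_cast hk
  have hpos : 0 < ⌈t * k⌉₊ := Nat.ceil_pos.mpr (by positivity)
  have hle : ⌈t * k⌉₊ ≤ k := Nat.ceil_le.mpr (by nlinarith)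
  obtain ⟨n, hn⟩ : ∃ n, ⌈t * k⌉₊ = n + 1 := ⟨⌈t * k⌉₊ - 1, by omega⟩
  have hc := (Nat.ceil_eq_iff (by omega)).mp hn
  refine ⟨⟨n, by omega⟩, ?_, ?_⟩
  · rw [div_lt_iff₀ hk0]
    simpa using hc.1
  · rw [le_div_iff₀ hk0]
    have := hc.2
    push_cast at this
    exact this

theorem concatPath_bridge_sub {k : ℕ} (hk : 1 ≤ k) (f g : Fin k → ℝ → ℝ) (i : Fin k) {t : ℝ}
    (h₁ : ((i : ℕ) : ℝ) / k < t) (h₂ : t ≤ ((i : ℕ) + 1 : ℝ) / k) :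
    (concatPath k f t - t * concatPath k f 1) - (concatPath k g t - t * concatPath k g 1) =
      (∑ j : Fin k with j.val < i.val, ((f j (1 / k) - g j (1 / k)) -
        (∑ l, (f l (1 / k) - g l (1 / k))) / k)) +
      f i (t - ((i : ℕ) : ℝ) / k) - g i (t - ((i : ℕ) : ℝ) / k) -
        (t - ((i : ℕ) : ℝ) / k) * ∑ l, (f l (1 / k) - g l (1 / k)) := by
  have hk0 : (k : ℝ) ≠ 0 := by exact_mod_cast (by omega : k ≠ 0)
  have hone : ∀ f : Fin k → ℝ → ℝ, concatPath k f 1 = ∑ l, f l (1 / k) := by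
    intro f
    have h := concatPath_grid hk f k
    rwa [div_self hk0, Finset.filter_true_of_mem fun j _ ↦ j.2] at h
  have hcard : (Finset.univ.filter fun j : Fin k ↦ j.val < i.val).card = i.val := by
    rw [← Fin.card_Iio i]
    congr 1
    ext j
    simp
  rw [concatPath_step k f i t h₁ h₂, concatPath_step k g i t h₁ h₂, hone, hone,
    concatPath_grid hk, concatPath_grid hk, Finset.sum_sub_distrib, Finset.sum_sub_distrib,
    Finset.sum_const, hcard, Finset.sum_sub_distrib, nsmul_eq_mul]
  field_simp
  ring

theorem ofReal_sq_le_maxPartialSq {k : ℕ} (d : Fin k → ℝ) (i : Fin k) :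
    ENNReal.ofReal ((∑ j : Fin k with j.val < i.val, (d j - (∑ l, d l) / k)) ^ 2) ≤
      maxPartialSq d :=
  le_iSup (fun m : Fin (k + 1) ↦
    ENNReal.ofReal ((∑ j : Fin k with j.val < m.val, (d j - (∑ l, d l) / k)) ^ 2)) i.castSucc

theorem sq_mul_sum_le {k : ℕ} (d : Fin k → ℝ) {s : ℝ} (h₀ : 0 ≤ s) (h₁ : s ≤ 1 / k) :
    (s * ∑ l, d l) ^ 2 ≤ ∑ l, d l ^ 2 := by
  rcases Nat.eq_zero_or_pos k with rfl | hk
  · simp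
  have hk1 : (1 : ℝ) ≤ k := by exact_mod_cast hk
  have h := sq_sum_le_card_mul_sum_sq (s := Finset.univ) (f := d)
  rw [Finset.card_univ, Fintype.card_fin] at h
  have hs : s ^ 2 * k ≤ 1 := by
    have h2 : s * k ≤ 1 := by rwa [le_div_iff₀ (by linarith)] at h₁
    have h3 : s ≤ 1 := by nlinarith
    nlinarith
  have hnn : 0 ≤ ∑ l, d l ^ 2 := Finset.sum_nonneg fun _ _ ↦ sq_nonneg _
  calc (s * ∑ l, d l) ^ 2 = s ^ 2 * (∑ l, d l) ^ 2 := mul_pow _ _ _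
    _ ≤ s ^ 2 * (k * ∑ l, d l ^ 2) := by gcongr
    _ = (s ^ 2 * k) * ∑ l, d l ^ 2 := by ring
    _ ≤ 1 * ∑ l, d l ^ 2 := by gcongr
    _ = _ := one_mul _

theorem continuousWithinAt_concatPath {k : ℕ} {f : Fin k → ℝ → ℝ}
    (hf : ∀ i, ContinuousOn (f i) (Set.Icc 0 (1 / k))) (t : ℝ) :
    ContinuousWithinAt (concatPath k f) (Set.Iio t) t := by
  refine tendsto_finsetSum _ fun i _ ↦ ?_
  by_cases h : ((i : ℕ) : ℝ) / k < t
  · have hc : ContinuousOn (fun x ↦ f i (min (x - ((i : ℕ) : ℝ) / k) (1 / k)))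
        (Set.Ici (((i : ℕ) : ℝ) / k)) := by
      refine (hf i).comp (by fun_prop) fun x hx ↦ ⟨le_min ?_ (by positivity), min_le_right _ _⟩
      exact sub_nonneg.mpr hx
    have hca := hc.continuousAt (Ici_mem_nhds h)
    refine Tendsto.congr' ?_ (by
      rw [if_pos h]
      exact hca.continuousWithinAt (s := Set.Iio t))
    filter_upwards [mem_nhdsWithin_of_mem_nhds (Ioi_mem_nhds h)] with x hx
    exact (if_pos hx).symm
  · rw [if_neg h]
    refine Tendsto.congr' ?_ tendsto_const_nhds
    filter_upwards [self_mem_nhdsWithin] with x hx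
    rw [if_neg fun hlt ↦ h (hlt.trans hx)]

/-- The rationals of `[0, 1]`, as real numbers. -/
def ratIcc : Set ℝ := Set.range ((↑) : ℚ → ℝ) ∩ Set.Icc 0 1

theorem countable_ratIcc : ratIcc.Countable :=
  (Set.countable_range _).mono Set.inter_subset_left

theorem biSup_Icc_eq_biSup_ratIcc {G : ℝ → ℝ≥0∞}
    (hG : ∀ t, ContinuousWithinAt G (Set.Iio t) t) :
    ⨆ t ∈ Set.Icc (0 : ℝ) 1, G t = ⨆ t ∈ ratIcc, G t := by
  refine le_antisymm (iSup₂_le fun t ht ↦ ?_) (biSup_mono fun t ht ↦ ht.2)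
  rcases ht.1.eq_or_lt with rfl | h0
  · exact le_biSup G (⟨⟨0, by simp⟩, by simp⟩ : (0 : ℝ) ∈ ratIcc)
  by_contra! hlt
  have hev : ∀ᶠ x in 𝓝[<] t, (⨆ t ∈ ratIcc, G t) < G x := (hG t).eventually (lt_mem_nhds hlt)
  obtain ⟨l, hl, hsub⟩ := (mem_nhdsLT_iff_exists_Ioo_subset' h0).mp hev
  obtain ⟨q, hq1, hq2⟩ := exists_rat_btwn (max_lt hl h0)
  have hq := hsub ⟨(le_max_left _ _).trans_lt hq1, hq2⟩
  exact absurd (le_biSup G (⟨⟨q, rfl⟩, ((le_max_right _ _).trans_lt hq1).le,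
    hq2.le.trans ht.2⟩ : (q : ℝ) ∈ ratIcc)) (not_le.mpr hq)

namespace CouplingInput

variable {Ω : Type*} [MeasurableSpace Ω] {k : ℕ} {P : Measure Ω} (S : CouplingInput k P)
  {π : Ω → Equiv.Perm (Fin k)}

/-! ### Measurability -/

theorem IsOrderMatching.measurable_apply {S : CouplingInput k P} (hπ : S.IsOrderMatching π)
    {Y : Fin k → Ω → ℝ} (hY : ∀ a, Measurable (Y a)) (i : Fin k) :
    Measurable fun ω ↦ Y (π ω i) ω := by
  classical
  have e : (fun ω ↦ Y (π ω i) ω) =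
      fun ω ↦ ∑ σ : Equiv.Perm (Fin k), Set.indicator {ω | π ω = σ} (Y (σ i)) ω := by
    ext ω
    rw [Finset.sum_eq_single (π ω)]
    · simp
    · intro σ _ hσ
      exact Set.indicator_of_notMem (fun h ↦ hσ h.symm) _
    · simp
  rw [e]
  exact Finset.measurable_sum _ fun σ _ ↦ (hY _).indicator (hπ.measurable σ)

theorem grid_add_mem (a : Fin k) {s : ℝ} (hs : s ∈ Set.Icc (0 : ℝ) (1 / k)) :
    ((a : ℕ) : ℝ) / k + s ∈ Set.Icc (0 : ℝ) 1 := by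
  refine ⟨add_nonneg (by positivity) hs.1, ?_⟩
  have h := (grid_succ_mem a).2
  rw [add_div] at h
  linarith [hs.2]

theorem measurable_W' {t : ℝ} (ht : t ∈ Set.Icc (0 : ℝ) 1) : Measurable (S.W' t) :=
  (S.bridge_B.measurable t ht).add (S.measurable_endValue.const_mul t)

/-- The piece of `W'` over the `a`-th grid interval, started from `0`. -/
def piece (a : Fin k) (s : ℝ) (ω : Ω) : ℝ :=
  S.W' (((a : ℕ) : ℝ) / k + s) ω - S.W' (((a : ℕ) : ℝ) / k) ω

theorem measurable_piece (a : Fin k) {s : ℝ} (hs : s ∈ Set.Icc (0 : ℝ) (1 / k)) :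
    Measurable (S.piece a s) :=
  (S.measurable_W' (grid_add_mem a hs)).sub (S.measurable_W' (grid_mem a))

theorem measurable_concatPath {f : Fin k → ℝ → Ω → ℝ}
    (hf : ∀ i, ∀ s ∈ Set.Icc (0 : ℝ) (1 / k), Measurable (f i s)) (t : ℝ) :
    Measurable fun ω ↦ concatPath k (fun i s ↦ f i s ω) t := by
  refine Finset.measurable_sum _ fun i _ ↦ ?_
  split_ifs with h
  · exact hf i _ ⟨le_min (sub_nonneg.mpr h.le) (by positivity), min_le_right _ _⟩
  · exact measurable_const

theorem measurable_W (hπ : S.IsOrderMatching π) (t : ℝ) : Measurable (S.W π t) :=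
  measurable_concatPath (f := fun i s ω ↦ S.piece (π ω i) s ω)
    (fun i _ hs ↦ hπ.measurable_apply (fun a ↦ S.measurable_piece a hs) i) t

theorem measurable_incDiff [IsProbabilityMeasure P] (hπ : S.IsOrderMatching π) :
    Measurable (S.incDiff π) :=
  measurable_pi_lambda _ fun j ↦ (hπ.measurable_apply (Y := pathIncrement k S.W')
    (fun a ↦ (S.measurable_W' (grid_succ_mem a)).sub (S.measurable_W' (grid_mem a))) j).sub
    ((measurable_pi_apply j).comp S.measurable_ξ)

theorem measurable_What [IsProbabilityMeasure P] (t : ℝ) : Measurable (S.What t) :=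
  measurable_concatPath (f := fun i s ω ↦ S.β i s ω + k * s * S.ξ i ω)
    (fun i s hs ↦ ((S.bridge_β i).measurable s hs).add
      (((measurable_pi_apply i).comp S.measurable_ξ).const_mul _)) t

theorem ae_continuousOn_piece :
    ∀ᵐ ω ∂P, ∀ a, ContinuousOn (fun s ↦ S.piece a s ω) (Set.Icc 0 (1 / k)) := by
  filter_upwards [S.bridge_B.continuous] with ω hω a
  have hW : ContinuousOn (fun t ↦ S.W' t ω) (Set.Icc 0 1) :=
    hω.add (by fun_prop)
  exact (hW.comp (by fun_prop) fun s hs ↦ grid_add_mem a hs).sub continuousOn_const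

theorem aemeasurable_supSqBridgeDist [IsProbabilityMeasure P] (hπ : S.IsOrderMatching π) :
    AEMeasurable (S.supSqBridgeDist π) P := by
  refine ⟨fun ω ↦ ⨆ t ∈ ratIcc, ENNReal.ofReal
    (|(S.W π t ω - t * S.W π 1 ω) - (S.What t ω - t * S.What 1 ω)| ^ 2), ?_, ?_⟩
  · refine Measurable.biSup _ countable_ratIcc fun t _ ↦ ?_
    have h1 := S.measurable_W hπ t
    have h2 := S.measurable_W hπ 1
    have h3 := S.measurable_What t
    have h4 := S.measurable_What 1
    have h5 : Measurable fun ω ↦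
        (S.W π t ω - t * S.W π 1 ω) - (S.What t ω - t * S.What 1 ω) :=
      (h1.sub (h2.const_mul t)).sub (h3.sub (h4.const_mul t))
    simp only [sq_abs]
    exact (h5.pow_const 2).ennreal_ofReal
  · filter_upwards [S.ae_continuousOn_piece, ae_all_iff.mpr fun i ↦ (S.bridge_β i).continuous]
      with ω hW hβ
    refine biSup_Icc_eq_biSup_ratIcc fun t ↦ ?_
    have h1 : ContinuousWithinAt (fun t ↦ S.W π t ω) (Set.Iio t) t :=
      continuousWithinAt_concatPath (fun i ↦ hW (π ω i)) t
    have h2 : ContinuousWithinAt (fun t ↦ S.What t ω) (Set.Iio t) t :=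
      continuousWithinAt_concatPath (fun i ↦ (hβ i).add (by fun_prop)) t
    have hid : ContinuousWithinAt (fun t : ℝ ↦ t) (Set.Iio t) t := continuousWithinAt_id
    exact ENNReal.continuous_ofReal.continuousAt.comp_continuousWithinAt
      ((((h1.sub (hid.mul continuousWithinAt_const)).sub
        (h2.sub (hid.mul continuousWithinAt_const))).abs).pow 2)

/-! ### The bound -/

theorem ae_ofReal_sq_le :
    ∀ᵐ ω ∂P, 1 ≤ k → ∀ t ∈ Set.Icc (0 : ℝ) 1, ∀ M₁ M₂ M₃ : ℝ≥0∞,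
      (∀ a, ∀ s ∈ Set.Icc (0 : ℝ) (1 / k), ENNReal.ofReal (S.piece a s ω ^ 2) ≤ M₁) →
      (∀ i, ∀ s ∈ Set.Icc (0 : ℝ) (1 / k), ENNReal.ofReal (S.β i s ω ^ 2) ≤ M₂) →
      (∀ i, ENNReal.ofReal (S.ξ i ω ^ 2) ≤ M₃) →
      ENNReal.ofReal (|(S.W π t ω - t * S.W π 1 ω) - (S.What t ω - t * S.What 1 ω)| ^ 2) ≤
        4 * maxPartialSq (S.incDiff π ω) + 4 * ENNReal.ofReal (∑ j, S.incDiff π ω j ^ 2) +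
          4 * M₁ + 8 * M₂ + 8 * M₃ := by
  have hend : ∀ i, ∀ᵐ ω ∂P, S.β i (1 / k) ω = 0 := fun i ↦
    (S.bridge_β i).ae_eq_zero ⟨by positivity, le_rfl⟩ (Or.inr rfl)
  filter_upwards [ae_all_iff.mpr hend] with ω hβ hk t ht M₁ M₂ M₃ h₁ h₂ h₃
  have hk0 : (k : ℝ) ≠ 0 := by exact_mod_cast (by omega : k ≠ 0)
  rw [sq_abs]
  rcases ht.1.eq_or_lt with rfl | h0
  · simp [W, What, concatPath_zero]
  obtain ⟨i, hi₁, hi₂⟩ := exists_grid_interval hk h0 ht.2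
  have hs : t - ((i : ℕ) : ℝ) / k ∈ Set.Icc (0 : ℝ) (1 / k) := by
    rw [add_div] at hi₂
    exact ⟨by linarith, by linarith⟩
  have key := concatPath_bridge_sub hk (fun i s ↦ S.piece (π ω i) s ω)
    (fun i s ↦ S.β i s ω + k * s * S.ξ i ω) i hi₁ hi₂
  have hd : ∀ j, S.piece (π ω j) (1 / k) ω - (S.β j (1 / k) ω + k * (1 / k) * S.ξ j ω) =
      S.incDiff π ω j := by
    intro j
    rw [hβ j, mul_one_div_cancel hk0, piece, incDiff, pathIncrement, add_div]
    ring
  simp only [hd] at key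
  change (S.W π t ω - t * S.W π 1 ω) - (S.What t ω - t * S.What 1 ω) = _ at key
  rw [key]
  set d := S.incDiff π ω
  set s := t - ((i : ℕ) : ℝ) / k
  have hA := ofReal_sq_le_maxPartialSq d i
  set A := ∑ j : Fin k with j.val < i.val, (d j - (∑ l, d l) / k)
  have hE := sq_mul_sum_le d hs.1 hs.2
  have hks : (k * s * S.ξ i ω) ^ 2 ≤ S.ξ i ω ^ 2 := by
    have h1 : k * s ≤ 1 := by
      have := mul_le_mul_of_nonneg_left hs.2 (Nat.cast_nonneg (α := ℝ) k)
      rwa [mul_one_div_cancel hk0] at this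
    have h2 : 0 ≤ k * s := mul_nonneg (Nat.cast_nonneg _) hs.1
    have h3 : (k * s) ^ 2 ≤ 1 := pow_le_one₀ h2 h1
    rw [mul_pow]
    exact mul_le_of_le_one_left (sq_nonneg _) h3
  have hreal : (A + S.piece (π ω i) s ω - (S.β i s ω + k * s * S.ξ i ω) - s * ∑ l, d l) ^ 2 ≤
      4 * A ^ 2 + 4 * (∑ j, d j ^ 2) + 4 * S.piece (π ω i) s ω ^ 2 + 8 * S.β i s ω ^ 2 +
        8 * S.ξ i ω ^ 2 := by
    generalize S.piece (π ω i) s ω = p at *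
    generalize S.β i s ω = b at *
    generalize k * s * S.ξ i ω = x at *
    generalize s * ∑ l, d l = e at *
    nlinarith [sq_nonneg (A - p), sq_nonneg (A + (b + x)), sq_nonneg (A + e),
      sq_nonneg (p + (b + x)), sq_nonneg (p + e), sq_nonneg (b + x - e), sq_nonneg (b - x)]
  refine (ENNReal.ofReal_le_ofReal hreal).trans ?_
  have hnn : 0 ≤ ∑ j, d j ^ 2 := Finset.sum_nonneg fun _ _ ↦ sq_nonneg _
  rw [ENNReal.ofReal_add (by positivity) (by positivity),
    ENNReal.ofReal_add (by positivity) (by positivity),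
    ENNReal.ofReal_add (by positivity) (by positivity),
    ENNReal.ofReal_add (by positivity) (by positivity)]
  simp only [ENNReal.ofReal_mul (show (0 : ℝ) ≤ 4 by norm_num),
    ENNReal.ofReal_mul (show (0 : ℝ) ≤ 8 by norm_num), ENNReal.ofReal_ofNat]
  gcongr
  · exact h₁ _ _ hs
  · exact h₂ _ _ hs
  · exact h₃ _

variable [IsProbabilityMeasure P]

theorem exists_dominating_piece_sq (hk : 1 ≤ k) : ∃ M : Ω → ℝ≥0∞, AEMeasurable M P ∧
    (∀ᵐ ω ∂P, ∀ a, ∀ s ∈ Set.Icc (0 : ℝ) (1 / k), ENNReal.ofReal (S.piece a s ω ^ 2) ≤ M ω) ∧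
    ∫⁻ ω, M ω ∂P ≤ ENNReal.ofReal (48 * (1 / k) * (Real.log k + 4)) := by
  have hk0 : (0 : ℝ) < 1 / k := by
    have : (0 : ℝ) < k := by exact_mod_cast hk
    positivity
  have : Nonempty (Fin k) := ⟨⟨0, hk⟩⟩
  have h := exists_dominating_gaussian_process_sq (P := P) (Y := S.piece) hk0
    (fun a ↦ by filter_upwards [S.ae_continuousOn_piece] with ω hω using hω a)
    (fun a ↦ by simp [piece])
    (fun a s hs t ht hst ↦ by
      obtain ⟨v, hv, hl⟩ := S.W'_increment_law (grid_add_mem a hs) (grid_add_mem a ht)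
        (by linarith)
      refine ⟨v, by linarith, ?_⟩
      simpa [piece] using hl)
  simpa using h

theorem exists_dominating_β_sq (hk : 1 ≤ k) : ∃ M : Ω → ℝ≥0∞, AEMeasurable M P ∧
    (∀ᵐ ω ∂P, ∀ i, ∀ s ∈ Set.Icc (0 : ℝ) (1 / k), ENNReal.ofReal (S.β i s ω ^ 2) ≤ M ω) ∧
    ∫⁻ ω, M ω ∂P ≤ ENNReal.ofReal (48 * (1 / k) * (Real.log k + 4)) := by
  have hk0 : (0 : ℝ) < 1 / k := by
    have : (0 : ℝ) < k := by exact_mod_cast hk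
    positivity
  have : Nonempty (Fin k) := ⟨⟨0, hk⟩⟩
  have h := exists_dominating_gaussian_process_sq (P := P) (Y := S.β) hk0
    (fun i ↦ (S.bridge_β i).continuous)
    (fun i ↦ (S.bridge_β i).ae_eq_zero ⟨le_rfl, hk0.le⟩ (Or.inl rfl))
    (fun i s hs t ht hst ↦ (S.bridge_β i).increment_law hk0 hs ht hst)
  simpa using h

theorem exists_dominating_ξ_sq (hk : 1 ≤ k) : ∃ M : Ω → ℝ≥0∞, AEMeasurable M P ∧
    (∀ ω i, ENNReal.ofReal (S.ξ i ω ^ 2) ≤ M ω) ∧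
    ∫⁻ ω, M ω ∂P ≤ ENNReal.ofReal (4 * (1 / k) * (Real.log k + 2)) := by
  have hk0 : (0 : ℝ) < 1 / k := by
    have : (0 : ℝ) < k := by exact_mod_cast hk
    positivity
  have : Nonempty (Fin k) := ⟨⟨0, hk⟩⟩
  obtain ⟨M, hM, -, hle, hint⟩ := exists_dominating_gaussian_sq (P := P) (g := S.ξ) hk0
    (fun i ↦ ⟨1 / k, by simp, by
      have h := (measurePreserving_eval (fun _ : Fin k ↦ gaussianReal 0 (1 / k)) i)
      exact h.hasLaw.comp S.hasLaw_ξ⟩)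
  refine ⟨fun ω ↦ ENNReal.ofReal (M ω), hM.ennreal_ofReal,
    fun ω i ↦ ENNReal.ofReal_le_ofReal (hle ω i), by simpa using hint⟩

theorem lintegral_supSqBridgeDist_le (hk : 2 ≤ k) (hπ : S.IsOrderMatching π) :
    ∫⁻ ω, S.supSqBridgeDist π ω ∂P ≤ ENNReal.ofReal (229600 * (Real.log k / k)) := by
  have hk1 : 1 ≤ k := by omega
  have hk0 : (0 : ℝ) < k := by exact_mod_cast hk1
  obtain ⟨M₁, hm₁, hd₁, hi₁⟩ := S.exists_dominating_piece_sq hk1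
  obtain ⟨M₂, hm₂, hd₂, hi₂⟩ := S.exists_dominating_β_sq hk1
  obtain ⟨M₃, hm₃, hd₃, hi₃⟩ := S.exists_dominating_ξ_sq hk1
  have hdm : Measurable fun ω ↦ ENNReal.ofReal (∑ j, S.incDiff π ω j ^ 2) := by
    have := S.measurable_incDiff hπ
    fun_prop
  have hlog : 1 ≤ 2 * Real.log k := by
    have h1 := Real.log_two_gt_d9
    have h2 : Real.log 2 ≤ Real.log k := Real.log_le_log (by norm_num) (by exact_mod_cast hk)
    linarith
  have hpi := Real.pi_le_four
  have hpi0 := Real.pi_pos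
  calc ∫⁻ ω, S.supSqBridgeDist π ω ∂P
      ≤ ∫⁻ ω, (4 * maxPartialSq (S.incDiff π ω) +
          4 * ENNReal.ofReal (∑ j, S.incDiff π ω j ^ 2) + 4 * M₁ ω + 8 * M₂ ω + 8 * M₃ ω) ∂P := by
        refine lintegral_mono_ae ?_
        filter_upwards [S.ae_ofReal_sq_le (π := π), hd₁, hd₂] with ω h h₁ h₂
        exact iSup₂_le fun t ht ↦ h hk1 t ht _ _ _ h₁ h₂ (hd₃ ω)
    _ = 4 * ∫⁻ ω, maxPartialSq (S.incDiff π ω) ∂P +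
          4 * ∫⁻ ω, ENNReal.ofReal (∑ j, S.incDiff π ω j ^ 2) ∂P + 4 * ∫⁻ ω, M₁ ω ∂P +
          8 * ∫⁻ ω, M₂ ω ∂P + 8 * ∫⁻ ω, M₃ ω ∂P := by
        rw [lintegral_add_right' _ (hm₃.const_mul _), lintegral_add_right' _ (hm₂.const_mul _),
          lintegral_add_right' _ (hm₁.const_mul _),
          lintegral_add_right' _ (hdm.aemeasurable.const_mul _)]
        simp only [lintegral_const_mul' (4 : ℝ≥0∞) _ (by simp),
          lintegral_const_mul' (8 : ℝ≥0∞) _ (by simp)]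
    _ ≤ 4 * (72 * ENNReal.ofReal (64 * Real.pi * (1 / k) * (1 + Real.log k))) +
          4 * ENNReal.ofReal (64 * Real.pi * (1 / k) * (1 + Real.log k)) +
          4 * ENNReal.ofReal (48 * (1 / k) * (Real.log k + 4)) +
          8 * ENNReal.ofReal (48 * (1 / k) * (Real.log k + 4)) +
          8 * ENNReal.ofReal (4 * (1 / k) * (Real.log k + 2)) := by
        gcongr
        · exact S.lintegral_maxPartialSq_incDiff_le hk hπ
        · exact S.lintegral_incDiff_sq_le hk1 hπ
    _ = ENNReal.ofReal (4 * (72 * (64 * Real.pi * (1 / k) * (1 + Real.log k))) +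
          4 * (64 * Real.pi * (1 / k) * (1 + Real.log k)) +
          4 * (48 * (1 / k) * (Real.log k + 4)) + 8 * (48 * (1 / k) * (Real.log k + 4)) +
          8 * (4 * (1 / k) * (Real.log k + 2))) := by
        have hl0 : 0 ≤ Real.log k := by linarith
        rw [ENNReal.ofReal_add (by positivity) (by positivity),
          ENNReal.ofReal_add (by positivity) (by positivity),
          ENNReal.ofReal_add (by positivity) (by positivity),
          ENNReal.ofReal_add (by positivity) (by positivity)]
        rw [ENNReal.ofReal_mul (p := 4) (by norm_num), ENNReal.ofReal_mul (p := 72) (by norm_num),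
          ENNReal.ofReal_mul (p := 4) (by norm_num), ENNReal.ofReal_mul (p := 4) (by norm_num),
          ENNReal.ofReal_mul (p := 8) (by norm_num), ENNReal.ofReal_mul (p := 8) (by norm_num)]
        simp only [ENNReal.ofReal_ofNat]
    _ ≤ ENNReal.ofReal (229600 * (Real.log k / k)) := by
        refine ENNReal.ofReal_le_ofReal ?_
        have hl0 : 0 ≤ Real.log k := by linarith
        have hA : 64 * Real.pi * (1 / k) * (1 + Real.log k) ≤ 768 * (Real.log k / k) := by
          calc 64 * Real.pi * (1 / k) * (1 + Real.log k)
              ≤ 64 * 4 * (1 / k) * (3 * Real.log k) := by gcongr; linarith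
            _ = 768 * (Real.log k / k) := by ring
        have hB : 48 * (1 / k) * (Real.log k + 4) ≤ 432 * (Real.log k / k) := by
          calc 48 * (1 / k) * (Real.log k + 4) ≤ 48 * (1 / k) * (9 * Real.log k) := by
                gcongr; linarith
            _ = 432 * (Real.log k / k) := by ring
        have hC : 4 * (1 / k) * (Real.log k + 2) ≤ 20 * (Real.log k / k) := by
          calc 4 * (1 / k) * (Real.log k + 2) ≤ 4 * (1 / k) * (5 * Real.log k) := by
                gcongr; linarith
            _ = 20 * (Real.log k / k) := by ring
        linarith

end CouplingInput

end

theorem proposition2p6 :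
    ∃ (C : ℝ) (k₀ : ℕ), ∀ k : ℕ, 1 ≤ k → k₀ ≤ k →
      ∀ (Ω : Type*) [MeasurableSpace Ω] (P : Measure Ω) [IsProbabilityMeasure P]
        (S : CouplingInput k P) (π : Ω → Equiv.Perm (Fin k)), S.IsOrderMatching π →
        AEMeasurable (S.supSqBridgeDist π) P ∧
          ∫⁻ ω, S.supSqBridgeDist π ω ∂P ≤ ENNReal.ofReal (C * (Real.log k / k)) := by
  exact ⟨229600, 2, fun _ _ hk _ _ _ _ S _ hπ ↦
    ⟨S.aemeasurable_supSqBridgeDist hπ, S.lintegral_supSqBridgeDist_le hk hπ⟩⟩
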